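/- Let $G$ be a Carnot group of step $m\ge 1$: a simply connected Lie group whose Lie algebra $\mathfrak g$ of left-invariant vector fields has a stratification $\mathfrak g=\mathfrak g_1\oplus\dots\oplus\mathfrak g_m$ with $\mathfrak g_i\ne\{0\}$ for $1\le i\le m$, $[\mathfrak g_1,\mathfrak g_j]=\mathfrak g_{j+1}$ for $1\le j\le m-1$, and $[\mathfrak g_1,\mathfrak g_m]=\{0\}$. Let $X_1,\dots,X_k$ be a basis of $\mathfrak g_1$; declaring it orthonormal defines a left-invariant (sub-)Riemannian structure on the distribution $D$ spanned by $X_1,\dots,X_k$ (we identify $D$ with $\mathfrak g_1$). Let $\mathcal V_0=\mathfrak g_2\oplus\dots\oplus\mathfrak g_m$, and for a linear map $\ell:\mathcal V_0\to D$ let $\mathcal V_\ell$ be the left-invariant sub-bundle of $TG$ generated by $\{X+\ell(X)\mid X\in\mathcal V_0\}$. Let $\mathcal P$ be Popp's volume, i.e. the left-invariant volume form of the scalar product on $\mathfrak g$ for which the layers are orthogonal and the norm on $\mathfrak g_j$ is $\|v\|=\min\{\|e\| : e\in\mathfrak g_1^{\otimes j},\ \pi_j(e)=v\}$, where $\pi_j(v_1\otimes\dots\otimes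 v_j)=[v_1,[v_2,\dots,[v_{j-1},v_j]]]$. Let $\Delta_{\mathcal P}=\mathrm{div}_{\mathcal P}\circ\mathrm{grad}$, where $\mathrm{grad}f=\sum_{i=1}^k X_i(f)X_i$ is the horizontal gradient and $\mathcal L_X\mathcal P=\mathrm{div}_{\mathcal P}(X)\,\mathcal P$. For a left-invariant complement $\mathcal V$ of $D$ (a left-invariant sub-bundle with $TG=D\oplus\mathcal V$), let $L^{\mathcal V}$ be the microscopic Laplacian $$(L^{\mathcal V}f)(q)=\lim_{t\to0^+}\frac{2k}{t^2}\int \big(f(\exp_q(t,\lambda))-f(q)\big)\,d\mu_q(\lambda),\qquad f\in C^\infty(G),\ q\in G,$$ where $\exp_q(t,\lambda)$ is the point at time $t$ of the normal geodesic with initial covector $\lambda$, i.e. the projection to $G$ of the integral curve from $\lambda\in T_q^*G$ of the Hamiltonian vector field of $H(\lambda)=\frac12\sum_{i=1}^k\langle\lambda,X_i\rangle^2$, and $\mu$ is any family of measures adapted to $\mathcal V$: $\mu_q$ is the product, on $\{\lambda\in T_q^*G: 2H(\lambda)=1\}=\mathbb S_q^{k-1}\times\mathbf v_q$, of the uniform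 probability measure on the unit sphere $\mathbb S_q^{k-1}$ (with respect to $2H$) of the annihilator of $\mathcal V_q$ and of a probability measure on the annihilator $\mathbf v_q$ of $D_q$ for which all linear functions are square integrable; moreover $q\mapsto\int F^2\,d\mu_q$ is continuous for every continuous fibrewise linear $F:T^*G\to\mathbb R$. We call $\mathcal V$ compatible (with Popp's volume) if $\Delta_{\mathcal P}=L^{\mathcal V}$, that is, if for every adapted family $\mu$ the limit above exists and equals $\Delta_{\mathcal P}f(q)$ for all $f\in C^\infty(G)$ and $q\in G$. Then: (1) Every left-invariant complement of $D$ equals $\mathcal V_\ell$ for exactly one linear map $\ell:\mathcal V_0\to D$ (and every $\mathcal V_\ell$ is a left-invariant complement). (2) $\mathcal V_\ell$ is compatible if and only if $\mathrm{tr}(\ell\circ\mathrm{ad}_{X_i})=0$ for all $i=1,\dots,k$. (3) Compatible left-invariant complements are in general not unique. If $\ell$ vanishes on $\mathfrak g_2$, then $\mathcal V_\ell$ is compatible; if $m\ge3$, there is such an $\ell\neq0$, and there are at least two distinct compatible left-invariant complements. (4) (Corank one.) Suppose $m=2$, $\mathfrak g_2=\mathrm{span}\{X_0\}$ and $[X_i,X_j]=A_{ij}X_0$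 for $i,j=1,\dots,k$. The left-invariant complements are exactly the left-invariant bundles $\mathrm{span}\{X_0+\sum_{j=1}^k\ell_jX_j\}$ with $(\ell_j)\in\mathbb R^k$ (distinct vectors giving distinct bundles), and such a complement is compatible if and only if $(\ell_j)\in\ker A$. In particular, there is exactly one compatible left-invariant complement if and only if $\ker A=\{0\}$. -/

import Mathlib

open scoped Manifold ContDiff Topology
open MeasureTheory VectorField

set_option linter.unusedSectionVars false

noncomputable section

/-- A smooth real Lie group has the regularity which Mathlib asks for in order to define its
Lie algebra. -/
instance minSmoothnessLEInfty : ENat.LEInfty (minSmoothness ℝ 3) :=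
  ⟨by rw [minSmoothness_of_isRCLikeNormedField]; exact ENat.LEInfty.out⟩

namespace CarnotGroup

/-- Covectors at a point of an `n`-dimensional manifold. In Mathlib every tangent space of a
manifold modelled on `ℝⁿ` is (a type synonym of) `ℝⁿ`, so every cotangent space is the dual
of `ℝⁿ`. -/
abbrev Covector (n : ℕ) : Type := EuclideanSpace ℝ (Fin n) →L[ℝ] ℝ

variable {n : ℕ} {G : Type*} [TopologicalSpace G] [ChartedSpace (EuclideanSpace ℝ (Fin n)) G]
  [Group G]

instance finiteDimensionalTangentSpace (q : G) : FiniteDimensional ℝ (TangentSpace (𝓡 n) q) :=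
  inferInstanceAs (FiniteDimensional ℝ (EuclideanSpace ℝ (Fin n)))

/-! ### Left translations -/

/-- The differential at the identity of the left translation by `q`. -/
def leftDiff (q : G) : GroupLieAlgebra (𝓡 n) G →L[ℝ] TangentSpace (𝓡 n) q :=
  mfderiv (𝓡 n) (𝓡 n) (M := G) (M' := G) (fun x => q * x) 1

/-- The differential at `q` of the left translation by `q⁻¹`. -/
def leftDiffInv (q : G) : TangentSpace (𝓡 n) q →L[ℝ] GroupLieAlgebra (𝓡 n) G :=
  mfderiv (𝓡 n) (𝓡 n) (M := G) (M' := G) (fun x => q⁻¹ * x) q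

/-- The left-invariant family of subspaces of the tangent spaces that is generated by a subspace
of the Lie algebra. -/
def leftTranslates (W : Submodule ℝ (GroupLieAlgebra (𝓡 n) G)) (q : G) :
    Submodule ℝ (TangentSpace (𝓡 n) q) :=
  W.map (leftDiff (n := n) q).toLinearMap

variable [LieGroup (𝓡 n) ∞ G]

/-- Smooth vector fields on `G`. -/
def SmoothField (Y : ∀ q : G, TangentSpace (𝓡 n) q) : Prop :=
  ContMDiff (𝓡 n) (𝓡 n).tangent ∞
    (fun q => (Bundle.TotalSpace.mk' (EuclideanSpace ℝ (Fin n)) q (Y q) : TangentBundle (𝓡 n) G))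

/-- Continuous vector fields on `G`. -/
def ContinuousField (Y : ∀ q : G, TangentSpace (𝓡 n) q) : Prop :=
  Continuous
    (fun q => (Bundle.TotalSpace.mk' (EuclideanSpace ℝ (Fin n)) q (Y q) : TangentBundle (𝓡 n) G))


lemma mdiff_left (p q : G) :
    MDifferentiableAt (𝓡 n) (𝓡 n) (M := G) (M' := G) (fun x => p * x) q :=
  (contMDiff_mul_left (I := 𝓡 n) (n := ∞) (a := p)).contMDiffAt.mdifferentiableAt (by simp)

lemma mfderiv_left_comp (p q r : G) :
    mfderiv (𝓡 n) (𝓡 n) (M := G) (M' := G) (fun x => p * q * x) r =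
      (mfderiv (𝓡 n) (𝓡 n) (M := G) (M' := G) (fun x => p * x) (q * r)).comp
        (mfderiv (𝓡 n) (𝓡 n) (M := G) (M' := G) (fun x => q * x) r) := by
  have : (fun x : G => p * q * x) = (fun x => p * x) ∘ (fun x => q * x) := by
    ext x; simp [mul_assoc]
  rw [this, mfderiv_comp (I' := 𝓡 n) _ (mdiff_left _ _) (mdiff_left _ _)]

lemma mfderiv_left_leftDiff (p q : G) (v : GroupLieAlgebra (𝓡 n) G) :
    mfderiv (𝓡 n) (𝓡 n) (M := G) (M' := G) (fun x => p * x) q (leftDiff q v) =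
      leftDiff (p * q) v := by
  have key : ∀ r : G, r = q * 1 →
      (mfderiv (𝓡 n) (𝓡 n) (M := G) (M' := G) (fun x => p * x) r :
        EuclideanSpace ℝ (Fin n) →L[ℝ] EuclideanSpace ℝ (Fin n)) (leftDiff q v) =
      leftDiff (p * q) v := by
    rintro _ rfl
    exact (congrArg (fun f : EuclideanSpace ℝ (Fin n) →L[ℝ] EuclideanSpace ℝ (Fin n) => f v)
      (mfderiv_left_comp (n := n) p q (1 : G))).symm
  exact key q (mul_one q).symm

lemma leftDiffInv_leftDiff (q : G) (v : GroupLieAlgebra (𝓡 n) G) :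
    leftDiffInv q (leftDiff q v) = v := by
  have h1 : ∀ r : G, r = 1 → (leftDiff (n := n) r :
      EuclideanSpace ℝ (Fin n) →L[ℝ] EuclideanSpace ℝ (Fin n)) v = v := by
    rintro _ rfl
    have : (fun x : G => 1 * x) = id := by ext x; simp
    have h2 : mfderiv (𝓡 n) (𝓡 n) (M := G) (M' := G) (fun x => 1 * x) (1 : G) =
        ContinuousLinearMap.id ℝ (TangentSpace (𝓡 n) (1 : G)) := by
      rw [this]; exact mfderiv_id
    exact congrArg (fun f : EuclideanSpace ℝ (Fin n) →L[ℝ] EuclideanSpace ℝ (Fin n) => f v) h2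
  exact (mfderiv_left_leftDiff q⁻¹ q v).trans (h1 _ (inv_mul_cancel q))

lemma leftDiff_leftDiffInv (q : G) (v : TangentSpace (𝓡 n) q) :
    leftDiff q (leftDiffInv q v) = v := by
  have hinj : Function.Injective (leftDiff (n := n) q).toLinearMap :=
    Function.LeftInverse.injective (g := leftDiffInv q) (leftDiffInv_leftDiff q)
  have hs : Function.Surjective (leftDiff (n := n) q).toLinearMap :=
    LinearMap.injective_iff_surjective (K := ℝ) (V := EuclideanSpace ℝ (Fin n)).1 hinj
  obtain ⟨w, rfl⟩ := hs v
  exact congrArg _ (leftDiffInv_leftDiff q w)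

/-- The differential of the left translation by `q`, as an isomorphism from the Lie algebra to
the tangent space at `q`. -/
def leftEquiv (q : G) : GroupLieAlgebra (𝓡 n) G ≃ₗ[ℝ] TangentSpace (𝓡 n) q :=
  LinearEquiv.ofBijective (leftDiff (n := n) q).toLinearMap
    ⟨Function.LeftInverse.injective (g := leftDiffInv q) (leftDiffInv_leftDiff q),
      fun v => ⟨leftDiffInv q v, leftDiff_leftDiffInv q v⟩⟩

lemma isCompl_leftTranslates {U W : Submodule ℝ (GroupLieAlgebra (𝓡 n) G)} (h : IsCompl U W)
    (q : G) : IsCompl (leftTranslates U q) (leftTranslates W q) :=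
  (OrderIso.isCompl_iff (Submodule.orderIsoMapComap (leftEquiv (n := n) q))).1 h

lemma map_leftTranslates (W : Submodule ℝ (GroupLieAlgebra (𝓡 n) G)) (p q : G) :
    (leftTranslates W q).map
      (mfderiv (𝓡 n) (𝓡 n) (M := G) (M' := G) (fun x => p * x) q).toLinearMap =
      leftTranslates W (p * q) := by
  ext v
  simp only [leftTranslates, Submodule.mem_map]
  constructor
  · rintro ⟨_, ⟨w, hw, rfl⟩, rfl⟩
    exact ⟨w, hw, (mfderiv_left_leftDiff p q w).symm⟩
  · rintro ⟨w, hw, rfl⟩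
    exact ⟨_, ⟨w, hw, rfl⟩, mfderiv_left_leftDiff p q w⟩

/-! ### Carnot groups -/

variable (n G) in
/-- A stratification of the Lie algebra of `G`, together with a left-invariant sub-Riemannian
structure on the first layer, given by declaring a basis of the first layer orthonormal.
The layers are `layer 1, …, layer step`; it is convenient to index them by `ℕ`, with zero
subspaces elsewhere. -/
structure CarnotStructure where
  /-- The step. -/
  step : ℕ
  one_le_step : 1 ≤ step
  /-- The layers of the stratification. -/
  layer : ℕ → Submodule ℝ (GroupLieAlgebra (𝓡 n) G)
  layer_ne_bot : ∀ j, 1 ≤ j → j ≤ step → layer j ≠ ⊥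
  layer_eq_bot : ∀ j, j = 0 ∨ step < j → layer j = ⊥
  isInternal : DirectSum.IsInternal layer
  bracket_layer : ∀ j, 1 ≤ j →
    Submodule.span ℝ {z | ∃ x ∈ layer 1, ∃ y ∈ layer j, ⁅x, y⁆ = z} = layer (j + 1)
  /-- The rank of the distribution. -/
  rank : ℕ
  /-- The global orthonormal frame of the distribution. -/
  frame : Module.Basis (Fin rank) ℝ (layer 1)

namespace CarnotStructure

variable (S : CarnotStructure n G)

/-- The `i`-th element of the orthonormal frame, as an element of the Lie algebra. -/
def X (i : Fin S.rank) : GroupLieAlgebra (𝓡 n) G := S.frame i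

/-- The `i`-th element of the orthonormal frame, as a left-invariant vector field. -/
def XField (i : Fin S.rank) (q : G) : TangentSpace (𝓡 n) q := leftDiff q (S.X i)

/-- The horizontal distribution `D`. -/
def horizontal (q : G) : Submodule ℝ (TangentSpace (𝓡 n) q) := leftTranslates (S.layer 1) q

/-- The basis `X₁(q), …, X_k(q)` of the distribution at `q`. -/
def frameAt (q : G) : Module.Basis (Fin S.rank) ℝ (S.horizontal q) :=
  S.frame.map ((leftEquiv q).submoduleMap (S.layer 1))

/-- The space `V₀`, the sum of the layers of order at least two. -/
def V₀ : Submodule ℝ (GroupLieAlgebra (𝓡 n) G) := ⨆ j : ℕ, S.layer (j + 2)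

lemma layer_le_V₀ {j : ℕ} (hj : 2 ≤ j) : S.layer j ≤ S.V₀ := by
  obtain ⟨i, rfl⟩ := Nat.exists_eq_add_of_le' hj
  exact le_iSup (fun j : ℕ => S.layer (j + 2)) i

lemma isCompl_V₀ : IsCompl (S.layer 1) S.V₀ := by
  have hind := S.isInternal.submodule_iSupIndep
  have htop := S.isInternal.submodule_iSup_eq_top
  constructor
  · exact (hind 1).mono_right (iSup_le fun j => le_iSup₂_of_le (j + 2) (by omega) le_rfl)
  · rw [codisjoint_iff, eq_top_iff, ← htop]
    refine iSup_le fun j => ?_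
    rcases Nat.lt_or_ge j 2 with hj | hj
    · interval_cases j
      · rw [S.layer_eq_bot 0 (Or.inl rfl)]; exact bot_le
      · exact le_sup_left
    · exact (S.layer_le_V₀ hj).trans le_sup_right

lemma bracket_mem_V₀ {x : GroupLieAlgebra (𝓡 n) G} (hx : x ∈ S.layer 1)
    (y : GroupLieAlgebra (𝓡 n) G) : ⁅x, y⁆ ∈ S.V₀ := by
  have hy : y ∈ ⨆ j, S.layer j := by
    rw [S.isInternal.submodule_iSup_eq_top]; exact Submodule.mem_top
  induction hy using Submodule.iSup_induction' with
  | mem j y hy =>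
    rcases Nat.eq_zero_or_pos j with rfl | hj
    · rw [S.layer_eq_bot 0 (Or.inl rfl), Submodule.mem_bot] at hy
      rw [hy, lie_zero]; exact Submodule.zero_mem _
    · apply S.layer_le_V₀ (j := j + 1) (by omega)
      rw [← S.bracket_layer j hj]
      exact Submodule.subset_span ⟨x, hx, y, hy, rfl⟩
  | zero => rw [lie_zero]; exact Submodule.zero_mem _
  | add y z _ _ hy hz => rw [lie_add]; exact Submodule.add_mem _ hy hz

/-- The endomorphism `ad_{X_i}` of the Lie algebra, as a map into `V₀`. -/
def adX (i : Fin S.rank) : GroupLieAlgebra (𝓡 n) G →ₗ[ℝ] S.V₀ :=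
  (LieAlgebra.ad ℝ (GroupLieAlgebra (𝓡 n) G) (S.X i) :
    GroupLieAlgebra (𝓡 n) G →ₗ[ℝ] GroupLieAlgebra (𝓡 n) G).codRestrict S.V₀
    fun y => S.bracket_mem_V₀ (S.frame i).2 y

/-- The endomorphism `ℓ ∘ ad_{X_i}` of the Lie algebra. -/
def compAd (l : S.V₀ →ₗ[ℝ] S.layer 1) (i : Fin S.rank) :
    GroupLieAlgebra (𝓡 n) G →ₗ[ℝ] GroupLieAlgebra (𝓡 n) G :=
  (S.layer 1).subtype ∘ₗ l ∘ₗ S.adX i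

/-! ### Left-invariant complements -/

/-- Left-invariant complements of the distribution. -/
@[ext]
structure LeftInvariantComplement where
  /-- The fibre at a point. -/
  fiber : ∀ q : G, Submodule ℝ (TangentSpace (𝓡 n) q)
  isCompl : ∀ q, IsCompl (S.horizontal q) (fiber q)
  leftInvariant : ∀ p q, (fiber q).map
    (mfderiv (𝓡 n) (𝓡 n) (M := G) (M' := G) (fun x => p * x) q).toLinearMap = fiber (p * q)

/-- The graph `{v + ℓ v | v ∈ V₀}` in the Lie algebra. -/
def graph (l : S.V₀ →ₗ[ℝ] S.layer 1) : Submodule ℝ (GroupLieAlgebra (𝓡 n) G) :=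
  LinearMap.range (S.V₀.subtype + (S.layer 1).subtype ∘ₗ l)

lemma isCompl_graph (l : S.V₀ →ₗ[ℝ] S.layer 1) : IsCompl (S.layer 1) (S.graph l) := by
  constructor
  · rw [Submodule.disjoint_def]
    rintro _ hx ⟨v, rfl⟩
    have hv : (v : GroupLieAlgebra (𝓡 n) G) ∈ S.layer 1 := by
      have := Submodule.sub_mem _ hx (l v).2
      simpa using this
    have h0 := Submodule.disjoint_def.1 S.isCompl_V₀.disjoint _ hv v.2
    have h1 : v = 0 := Subtype.ext h0
    simp [h1]
  · rw [codisjoint_iff, eq_top_iff]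
    intro x _
    have hx : x ∈ S.layer 1 ⊔ S.V₀ := by
      rw [S.isCompl_V₀.sup_eq_top]; exact Submodule.mem_top
    obtain ⟨a, ha, b, hb, rfl⟩ := Submodule.mem_sup.1 hx
    refine Submodule.mem_sup.2 ⟨a - l ⟨b, hb⟩, Submodule.sub_mem _ ha (l _).2,
      _, ⟨⟨b, hb⟩, rfl⟩, ?_⟩
    simp

/-- The left-invariant complement `V_ℓ`. -/
def graphComplement (l : S.V₀ →ₗ[ℝ] S.layer 1) : S.LeftInvariantComplement where
  fiber := leftTranslates (S.graph l)
  isCompl := isCompl_leftTranslates (S.isCompl_graph l)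
  leftInvariant := map_leftTranslates (S.graph l)

/-! ### Popp's volume -/

/-- The iterated bracket `[v₁, [v₂, …, [v_{j-1}, v_j]]]`. -/
def nestedBracket : List (GroupLieAlgebra (𝓡 n) G) → GroupLieAlgebra (𝓡 n) G
  | [] => 0
  | [v] => v
  | v :: w :: t => ⁅v, nestedBracket (w :: t)⁆

/-- The map `π_j` from the `j`-th tensor power of the first layer to the `j`-th layer, which sends
`v₁ ⊗ ⋯ ⊗ v_j` to the iterated bracket of the `v_i`. The tensor power has the orthonormal basis
of the `X_{w 1} ⊗ ⋯ ⊗ X_{w j}`, and is identified with the Euclidean space of coefficients. -/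
def tensorBracket (j : ℕ) (a : EuclideanSpace ℝ (Fin j → Fin S.rank)) :
    GroupLieAlgebra (𝓡 n) G :=
  ∑ w, a w • nestedBracket (List.ofFn fun i => S.X (w i))

/-- The norm on the `j`-th layer induced by `π_j`: the least norm of a preimage. -/
def layerNorm (j : ℕ) (v : GroupLieAlgebra (𝓡 n) G) : ℝ :=
  sInf {r | ∃ a, S.tensorBracket j a = v ∧ ‖a‖ = r}

/-- The scalar product on the `j`-th layer that induces this norm. -/
def layerInner (j : ℕ) (v w : GroupLieAlgebra (𝓡 n) G) : ℝ :=
  (S.layerNorm j (v + w) ^ 2 - S.layerNorm j (v - w) ^ 2) / 4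

/-- The component in the `j`-th layer. -/
def component (j : ℕ) (v : GroupLieAlgebra (𝓡 n) G) : GroupLieAlgebra (𝓡 n) G :=
  (LinearEquiv.ofBijective (DirectSum.coeLinearMap S.layer) S.isInternal).symm v j

/-- The scalar product of the orthogonal direct sum of the layers. -/
def scalarProduct (v w : GroupLieAlgebra (𝓡 n) G) : ℝ :=
  ∑ j ∈ Finset.Icc 1 S.step, S.layerInner j (S.component j v) (S.component j w)

variable (n G) in
/-- An auxiliary basis of the Lie algebra. -/
def auxBasis : Module.Basis (Fin (Module.finrank ℝ (GroupLieAlgebra (𝓡 n) G))) ℝ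
    (GroupLieAlgebra (𝓡 n) G) :=
  Module.finBasis ℝ (GroupLieAlgebra (𝓡 n) G)

/-- Popp's volume form at the identity: the volume form of the scalar product, that is
`√(det g_{ab}) e¹ ∧ ⋯ ∧ eⁿ` in a basis `e` with Gram matrix `g_{ab}`. It is defined up to a sign,
which is irrelevant and is chosen here so that the auxiliary basis is positive. -/
def poppAtOne : GroupLieAlgebra (𝓡 n) G
    [⋀^Fin (Module.finrank ℝ (GroupLieAlgebra (𝓡 n) G))]→ₗ[ℝ] ℝ :=
  √(Matrix.of fun a b => S.scalarProduct (auxBasis n G a) (auxBasis n G b)).det •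
    (auxBasis n G).det

variable (n G) in
/-- Differential forms of top degree on `G` (without regularity). -/
abbrev TopForm : Type _ :=
  ∀ q : G, TangentSpace (𝓡 n) q
    [⋀^Fin (Module.finrank ℝ (GroupLieAlgebra (𝓡 n) G))]→ₗ[ℝ] ℝ

/-- Popp's volume form, the left-invariant extension of its value at the identity. -/
def popp : TopForm n G := fun q =>
  S.poppAtOne.compLinearMap (leftDiffInv (n := n) q).toLinearMap

/-! ### The macroscopic Laplacian -/

/-- The function `X f`. -/
def derivAlong (Y : ∀ q : G, TangentSpace (𝓡 n) q) (f : G → ℝ) (q : G) : ℝ :=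
  mfderiv (𝓡 n) 𝓘(ℝ, ℝ) f q (Y q)

/-- The Lie derivative along `X` of a form of top degree, evaluated on vector fields:
`(L_X ω)(Y₁, …, Yₙ) = X (ω(Y₁, …, Yₙ)) - ∑ ω(Y₁, …, [X, Y_a], …, Yₙ)`. -/
def lieDerivative (w : TopForm n G) (X : ∀ q : G, TangentSpace (𝓡 n) q)
    (Y : Fin (Module.finrank ℝ (GroupLieAlgebra (𝓡 n) G)) → ∀ q : G, TangentSpace (𝓡 n) q)
    (q : G) : ℝ :=
  derivAlong X (fun p => w p fun a => Y a p) q -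
    ∑ a, w q (Function.update (fun b => Y b q) a (mlieBracket (𝓡 n) X (Y a) q))

/-- The divergence, defined by `L_X ω = (div X) ω`. Both sides are tensors, and the factor is read
off on a left-invariant frame. -/
def divergence (w : TopForm n G) (X : ∀ q : G, TangentSpace (𝓡 n) q) (q : G) : ℝ :=
  lieDerivative w X (fun a p => leftDiff p (auxBasis n G a)) q /
    w q fun a => leftDiff q (auxBasis n G a)

/-- The horizontal gradient: the horizontal field whose scalar product with each horizontal `Y` is
`Y f`; in the orthonormal frame, `grad f = ∑ X_i(f) X_i`. -/
def grad (f : G → ℝ) (q : G) : TangentSpace (𝓡 n) q :=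
  ∑ i, derivAlong (S.XField i) f q • S.XField i q

/-- The macroscopic Laplacian `Δ_ω = div_ω ∘ grad`. -/
def macroLaplacian (w : TopForm n G) (f : G → ℝ) : G → ℝ := divergence w (S.grad f)

/-! ### Normal geodesics

The Hamiltonian is `H = (1/2) ∑ h_i ^ 2` with `h_i(λ) = ⟨λ, X_i⟩`. -/

/-- On the set `J` of times, `(γ(t), Λ(t))` is an integral curve in the cotangent bundle of the
Hamiltonian vector field of `H`. Hamilton's equations `da/dt = {H, a}` are written for the
functions on the base and for the functions `h_Y(λ) = ⟨λ, Y⟩` with `Y` a smooth vector field,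
with `{h_X, f} = X f` and `{h_X, h_Y} = h_{[X, Y]}`. -/
def IsNormalExtremalOn (γ : ℝ → G) (Λ : ℝ → Covector n) (J : Set ℝ) : Prop :=
  ∀ t ∈ J,
    HasMFDerivAt 𝓘(ℝ, ℝ) (𝓡 n) γ t
      ((1 : ℝ →L[ℝ] ℝ).smulRight
        (∑ i, Λ t (S.XField i (γ t)) • S.XField i (γ t) : TangentSpace (𝓡 n) (γ t))) ∧
    ∀ Y : ∀ q : G, TangentSpace (𝓡 n) q, SmoothField Y →
      HasDerivAt (fun s => Λ s (Y (γ s)))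
        (∑ i, Λ t (S.XField i (γ t)) * Λ t (mlieBracket (𝓡 n) (S.XField i) Y (γ t))) t

/-- The normal geodesic with initial point `q` and initial covector `l` is defined up to time `t`
(`0 ≤ t`), and `p` is the point that it reaches at time `t`. -/
def ReachedByNormalGeodesic (q : G) (l : Covector n) (t : ℝ) (p : G) : Prop :=
  ∃ (γ : ℝ → G) (Λ : ℝ → Covector n) (δ : ℝ), 0 < δ ∧
    S.IsNormalExtremalOn γ Λ (Set.Ioo (-δ) (t + δ)) ∧ γ 0 = q ∧ Λ 0 = l ∧ γ t = p

open Classical in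
/-- The exponential map `exp_q(t, l)` (with an irrelevant value where the normal geodesic is not
defined up to time `t`). -/
def normalExp (q : G) (t : ℝ) (l : Covector n) : G :=
  if h : ∃ p, S.ReachedByNormalGeodesic q l t p then h.choose else q

/-! ### The microscopic Laplacian -/

/-- The vertical covectors at `q`, which annihilate the distribution. -/
def vertical (q : G) : Submodule ℝ (Covector n) where
  carrier := {l | ∀ v ∈ S.horizontal q, l v = 0}
  add_mem' := by
    intro a b ha hb v hv
    exact (congrArg₂ (· + ·) (ha v hv) (hb v hv)).trans (add_zero 0)
  zero_mem' := fun _ _ => rfl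
  smul_mem' := by
    intro c a ha v hv
    exact (congrArg (c * ·) (ha v hv)).trans (mul_zero c)

variable {S}

/-- The horizontal covector at `q` (that is, vanishing on the complement) which takes the values
`s_i` on the `X_i`. For `s` in the unit sphere these are the points of the sphere of
horizontal covectors with `2 H = 1`. -/
def LeftInvariantComplement.horizontalCovector (V : S.LeftInvariantComplement) (q : G)
    (s : EuclideanSpace ℝ (Fin S.rank)) : Covector n :=
  LinearMap.toContinuousLinearMap
    ((S.frameAt q).constr ℝ (fun i => s i) ∘ₗ
      (S.horizontal q).projectionOnto (V.fiber q) (V.isCompl q))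

/-- The uniform probability measure on the unit sphere of `ℝᵏ`. -/
def sphereMeasure (k : ℕ) : Measure (Metric.sphere (0 : EuclideanSpace ℝ (Fin k)) 1) :=
  ((volume : Measure (EuclideanSpace ℝ (Fin k))).toSphere Set.univ)⁻¹ •
    (volume : Measure (EuclideanSpace ℝ (Fin k))).toSphere

variable (S) in
/-- The model of the fibre at `q` of the unit cotangent bundle, as the product of the unit sphere
of `ℝᵏ` (which stands for the sphere of horizontal covectors) and of the vertical covectors. -/
abbrev Cylinder (q : G) : Type :=
  Metric.sphere (0 : EuclideanSpace ℝ (Fin S.rank)) 1 × S.vertical q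

/-- The unit covector corresponding to a point of the cylinder. -/
def LeftInvariantComplement.covector (V : S.LeftInvariantComplement) (q : G)
    (x : S.Cylinder q) : Covector n :=
  V.horizontalCovector q (x.1 : EuclideanSpace ℝ (Fin S.rank)) + (x.2 : Covector n)

/-- The product of the uniform measure on the sphere and of a measure on the vertical
covectors. -/
def cylinderMeasure (q : G) (μ : Measure (S.vertical q)) : Measure (S.Cylinder q) :=
  (sphereMeasure S.rank).prod μ

/-- Families of measures adapted to the splitting. The family is given by its vertical parts,
which are 2-decreasing probability measures on the spaces of vertical covectors. Continuous
fibrewise linear functions on the cotangent bundle are given by continuous vector fields. -/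
structure LeftInvariantComplement.IsAdapted (V : S.LeftInvariantComplement)
    (μ : ∀ q : G, Measure (S.vertical q)) : Prop where
  isProbabilityMeasure : ∀ q, IsProbabilityMeasure (μ q)
  twoDecreasing : ∀ q, ∀ f : S.vertical q →ₗ[ℝ] ℝ, MemLp f 2 (μ q)
  continuous : ∀ Y : ∀ q : G, TangentSpace (𝓡 n) q, ContinuousField Y →
    Continuous fun q => ∫ x, (V.covector q x (Y q)) ^ 2 ∂(cylinderMeasure q (μ q))

/-- `L` is the microscopic Laplacian `L^V` of the complement `V`: for every adapted family of
measures, every smooth function `f` and every point `q`,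
`L f (q) = lim_{t → 0+} (2k/t²) ∫ (f(exp_q(t, λ)) - f(q)) dμ_q(λ)`. -/
def LeftInvariantComplement.IsMicroLaplacian (V : S.LeftInvariantComplement)
    (L : (G → ℝ) → G → ℝ) : Prop :=
  ∀ μ : ∀ q : G, Measure (S.vertical q), V.IsAdapted μ →
    ∀ f : G → ℝ, ContMDiff (𝓡 n) 𝓘(ℝ, ℝ) ∞ f → ∀ q : G,
      Filter.Tendsto
        (fun t : ℝ => 2 * (S.rank : ℝ) / t ^ 2 *
          ∫ x, (f (S.normalExp q t (V.covector q x)) - f q) ∂(cylinderMeasure q (μ q)))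
        (𝓝[>] 0) (𝓝 (L f q))

/-- The complement `V` is compatible with Popp's volume: `Δ_P = L^V`. -/
def LeftInvariantComplement.CompatibleWithPopp (V : S.LeftInvariantComplement) : Prop :=
  V.IsMicroLaplacian (S.macroLaplacian S.popp)

end CarnotStructure
end CarnotGroup

end

noncomputable section

/-! ### Left-invariant complements as graphs over `V₀`, and the trace condition. -/

namespace CarnotGroup

variable {n : ℕ} {G : Type*} [TopologicalSpace G] [ChartedSpace (EuclideanSpace ℝ (Fin n)) G]
  [Group G] [LieGroup (𝓡 n) ∞ G]

/-! Both Laplacians can be computed in the left-invariant frame, and they differ by an explicit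
first-order term.

Macroscopic side. Popp's form is constant on left-invariant frames, so the divergence of `X_i` is
`-tr(ad X_i)`. This is zero because `ad X_i` raises the layer by one. Hence `Δ_P f = ∑ X_i X_i f`
(`macroLaplacian_popp`). Of Popp's volume only left invariance and nondegeneracy
(`det_scalarProduct_pos`) matter.

Microscopic side. After left trivialization a normal extremal satisfies `ξ' = ξ ∘ ad(u)`, where `u =
∑ u_i X_i` and `u_i = ξ(X_i)`, and its projection moves with velocity `u`. The second derivative of
`f` along it is `∑ u_i u_j X_j X_i f + ∑ u_j ξ([X_j, X_i]) X_i f`. On the cylinder `u` is uniform on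
the sphere: its mean is zero and its second moments are `δ_ij / k`. For `v` in `V₀` one has `ξ(v) =
-⟨u, ℓ v⟩ + η(v)` with `η` vertical and independent of `u`. Averaging therefore gives `L^V f = ∑ X_i
X_i f + ∑ tr(ℓ ∘ ad X_i) X_i f` (`integral_secondVariation`, `tendsto_microLaplacian`).

The two operators agree exactly when every trace vanishes, because smooth functions detect each
nonzero horizontal vector and an adapted family exists (`isAdapted_dirac`). By cyclicity the trace
is taken over the first layer, so it involves only `ℓ` on the brackets `[X_i, X_j]`, that is, on the
second layer. This gives nonuniqueness from step three on, and the condition `A c = 0` in corank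
one.

The analytic difficulty is that the vertical covectors are unbounded. The system is linear in `ξ`
once `u` is controlled, and `|u|` is conserved. Rescaling `ξ` then yields a lifetime independent of
the covector (`exists_uniform_momentum_flow`) and a remainder of order `t ^ 2` growing linearly in
`‖ξ‖`. Finite second moments make this integrable, and dominated convergence applies. -/

lemma leftDiff_one (v : GroupLieAlgebra (𝓡 n) G) : leftDiff (1 : G) v = v := by
  have : (fun x : G => 1 * x) = id := by ext x; simp
  have h2 : mfderiv (𝓡 n) (𝓡 n) (M := G) (M' := G) (fun x => 1 * x) (1 : G) =
      ContinuousLinearMap.id ℝ (TangentSpace (𝓡 n) (1 : G)) := by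
    rw [this]; exact mfderiv_id
  exact congrArg (fun f : EuclideanSpace ℝ (Fin n) →L[ℝ] EuclideanSpace ℝ (Fin n) => f v) h2

lemma leftTranslates_one (W : Submodule ℝ (GroupLieAlgebra (𝓡 n) G)) :
    leftTranslates W (1 : G) = W := by
  ext v
  constructor
  · rintro ⟨w, hw, rfl⟩
    exact (leftDiff_one (n := n) (G := G) w).symm ▸ hw
  · intro hv
    exact ⟨v, hv, leftDiff_one v⟩

lemma leftTranslates_injective {U W : Submodule ℝ (GroupLieAlgebra (𝓡 n) G)}
    (h : leftTranslates (n := n) (G := G) U = leftTranslates W) : U = W := by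
  have := congrFun h 1
  rwa [leftTranslates_one, leftTranslates_one] at this

namespace CarnotStructure

variable (S : CarnotStructure n G)

lemma LeftInvariantComplement.fiber_eq {S : CarnotStructure n G} (V : S.LeftInvariantComplement) :
    V.fiber = leftTranslates (V.fiber 1) := by
  funext q
  have h : (leftTranslates (V.fiber 1) q : Submodule ℝ (EuclideanSpace ℝ (Fin n))) =
      V.fiber (q * 1) := V.leftInvariant q 1
  -- The fibres over `q * 1` and `q` have different types; they are compared in the common model
  -- `ℝⁿ`, by substitution.
  have key : ∀ r : G, r = q → (V.fiber r : Submodule ℝ (EuclideanSpace ℝ (Fin n))) =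
      V.fiber q := by rintro _ rfl; rfl
  exact (h.trans (key _ (mul_one q))).symm

/-- Subtracting from `v` its projection `p v` to the first layer along `W` lands in `W`, so `ℓ` is
`-p` restricted to `V₀`. -/
lemma exists_eq_graph {W : Submodule ℝ (GroupLieAlgebra (𝓡 n) G)} (hW : IsCompl (S.layer 1) W) :
    ∃ l : S.V₀ →ₗ[ℝ] S.layer 1, W = S.graph l := by
  set p := (S.layer 1).projectionOnto W hW with hp
  have hsub : ∀ v, v - (p v : GroupLieAlgebra (𝓡 n) G) ∈ W := by
    intro v
    rw [← Submodule.ker_projectionOnto hW, LinearMap.mem_ker, map_sub, ← hp,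
      hp, Submodule.projectionOnto_apply_left, sub_self]
  refine ⟨-(p ∘ₗ S.V₀.subtype), le_antisymm ?_ ?_⟩
  · intro w hw
    have hx : w ∈ S.layer 1 ⊔ S.V₀ := by
      rw [S.isCompl_V₀.sup_eq_top]; exact Submodule.mem_top
    obtain ⟨a, ha, b, hb, rfl⟩ := Submodule.mem_sup.1 hx
    refine ⟨⟨b, hb⟩, ?_⟩
    -- The vector `a + p b` is horizontal, and it is the difference of `a + b` and `b - p b`, both
    -- in `W`.
    have h1 : a + (p b : GroupLieAlgebra (𝓡 n) G) = 0 := by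
      refine Submodule.disjoint_def.1 hW.disjoint _ (Submodule.add_mem _ ha (p b).2) ?_
      have := Submodule.sub_mem _ hw (hsub b)
      have e : a + b - (b - (p b : GroupLieAlgebra (𝓡 n) G)) = a + p b := by abel
      rwa [e] at this
    have h2 : a = -(p b : GroupLieAlgebra (𝓡 n) G) := eq_neg_of_add_eq_zero_left h1
    simp [h2, add_comm]
  · rintro _ ⟨v, rfl⟩
    have := hsub v
    simpa [sub_eq_add_neg] using this

/-- The first layer and `V₀` meet only in `0`, so a vector of the graph is determined by its part in
`V₀`. -/
lemma add_mem_graph_iff (l : S.V₀ →ₗ[ℝ] S.layer 1) {a : GroupLieAlgebra (𝓡 n) G}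
    (ha : a ∈ S.layer 1) (v : S.V₀) :
    (v : GroupLieAlgebra (𝓡 n) G) + a ∈ S.graph l ↔ (l v : GroupLieAlgebra (𝓡 n) G) = a := by
  constructor
  · rintro ⟨w, hw⟩
    simp only [LinearMap.add_apply, Submodule.subtype_apply, LinearMap.comp_apply] at hw
    have h0 : (w : GroupLieAlgebra (𝓡 n) G) - v = a - l w := by
      rw [sub_eq_sub_iff_add_eq_add, hw, add_comm]
    have h1 : (w : GroupLieAlgebra (𝓡 n) G) - v = 0 :=
      Submodule.disjoint_def.1 S.isCompl_V₀.disjoint _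
        (h0 ▸ Submodule.sub_mem _ ha (l w).2) (Submodule.sub_mem _ w.2 v.2)
    have h2 : w = v := Subtype.ext (sub_eq_zero.1 h1)
    subst h2
    exact add_left_cancel hw
  · rintro rfl
    exact ⟨v, rfl⟩

lemma graph_injective : Function.Injective S.graph := by
  intro l l' h
  ext v : 2
  have : (v : GroupLieAlgebra (𝓡 n) G) + l v ∈ S.graph l' :=
    h ▸ (S.add_mem_graph_iff l (l v).2 v).2 rfl
  exact ((S.add_mem_graph_iff l' (l v).2 v).1 this).symm

/-- By left invariance everything is decided at the identity, where complements of the first layer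
are graphs. -/
lemma existsUnique_graphComplement (V : S.LeftInvariantComplement) :
    ∃! l : S.V₀ →ₗ[ℝ] S.layer 1, V = S.graphComplement l := by
  have hc : IsCompl (S.layer 1) (V.fiber 1) := by
    have := V.isCompl 1
    rwa [horizontal, leftTranslates_one] at this
  obtain ⟨l, hl⟩ := S.exists_eq_graph hc
  refine ⟨l, ?_, ?_⟩
  · ext1
    rw [V.fiber_eq, hl]
    rfl
  · rintro l' rfl
    apply S.graph_injective
    rw [← hl]
    exact (leftTranslates_one _).symm

lemma graphComplement_injective : Function.Injective S.graphComplement := fun l _ h =>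
  (S.existsUnique_graphComplement (S.graphComplement l)).unique rfl h

/-! ### Traces -/

/-- Cyclicity of the trace moves the computation to the first layer, where the frame is a basis;
only the brackets `[X_i, X_j]` remain. -/
lemma trace_compAd (l : S.V₀ →ₗ[ℝ] S.layer 1) (i : Fin S.rank) :
    LinearMap.trace ℝ (GroupLieAlgebra (𝓡 n) G) (S.compAd l i) =
      ∑ j, S.frame.repr (l (S.adX i (S.X j))) j := by
  have : Module.Finite ℝ (GroupLieAlgebra (𝓡 n) G) := finiteDimensionalTangentSpace (1 : G)
  rw [compAd, LinearMap.trace_comp_comm', LinearMap.trace_eq_matrix_trace ℝ S.frame, Matrix.trace]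
  refine Finset.sum_congr rfl fun j _ => ?_
  rw [Matrix.diag_apply, LinearMap.toMatrix_apply]
  rfl

lemma bracket_X_mem_layer_two (i j : Fin S.rank) : ⁅S.X i, S.X j⁆ ∈ S.layer 2 := by
  have := S.bracket_layer 1 le_rfl
  rw [show (2 : ℕ) = 1 + 1 from rfl, ← this]
  exact Submodule.subset_span ⟨_, (S.frame i).2, _, (S.frame j).2, rfl⟩

lemma trace_compAd_eq_zero {l : S.V₀ →ₗ[ℝ] S.layer 1}
    (hl : ∀ v : S.V₀, (v : GroupLieAlgebra (𝓡 n) G) ∈ S.layer 2 → l v = 0) (i : Fin S.rank) :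
    LinearMap.trace ℝ (GroupLieAlgebra (𝓡 n) G) (S.compAd l i) = 0 := by
  rw [trace_compAd]
  refine Finset.sum_eq_zero fun j _ => ?_
  rw [hl _ (S.bracket_X_mem_layer_two i j)]
  simp

/-- A functional that kills the second layer but not some `z` in the third, multiplied by a nonzero
horizontal vector. -/
lemma exists_ne_zero_vanishing_on_layer_two (h : 3 ≤ S.step) :
    ∃ l : S.V₀ →ₗ[ℝ] S.layer 1, l ≠ 0 ∧
      ∀ v : S.V₀, (v : GroupLieAlgebra (𝓡 n) G) ∈ S.layer 2 → l v = 0 := by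
  obtain ⟨z, hz, hz0⟩ := Submodule.exists_mem_ne_zero_of_ne_bot (S.layer_ne_bot 3 (by omega) h)
  obtain ⟨x, hx, hx0⟩ := Submodule.exists_mem_ne_zero_of_ne_bot
    (S.layer_ne_bot 1 le_rfl S.one_le_step)
  have hzn : z ∉ S.layer 2 := fun h2 => hz0 <| Submodule.disjoint_def.1
    (S.isInternal.submodule_iSupIndep.pairwiseDisjoint (show (2 : ℕ) ≠ 3 by decide)) z h2 hz
  obtain ⟨f, hf, hf2⟩ := Submodule.exists_dual_map_eq_bot_of_notMem hzn inferInstance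
  refine ⟨(f ∘ₗ S.V₀.subtype).smulRight (⟨x, hx⟩ : S.layer 1), ?_, ?_⟩
  · intro h0
    have := LinearMap.congr_fun h0 ⟨z, S.layer_le_V₀ (by norm_num) hz⟩
    have h3 : f z • (⟨x, hx⟩ : S.layer 1) = 0 := this
    rcases smul_eq_zero.1 h3 with h4 | h4
    · exact hf h4
    · exact hx0 (congrArg Subtype.val h4)
  · intro v hv
    have h5 : f (v : GroupLieAlgebra (𝓡 n) G) = 0 := by
      have : f v ∈ (S.layer 2).map f := ⟨_, hv, rfl⟩
      rwa [hf2, Submodule.mem_bot] at this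
    simp [h5]

/-! ### Corank one -/

section CorankOne

variable {S} {Z : GroupLieAlgebra (𝓡 n) G}

lemma V₀_eq_layer_two (h2 : S.step = 2) : S.V₀ = S.layer 2 := by
  refine le_antisymm (iSup_le fun j => ?_) (S.layer_le_V₀ le_rfl)
  rcases Nat.eq_zero_or_pos j with rfl | hj
  · exact le_rfl
  · rw [S.layer_eq_bot _ (Or.inr (by omega))]; exact bot_le

lemma frame_sum_mem (c : Fin S.rank → ℝ) : ∑ j, c j • S.X j ∈ S.layer 1 :=
  Submodule.sum_mem _ fun j _ => Submodule.smul_mem _ _ (S.frame j).2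

/-- As `V₀` is the line through `Z`, the graph is the line through `Z + ℓ Z`. -/
lemma graph_eq_span_iff (h2 : S.step = 2) (hZ : S.layer 2 = Submodule.span ℝ {Z})
    (hZ' : Z ∈ S.V₀) (l : S.V₀ →ₗ[ℝ] S.layer 1) (c : Fin S.rank → ℝ) :
    S.graph l = Submodule.span ℝ {Z + ∑ j, c j • S.X j} ↔
      (l ⟨Z, hZ'⟩ : GroupLieAlgebra (𝓡 n) G) = ∑ j, c j • S.X j := by
  rw [← S.add_mem_graph_iff l (frame_sum_mem c) ⟨Z, hZ'⟩]
  constructor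
  · intro h
    rw [h]
    exact Submodule.mem_span_singleton_self _
  · intro h
    refine le_antisymm ?_ (Submodule.span_le.2 (by simpa using h))
    have hl := (S.add_mem_graph_iff l (frame_sum_mem c) ⟨Z, hZ'⟩).1 h
    rintro _ ⟨⟨v, hv⟩, rfl⟩
    have hv' : v ∈ Submodule.span ℝ {Z} := by rwa [← hZ, ← V₀_eq_layer_two h2]
    obtain ⟨a, rfl⟩ := Submodule.mem_span_singleton.1 hv'
    refine Submodule.mem_span_singleton.2 ⟨a, ?_⟩
    have : l ⟨a • Z, hv⟩ = a • l ⟨Z, hZ'⟩ := by rw [← map_smul]; rfl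
    simp only [LinearMap.add_apply, LinearMap.comp_apply, Submodule.subtype_apply, this,
      Submodule.coe_smul, hl, smul_add]

lemma generator_mem_V₀ (h2 : S.step = 2) (hZ : S.layer 2 = Submodule.span ℝ {Z}) : Z ∈ S.V₀ := by
  rw [V₀_eq_layer_two h2, hZ]; exact Submodule.mem_span_singleton_self _

lemma generator_ne_zero (h2 : S.step = 2) (hZ : S.layer 2 = Submodule.span ℝ {Z}) : Z ≠ 0 := by
  rintro rfl
  exact S.layer_ne_bot 2 (by norm_num) h2.ge (by rw [hZ]; simp)

lemma fiber_graphComplement_eq_iff (l : S.V₀ →ₗ[ℝ] S.layer 1)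
    (W : Submodule ℝ (GroupLieAlgebra (𝓡 n) G)) :
    (S.graphComplement l).fiber = leftTranslates W ↔ S.graph l = W :=
  ⟨fun h => leftTranslates_injective h, fun h => h ▸ rfl⟩

lemma existsUnique_complement_of_vector (h2 : S.step = 2)
    (hZ : S.layer 2 = Submodule.span ℝ {Z}) (c : Fin S.rank → ℝ) :
    ∃! V : S.LeftInvariantComplement,
      V.fiber = leftTranslates (Submodule.span ℝ {Z + ∑ j, c j • S.X j}) := by
  have hZ' := generator_mem_V₀ h2 hZ
  -- With `f Z = 1`, the map `v ↦ f v • a` sends `Z` to the prescribed vector `a`.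
  obtain ⟨f, hf⟩ := Module.Projective.exists_dual_eq_one ℝ (generator_ne_zero h2 hZ)
  set a : S.layer 1 := ⟨∑ j, c j • S.X j, frame_sum_mem c⟩ with ha
  have hl : S.graph ((f ∘ₗ S.V₀.subtype).smulRight a) =
      Submodule.span ℝ {Z + ∑ j, c j • S.X j} := by
    rw [graph_eq_span_iff h2 hZ hZ']
    have h1 : (f ∘ₗ S.V₀.subtype).smulRight a ⟨Z, hZ'⟩ = f Z • a := rfl
    rw [h1, hf, one_smul]
  refine ⟨S.graphComplement ((f ∘ₗ S.V₀.subtype).smulRight a), ?_, ?_⟩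
  · rw [← hl]; rfl
  · intro W hW
    ext1
    rw [hW, ← hl]; rfl

lemma existsUnique_vector_of_complement (h2 : S.step = 2)
    (hZ : S.layer 2 = Submodule.span ℝ {Z}) (V : S.LeftInvariantComplement) :
    ∃! c : Fin S.rank → ℝ,
      V.fiber = leftTranslates (Submodule.span ℝ {Z + ∑ j, c j • S.X j}) := by
  have hZ' := generator_mem_V₀ h2 hZ
  obtain ⟨l, rfl, -⟩ := S.existsUnique_graphComplement V
  simp only [fiber_graphComplement_eq_iff, graph_eq_span_iff h2 hZ hZ']
  refine ⟨S.frame.repr (l ⟨Z, hZ'⟩), ?_, ?_⟩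
  · have := congrArg Subtype.val (S.frame.sum_repr (l ⟨Z, hZ'⟩))
    rw [← this, Submodule.coe_sum]
    rfl
  · intro c hc
    have : l ⟨Z, hZ'⟩ = ∑ j, c j • S.frame j := by
      ext1; rw [hc]; simp [X]
    rw [this]
    ext j
    simp [Finsupp.single_apply]

/-- The `j`-th coordinate of `ℓ [X_i, X_j] = A i j • ℓ Z` is `A i j * c j`. -/
lemma trace_compAd_eq_mulVec (A : Matrix (Fin S.rank) (Fin S.rank) ℝ)
    (hA : ∀ i j, ⁅S.X i, S.X j⁆ = A i j • Z) (hZ' : Z ∈ S.V₀)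
    (l : S.V₀ →ₗ[ℝ] S.layer 1) (c : Fin S.rank → ℝ)
    (hl : (l ⟨Z, hZ'⟩ : GroupLieAlgebra (𝓡 n) G) = ∑ j, c j • S.X j) (i : Fin S.rank) :
    LinearMap.trace ℝ (GroupLieAlgebra (𝓡 n) G) (S.compAd l i) = A.mulVec c i := by
  rw [trace_compAd, Matrix.mulVec, dotProduct]
  refine Finset.sum_congr rfl fun j _ => ?_
  have h1 : S.adX i (S.X j) = A i j • ⟨Z, hZ'⟩ := Subtype.ext (hA i j)
  have h2 : l ⟨Z, hZ'⟩ = ∑ j, c j • S.frame j := by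
    ext1; rw [hl]; simp [X]
  rw [h1, map_smul, h2]
  simp [Finsupp.single_apply]

end CorankOne

end CarnotStructure
end CarnotGroup

/-! ### Nondegeneracy of Popp's volume. -/

/-- The quotient norm of a finite-dimensional Euclidean space is realized by a linear section. -/
lemma exists_linear_norm_minimizing_section {V W : Type*} [NormedAddCommGroup V]
    [InnerProductSpace ℝ V] [FiniteDimensional ℝ V] [AddCommGroup W] [Module ℝ W]
    (T : V →ₗ[ℝ] W) (U : Submodule ℝ W) (hU : U ≤ LinearMap.range T) :
    ∃ L : U →ₗ[ℝ] V, Function.Injective L ∧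
      ∀ v : U, sInf {r | ∃ a, T a = v ∧ ‖a‖ = r} = ‖L v‖ := by
  obtain ⟨s, hs⟩ := T.rangeRestrict.exists_rightInverse_of_surjective T.range_rangeRestrict
  -- The shortest preimage is the one orthogonal to `ker T`; projecting an arbitrary linear section
  -- `s` along the kernel selects it linearly.
  set P : V →ₗ[ℝ] V := (LinearMap.ker T)ᗮ.starProjection.toLinearMap with hP
  have hTP : ∀ a, T (P a) = T a := by
    intro a
    have h : a - P a ∈ LinearMap.ker T := by
      have := (LinearMap.ker T)ᗮ.sub_starProjection_mem_orthogonal a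
      rwa [Submodule.orthogonal_orthogonal] at this
    rw [LinearMap.mem_ker, map_sub, sub_eq_zero] at h
    exact h.symm
  have hPker : ∀ a, T a = 0 → P a = 0 := by
    intro a ha
    refine (Submodule.starProjection_apply_eq_zero_iff _).2 ?_
    rw [Submodule.orthogonal_orthogonal]
    exact ha
  have hTs : ∀ v, T (s v) = v := fun v => congrArg Subtype.val (LinearMap.congr_fun hs v)
  set L : U →ₗ[ℝ] V := P ∘ₗ s ∘ₗ Submodule.inclusion hU with hL
  have hTL : ∀ v, T (L v) = v := fun v => (hTP _).trans (hTs _)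
  refine ⟨L, fun v w h => Subtype.ext ?_, fun v => ?_⟩
  · rw [← hTL v, ← hTL w, h]
  · refine IsLeast.csInf_eq ⟨⟨L v, hTL v, rfl⟩, ?_⟩
    rintro _ ⟨a, ha, rfl⟩
    -- Two preimages differ by an element of the kernel, which `P` kills, and `P` is idempotent; the
    -- bound is then that a projection does not increase norms.
    have : L v = P a := by
      have h := hPker (L v - a) (by rw [map_sub, hTL, ha, sub_self])
      rw [map_sub, sub_eq_zero] at h
      rw [← h]
      change P (s _) = P (P (s _))
      have h2 := hPker (s (Submodule.inclusion hU v) - P (s (Submodule.inclusion hU v)))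
        (by rw [map_sub, hTP, sub_self])
      rwa [map_sub, sub_eq_zero] at h2
    rw [this]
    exact Submodule.norm_starProjection_apply_le _ _

namespace CarnotGroup

variable {n : ℕ} {G : Type*} [TopologicalSpace G] [ChartedSpace (EuclideanSpace ℝ (Fin n)) G]
  [Group G] [LieGroup (𝓡 n) ∞ G]

namespace CarnotStructure

variable (S : CarnotStructure n G)

lemma layer_one_eq_span : S.layer 1 = Submodule.span ℝ (Set.range S.X) := by
  have := congrArg (Submodule.map (S.layer 1).subtype) S.frame.span_eq
  rw [Submodule.map_span, Submodule.map_top, Submodule.range_subtype, ← Set.range_comp] at this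
  exact this.symm

/-- The span of the iterated brackets of length `j` of the frame. -/
def nestedSpan (j : ℕ) : Submodule ℝ (GroupLieAlgebra (𝓡 n) G) :=
  Submodule.span ℝ (Set.range fun w : Fin j → Fin S.rank =>
    nestedBracket (List.ofFn fun i => S.X (w i)))

lemma bracket_mem_nestedSpan {j : ℕ} (hj : 1 ≤ j) {x y : GroupLieAlgebra (𝓡 n) G}
    (hx : x ∈ S.layer 1) (hy : y ∈ S.nestedSpan j) : ⁅x, y⁆ ∈ S.nestedSpan (j + 1) := by
  rw [layer_one_eq_span] at hx
  induction hx using Submodule.span_induction with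
  | mem x hx =>
    obtain ⟨i, rfl⟩ := hx
    induction hy using Submodule.span_induction with
    | mem y hy =>
      obtain ⟨w, rfl⟩ := hy
      refine Submodule.subset_span ⟨Fin.cons i w, ?_⟩
      -- The word `w` must be nonempty: for an empty one `nestedBracket` of the longer word is `X i`
      -- itself and not a bracket.
      obtain ⟨j, rfl⟩ := Nat.exists_eq_add_of_le' hj
      simp [List.ofFn_succ, nestedBracket]
    | zero => rw [lie_zero]; exact Submodule.zero_mem _
    | add a b _ _ ha hb => rw [lie_add]; exact Submodule.add_mem _ ha hb
    | smul c a _ ha => rw [lie_smul]; exact Submodule.smul_mem _ _ ha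
  | zero => rw [zero_lie]; exact Submodule.zero_mem _
  | add a b _ _ ha hb => rw [add_lie]; exact Submodule.add_mem _ ha hb
  | smul c a _ ha => rw [smul_lie]; exact Submodule.smul_mem _ _ ha

/-- Unrolling `g_{j+1} = [g_1, g_j]` expresses each layer by words in the frame. This makes every
vector of the layer a value of `π_j`, so that its norm is an infimum over a nonempty set. -/
lemma layer_le_nestedSpan (j : ℕ) : S.layer (j + 1) ≤ S.nestedSpan (j + 1) := by
  induction j with
  | zero =>
    rw [zero_add, layer_one_eq_span]
    refine Submodule.span_mono ?_
    rintro _ ⟨i, rfl⟩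
    exact ⟨fun _ => i, by simp [nestedBracket]⟩
  | succ j ih =>
    rw [← S.bracket_layer (j + 1) (by omega)]
    refine Submodule.span_le.2 ?_
    rintro _ ⟨x, hx, y, hy, rfl⟩
    exact S.bracket_mem_nestedSpan (by omega) hx (ih hy)

/-- The map `π_j` as a linear map. -/
def tensorBracketHom (j : ℕ) :
    EuclideanSpace ℝ (Fin j → Fin S.rank) →ₗ[ℝ] GroupLieAlgebra (𝓡 n) G where
  toFun := S.tensorBracket j
  map_add' a b := by simp [tensorBracket, add_smul, Finset.sum_add_distrib]
  map_smul' c a := by simp [tensorBracket, mul_smul, Finset.smul_sum]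

lemma layer_le_range {j : ℕ} (hj : 1 ≤ j) : S.layer j ≤ LinearMap.range (S.tensorBracketHom j) := by
  obtain ⟨j, rfl⟩ := Nat.exists_eq_add_of_le' hj
  refine (S.layer_le_nestedSpan j).trans (Submodule.span_le.2 ?_)
  rintro _ ⟨w, rfl⟩
  refine ⟨EuclideanSpace.single w 1, ?_⟩
  change S.tensorBracket _ _ = _
  simp [tensorBracket]

/-- The component in the `j`-th layer, as a linear map. -/
def componentHom (j : ℕ) : GroupLieAlgebra (𝓡 n) G →ₗ[ℝ] S.layer j :=
  DirectSum.component ℝ ℕ (fun j => S.layer j) j ∘ₗ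
    (LinearEquiv.ofBijective (DirectSum.coeLinearMap S.layer) S.isInternal).symm.toLinearMap

lemma coe_componentHom (j : ℕ) (v : GroupLieAlgebra (𝓡 n) G) :
    (S.componentHom j v : GroupLieAlgebra (𝓡 n) G) = S.component j v := rfl

lemma eq_zero_of_componentHom {v : GroupLieAlgebra (𝓡 n) G}
    (h : ∀ j ∈ Finset.Icc 1 S.step, S.componentHom j v = 0) : v = 0 := by
  rw [← LinearEquiv.map_eq_zero_iff
    (LinearEquiv.ofBijective (DirectSum.coeLinearMap S.layer) S.isInternal).symm]
  refine DFinsupp.ext fun j => ?_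
  by_cases hj : j ∈ Finset.Icc 1 S.step
  · exact h j hj
  · have : S.layer j = ⊥ := S.layer_eq_bot j (by rw [Finset.mem_Icc] at hj; omega)
    refine Subtype.ext ((Submodule.mem_bot ℝ).1 ?_)
    exact this.le (Subtype.property _)

/-- `scalarProduct` is built from infima and polarization, which hides bilinearity and positivity.
The norm-minimizing sections of the layers together embed the Lie algebra in a Euclidean space whose
inner product pulls back to it. -/
lemma exists_isometric_model : ∃ (F : Type) (_ : NormedAddCommGroup F) (_ : InnerProductSpace ℝ F)
    (Φ : GroupLieAlgebra (𝓡 n) G →ₗ[ℝ] F), Function.Injective Φ ∧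
      ∀ v w, S.scalarProduct v w = inner ℝ (Φ v) (Φ w) := by
  have h : ∀ j : Finset.Icc 1 S.step, _ := fun j =>
    exists_linear_norm_minimizing_section (S.tensorBracketHom j) (S.layer j)
      (S.layer_le_range (Finset.mem_Icc.1 j.2).1)
  choose L hinj hL using h
  refine ⟨PiLp 2 fun j : Finset.Icc 1 S.step => EuclideanSpace ℝ (Fin j → Fin S.rank),
    inferInstance, inferInstance,
    (WithLp.linearEquiv 2 ℝ _).symm.toLinearMap ∘ₗ LinearMap.pi fun j => L j ∘ₗ S.componentHom j,
    ?_, ?_⟩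
  · rw [← LinearMap.ker_eq_bot, LinearMap.ker_eq_bot']
    intro v hv
    refine S.eq_zero_of_componentHom fun j hj => hinj ⟨j, hj⟩ ?_
    rw [map_zero]
    have := congrArg (fun f => f.ofLp ⟨j, hj⟩) hv
    simpa using this
  · intro v w
    rw [scalarProduct, ← Finset.sum_coe_sort, PiLp.inner_apply]
    refine Finset.sum_congr rfl fun j _ => ?_
    have hn : ∀ x : S.layer j, S.layerNorm j x = ‖L j x‖ := hL j
    rw [layerInner, ← coe_componentHom, ← coe_componentHom, ← Submodule.coe_add,
      ← Submodule.coe_sub, hn, hn, map_add, map_sub,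
      norm_add_sq_real, norm_sub_sq_real]
    change _ = inner ℝ (L j (S.componentHom j v)) (L j (S.componentHom j w))
    ring

/-- In the isometric model this is the Gram determinant of linearly independent vectors. It allows
the division in `divergence`. -/
lemma det_scalarProduct_pos : 0 < (Matrix.of fun a b =>
    S.scalarProduct (auxBasis n G a) (auxBasis n G b)).det := by
  obtain ⟨F, _, _, Φ, hΦ, h⟩ := S.exists_isometric_model
  have hli := (auxBasis n G).linearIndependent.map' Φ (LinearMap.ker_eq_bot.2 hΦ)
  have : (Matrix.of fun a b => S.scalarProduct (auxBasis n G a) (auxBasis n G b)) =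
      Matrix.gram ℝ (Φ ∘ auxBasis n G) := by
    ext a b
    exact h _ _
  rw [this]
  exact (Matrix.posDef_gram_of_linearIndependent hli).det_pos

end CarnotStructure
end CarnotGroup

/-! ### Moments of the uniform measure on the sphere. -/

/-- A linear isometry, restricted to the unit sphere. -/
def LinearIsometryEquiv.unitSphereMap {E : Type*} [NormedAddCommGroup E] [NormedSpace ℝ E]
    (T : E ≃ₗᵢ[ℝ] E) (x : Metric.sphere (0 : E) 1) : Metric.sphere (0 : E) 1 :=
  ⟨T x, by simp [T.norm_map]⟩

-- The surface measure of a set is, up to a constant, the volume of the cone over it; a linear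
-- isometry maps cones to cones and preserves volume.
open scoped Pointwise in
lemma LinearIsometryEquiv.measurePreserving_unitSphereMap {E : Type*} [NormedAddCommGroup E]
    [InnerProductSpace ℝ E] [FiniteDimensional ℝ E] [MeasurableSpace E] [BorelSpace E]
    (T : E ≃ₗᵢ[ℝ] E) :
    MeasurePreserving T.unitSphereMap (volume : Measure E).toSphere
      (volume : Measure E).toSphere := by
  have hm : Measurable T.unitSphereMap :=
    (T.continuous.comp continuous_subtype_val).subtype_mk _ |>.measurable
  refine ⟨hm, ?_⟩
  ext s hs
  rw [Measure.map_apply hm hs, Measure.toSphere_apply' _ (hm hs), Measure.toSphere_apply' _ hs]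
  congr 1
  have h : Set.Ioo (0 : ℝ) 1 • (Subtype.val '' (T.unitSphereMap ⁻¹' s) : Set E) =
      T.toMeasurableEquiv ⁻¹' (Set.Ioo (0 : ℝ) 1 • (Subtype.val '' s : Set E)) := by
    ext x
    simp only [Set.mem_smul, Set.mem_preimage]
    constructor
    · rintro ⟨r, hr, _, ⟨y, hy, rfl⟩, rfl⟩
      exact ⟨r, hr, _, ⟨T.unitSphereMap y, hy, rfl⟩, (T.toLinearEquiv.map_smul r (y : E)).symm⟩
    · rintro ⟨r, hr, _, ⟨y, hy, rfl⟩, h⟩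
      refine ⟨r, hr, T.symm y, ⟨⟨T.symm y, by simp [T.symm.norm_map]⟩, ?_, rfl⟩, ?_⟩
      · have : T.unitSphereMap ⟨T.symm y, by simp [T.symm.norm_map]⟩ = y :=
          Subtype.ext (T.apply_symm_apply _)
        rwa [Set.mem_preimage, this]
      · apply T.injective
        exact (T.toLinearEquiv.map_smul r _).trans
          ((congrArg (r • ·) (T.apply_symm_apply (y : E))).trans h)
  rw [h]
  exact T.measurePreserving.measure_preimage_equiv (f := T.toMeasurableEquiv) _

namespace CarnotGroup

namespace CarnotStructure

variable {k : ℕ}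

lemma measurePreserving_sphereMeasure
    (T : EuclideanSpace ℝ (Fin k) ≃ₗᵢ[ℝ] EuclideanSpace ℝ (Fin k)) :
    MeasurePreserving T.unitSphereMap (sphereMeasure k) (sphereMeasure k) :=
  T.measurePreserving_unitSphereMap.smul_measure _

lemma isProbabilityMeasure_sphereMeasure (hk : 0 < k) : IsProbabilityMeasure (sphereMeasure k) := by
  have : Nonempty (Fin k) := ⟨⟨0, hk⟩⟩
  have h : (volume : Measure (EuclideanSpace ℝ (Fin k))).toSphere Set.univ ≠ 0 := by
    rw [Ne, Measure.measure_univ_eq_zero]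
    exact Measure.toSphere_ne_zero _
  exact ⟨ENNReal.inv_mul_cancel h (measure_ne_top _ _)⟩

lemma integral_sphereMeasure_comp
    (T : EuclideanSpace ℝ (Fin k) ≃ₗᵢ[ℝ] EuclideanSpace ℝ (Fin k))
    (g : Metric.sphere (0 : EuclideanSpace ℝ (Fin k)) 1 → ℝ) (hg : Continuous g) :
    ∫ x, g (T.unitSphereMap x) ∂(sphereMeasure k) = ∫ x, g x ∂(sphereMeasure k) := by
  have h := measurePreserving_sphereMeasure T
  conv_rhs => rw [← h.map_eq]
  rw [integral_map h.measurable.aemeasurable hg.aestronglyMeasurable]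

lemma continuous_sphere_coord (i : Fin k) : Continuous
    fun x : Metric.sphere (0 : EuclideanSpace ℝ (Fin k)) 1 => (x : EuclideanSpace ℝ (Fin k)) i :=
  (EuclideanSpace.proj (𝕜 := ℝ) i).continuous.comp continuous_subtype_val

/-- The antipodal map changes the sign of the integrand. -/
lemma integral_sphere_coord (i : Fin k) :
    ∫ x, (x : EuclideanSpace ℝ (Fin k)) i ∂(sphereMeasure k) = 0 := by
  have h := integral_sphereMeasure_comp (LinearIsometryEquiv.neg ℝ) _ (continuous_sphere_coord i)
  have h2 : ∀ x, ((LinearIsometryEquiv.neg ℝ : EuclideanSpace ℝ (Fin k) ≃ₗᵢ[ℝ] _).unitSphereMap x :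
      EuclideanSpace ℝ (Fin k)) i = -(x : EuclideanSpace ℝ (Fin k)) i := fun x => rfl
  simp only [h2, integral_neg] at h
  linarith

/-- The reflection in the `i`-th coordinate changes the sign of the product. -/
lemma integral_sphere_coord_mul_of_ne {i j : Fin k} (hij : i ≠ j) :
    ∫ x, (x : EuclideanSpace ℝ (Fin k)) i * (x : EuclideanSpace ℝ (Fin k)) j
      ∂(sphereMeasure k) = 0 := by
  let T : EuclideanSpace ℝ (Fin k) ≃ₗᵢ[ℝ] EuclideanSpace ℝ (Fin k) :=
    LinearIsometryEquiv.piLpCongrRight 2 fun m =>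
      if m = i then LinearIsometryEquiv.neg ℝ else LinearIsometryEquiv.refl ℝ ℝ
  have h := integral_sphereMeasure_comp T
    (fun x => (x : EuclideanSpace ℝ (Fin k)) i * (x : EuclideanSpace ℝ (Fin k)) j)
    ((continuous_sphere_coord i).mul (continuous_sphere_coord j))
  have h2 : ∀ x, (T.unitSphereMap x : EuclideanSpace ℝ (Fin k)) i =
      -(x : EuclideanSpace ℝ (Fin k)) i := fun x => by
    simp [T, LinearIsometryEquiv.unitSphereMap]
  have h3 : ∀ x, (T.unitSphereMap x : EuclideanSpace ℝ (Fin k)) j =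
      (x : EuclideanSpace ℝ (Fin k)) j := fun x => by
    simp [T, LinearIsometryEquiv.unitSphereMap, hij.symm]
  simp only [h2, h3, neg_mul, integral_neg] at h
  linarith

lemma integral_sphere_coord_sq_eq (i j : Fin k) :
    ∫ x, (x : EuclideanSpace ℝ (Fin k)) i ^ 2 ∂(sphereMeasure k) =
      ∫ x, (x : EuclideanSpace ℝ (Fin k)) j ^ 2 ∂(sphereMeasure k) := by
  rw [← integral_sphereMeasure_comp (LinearIsometryEquiv.piLpCongrLeft 2 ℝ ℝ (Equiv.swap i j))
    (fun x => (x : EuclideanSpace ℝ (Fin k)) i ^ 2) ((continuous_sphere_coord i).pow 2)]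
  refine integral_congr_ae (Filter.Eventually.of_forall fun x => ?_)
  simp [LinearIsometryEquiv.unitSphereMap, LinearIsometryEquiv.piLpCongrLeft_apply]

lemma integrable_sphereMeasure (g : Metric.sphere (0 : EuclideanSpace ℝ (Fin k)) 1 → ℝ)
    (hg : Continuous g) (hk : 0 < k) : Integrable g (sphereMeasure k) := by
  have := isProbabilityMeasure_sphereMeasure hk
  exact hg.integrable_of_hasCompactSupport (HasCompactSupport.of_compactSpace g)

/-- Exchanging coordinates makes the `k` second moments equal, and they add up to `1` because `‖x‖ =
1`. -/
lemma integral_sphere_coord_sq (i : Fin k) :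
    ∫ x, (x : EuclideanSpace ℝ (Fin k)) i ^ 2 ∂(sphereMeasure k) = 1 / k := by
  have hk : 0 < k := i.pos
  have := isProbabilityMeasure_sphereMeasure hk
  have h1 : ∫ x, ∑ j, (x : EuclideanSpace ℝ (Fin k)) j ^ 2 ∂(sphereMeasure k) = 1 := by
    have : ∀ x : Metric.sphere (0 : EuclideanSpace ℝ (Fin k)) 1,
        ∑ j, (x : EuclideanSpace ℝ (Fin k)) j ^ 2 = 1 := fun x => by
      rw [← EuclideanSpace.real_norm_sq_eq, norm_eq_of_mem_sphere, one_pow]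
    simp [this]
  rw [integral_finsetSum _ fun j _ =>
    integrable_sphereMeasure (fun x => (x : EuclideanSpace ℝ (Fin k)) j ^ 2) ((continuous_sphere_coord j).pow 2) hk] at h1
  simp only [integral_sphere_coord_sq_eq _ i, Finset.sum_const, Finset.card_univ, Fintype.card_fin,
    nsmul_eq_mul] at h1
  field_simp
  linarith

lemma integral_sphere_coord_mul (i j : Fin k) :
    ∫ x, (x : EuclideanSpace ℝ (Fin k)) i * (x : EuclideanSpace ℝ (Fin k)) j
      ∂(sphereMeasure k) = if i = j then 1 / (k : ℝ) else 0 := by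
  split_ifs with h
  · subst h
    simpa only [sq] using integral_sphere_coord_sq i
  · exact integral_sphere_coord_mul_of_ne h

end CarnotStructure
end CarnotGroup

/-! ### Smoothness of left-invariant fields, the Maurer-Cartan form, and brackets in a
left-invariant frame. -/

namespace CarnotGroup

variable {n : ℕ} {G : Type*} [TopologicalSpace G] [ChartedSpace (EuclideanSpace ℝ (Fin n)) G]
  [Group G] [LieGroup (𝓡 n) ∞ G]

/-- The map which sends a pair of tangent vectors to the differential of the multiplication at
this pair. -/
lemma contMDiff_tangentMap_mul :
    ContMDiff ((𝓡 n).tangent.prod (𝓡 n).tangent) (𝓡 n).tangent ∞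
      (fun p : TangentBundle (𝓡 n) G × TangentBundle (𝓡 n) G =>
        tangentMap ((𝓡 n).prod (𝓡 n)) (𝓡 n) (fun p : G × G => p.1 * p.2)
          ((equivTangentBundleProd (𝓡 n) G (𝓡 n) G).symm p)) := by
  refine ContMDiff.comp (g := tangentMap ((𝓡 n).prod (𝓡 n)) (𝓡 n) (fun p : G × G => p.1 * p.2))
    (f := (equivTangentBundleProd (𝓡 n) G (𝓡 n) G).symm) ?_ contMDiff_equivTangentBundleProd_symm
  exact ContMDiff.contMDiff_tangentMap (contMDiff_mul (𝓡 n) ∞) (m := ∞) (by simp)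

lemma tangentMap_mul_apply (p q : G) (v : TangentSpace (𝓡 n) p) (w : TangentSpace (𝓡 n) q) :
    tangentMap ((𝓡 n).prod (𝓡 n)) (𝓡 n) (fun p : G × G => p.1 * p.2)
      ((equivTangentBundleProd (𝓡 n) G (𝓡 n) G).symm (⟨p, v⟩, ⟨q, w⟩)) =
    ⟨p * q, (mfderiv (𝓡 n) (𝓡 n) (fun x => x * q) p v : EuclideanSpace ℝ (Fin n)) +
      (mfderiv (𝓡 n) (𝓡 n) (fun x => p * x) q w : EuclideanSpace ℝ (Fin n))⟩ := by
  simp only [tangentMap]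
  rw [mfderiv_prod_eq_add_apply ((contMDiff_mul (𝓡 n) ∞).mdifferentiable (by simp) _)]
  rfl

/-- The field is the smooth map `q ↦ (0_q, v)` followed by the differential of the multiplication.
-/
lemma smoothField_leftDiff (v : GroupLieAlgebra (𝓡 n) G) :
    SmoothField (n := n) (G := G) (fun q => leftDiff q v) := by
  have h1 : ContMDiff (𝓡 n) ((𝓡 n).tangent.prod (𝓡 n).tangent) ∞
      (fun q : G => ((⟨q, 0⟩, ⟨1, v⟩) : TangentBundle (𝓡 n) G × TangentBundle (𝓡 n) G)) :=
    (Bundle.contMDiff_zeroSection ℝ (TangentSpace (𝓡 n) : G → Type _)).prodMk contMDiff_const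
  have h := contMDiff_tangentMap_mul.comp h1
  refine h.congr fun q => ?_
  rw [Function.comp_apply, tangentMap_mul_apply]
  -- The base point comes out as `q * 1`, so the equality in the tangent bundle goes through a
  -- substitution.
  have key : ∀ r : G, r = q → ∀ x y : EuclideanSpace ℝ (Fin n), x = y →
      (⟨q, x⟩ : TangentBundle (𝓡 n) G) = ⟨r, y⟩ := by
    rintro _ rfl _ _ rfl; rfl
  refine key _ (mul_one q) _ _ ?_
  rw [ContinuousLinearMap.map_zero, zero_add]
  rfl

/-- The Maurer-Cartan form, with values in the Euclidean space which is the Lie algebra. -/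
def maurerCartan (p : TangentBundle (𝓡 n) G) : EuclideanSpace ℝ (Fin n) := leftDiffInv p.1 p.2

/-- Applying the differential of the multiplication to the zero vector at `q⁻¹` and to `v` at `q`
gives the translate of `v` to the identity. -/
lemma contMDiff_maurerCartan : ContMDiff (𝓡 n).tangent 𝓘(ℝ, EuclideanSpace ℝ (Fin n)) ∞
    (maurerCartan (n := n) (G := G)) := by
  have hp : ContMDiff (𝓡 n).tangent (𝓡 n) ∞ (fun p : TangentBundle (𝓡 n) G => p.1) :=
    Bundle.contMDiff_proj (TangentSpace (𝓡 n))
  have h0 : ContMDiff (𝓡 n).tangent (𝓡 n).tangent ∞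
      (fun p : TangentBundle (𝓡 n) G => (⟨p.1⁻¹, 0⟩ : TangentBundle (𝓡 n) G)) :=
    (Bundle.contMDiff_zeroSection ℝ (TangentSpace (𝓡 n) : G → Type _)).comp
      ((contMDiff_inv (𝓡 n) ∞).comp hp)
  have h := contMDiff_tangentMap_mul.comp (h0.prodMk contMDiff_id)
  have hF : ContMDiff (𝓡 n).tangent (𝓡 n).tangent ∞
      (fun p : TangentBundle (𝓡 n) G =>
        (⟨1, leftDiffInv p.1 p.2⟩ : TangentBundle (𝓡 n) G)) := by
    refine h.congr fun p => ?_
    rw [Function.comp_apply]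
    have key : ∀ r : G, r = 1 → ∀ x y : EuclideanSpace ℝ (Fin n), x = y →
        (⟨1, x⟩ : TangentBundle (𝓡 n) G) = ⟨r, y⟩ := by
      rintro _ rfl _ _ rfl; rfl
    refine Eq.trans ?_ (tangentMap_mul_apply p.1⁻¹ p.1 0 p.2).symm
    refine key _ (inv_mul_cancel p.1) _ _ ?_
    rw [ContinuousLinearMap.map_zero, zero_add]
    rfl
  intro p
  -- The map takes values in the fibre over `1`; the trivialization at `1` is the identity there,
  -- because the chart at `1` changes trivially to itself.
  have h2 := (Bundle.contMDiffAt_totalSpace.1 (hF p)).2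
  refine h2.congr_of_eventuallyEq (Filter.Eventually.of_forall fun p => ?_)
  exact ((tangentBundleCore (𝓡 n) G).coordChange_self (achart (EuclideanSpace ℝ (Fin n)) (1 : G)) 1
    (mem_achart_source _ (1 : G)) (maurerCartan p)).symm

lemma SmoothField.contMDiff_maurerCartan {Y : ∀ q : G, TangentSpace (𝓡 n) q}
    (hY : SmoothField Y) : ContMDiff (𝓡 n) 𝓘(ℝ, EuclideanSpace ℝ (Fin n)) ∞
      (fun q : G => maurerCartan ⟨q, Y q⟩) :=
  CarnotGroup.contMDiff_maurerCartan.comp hY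

lemma ContinuousField.continuous_maurerCartan {Y : ∀ q : G, TangentSpace (𝓡 n) q}
    (hY : ContinuousField Y) :
      Continuous (fun q : G => maurerCartan ⟨q, Y q⟩) :=
  CarnotGroup.contMDiff_maurerCartan.continuous.comp hY

lemma mlieBracket_leftDiff (v w : GroupLieAlgebra (𝓡 n) G) (q : G) :
    mlieBracket (𝓡 n) (fun q => leftDiff q v) (fun q => leftDiff q w) q = leftDiff q ⁅v, w⁆ :=
  (congrFun (mulInvariantVector_mlieBracket (I := 𝓡 n) v w) q).symm

lemma contMDiff_derivAlong {Y : ∀ q : G, TangentSpace (𝓡 n) q} (hY : SmoothField Y) {f : G → ℝ}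
    (hf : ContMDiff (𝓡 n) 𝓘(ℝ, ℝ) ∞ f) :
    ContMDiff (𝓡 n) 𝓘(ℝ, ℝ) ∞ (CarnotStructure.derivAlong Y f) := by
  have h := (hf.contMDiff_tangentMap (m := ∞) (by simp)).comp hY
  exact (contMDiff_snd_tangentBundle_modelSpace ℝ 𝓘(ℝ, ℝ)).comp h

lemma SmoothField.mdifferentiableAt {Y : ∀ q : G, TangentSpace (𝓡 n) q} (hY : SmoothField Y)
    (q : G) : MDifferentiableAt (𝓡 n) (𝓡 n).tangent
      (fun q => (⟨q, Y q⟩ : TangentBundle (𝓡 n) G)) q :=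
  ContMDiff.mdifferentiable hY (by simp) q

lemma SmoothField.smul {Y : ∀ q : G, TangentSpace (𝓡 n) q} (hY : SmoothField Y)
    {g : G → ℝ} (hg : ContMDiff (𝓡 n) 𝓘(ℝ, ℝ) ∞ g) : SmoothField (g • Y) :=
  ContMDiff.smul_section hg hY

lemma SmoothField.sum_smul {ι : Type*} (s : Finset ι) {W : ι → ∀ q : G, TangentSpace (𝓡 n) q}
    (hW : ∀ i, SmoothField (W i)) {g : ι → G → ℝ}
    (hg : ∀ i, ContMDiff (𝓡 n) 𝓘(ℝ, ℝ) ∞ (g i)) : SmoothField (∑ i ∈ s, g i • W i) := by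
  have := ContMDiff.sum_section (s := s) (fun i _ => (hW i).smul (hg i))
  refine this.congr fun q => ?_
  rw [Finset.sum_apply]

lemma mlieBracket_sum_smul_right {ι : Type*} (s : Finset ι) (V : ∀ q : G, TangentSpace (𝓡 n) q)
    {W : ι → ∀ q : G, TangentSpace (𝓡 n) q} (hW : ∀ i, SmoothField (W i)) {g : ι → G → ℝ}
    (hg : ∀ i, ContMDiff (𝓡 n) 𝓘(ℝ, ℝ) ∞ (g i)) (q : G) :
    mlieBracket (𝓡 n) V (∑ i ∈ s, g i • W i) q =
      ∑ i ∈ s, (CarnotStructure.derivAlong V (g i) q • W i q +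
        g i q • mlieBracket (𝓡 n) V (W i) q) := by
  classical
  induction s using Finset.induction_on with
  | empty => simp [mlieBracket_zero_right]
  | insert i s hi ih =>
    rw [Finset.sum_insert hi, Finset.sum_insert hi, ← ih, mlieBracket_add_right
      (((hW i).smul (hg i)).mdifferentiableAt q) ((SmoothField.sum_smul s hW hg).mdifferentiableAt q),
      mlieBracket_smul_right ((hg i).mdifferentiable (by simp) q) ((hW i).mdifferentiableAt q)]
    rfl

lemma mlieBracket_sum_smul_left {ι : Type*} (s : Finset ι) (V : ∀ q : G, TangentSpace (𝓡 n) q)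
    {W : ι → ∀ q : G, TangentSpace (𝓡 n) q} (hW : ∀ i, SmoothField (W i)) {g : ι → G → ℝ}
    (hg : ∀ i, ContMDiff (𝓡 n) 𝓘(ℝ, ℝ) ∞ (g i)) (q : G) :
    mlieBracket (𝓡 n) (∑ i ∈ s, g i • W i) V q =
      ∑ i ∈ s, (-CarnotStructure.derivAlong V (g i) q • W i q +
        g i q • mlieBracket (𝓡 n) (W i) V q) := by
  rw [mlieBracket_swap_apply, mlieBracket_sum_smul_right s V hW hg, ← Finset.sum_neg_distrib]
  refine Finset.sum_congr rfl fun i _ => ?_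
  rw [mlieBracket_swap_apply (V := W i), neg_add, neg_smul, smul_neg]

namespace CarnotStructure

/-- The coefficients of a vector field in a left-invariant frame. -/
def coeff (Y : ∀ q : G, TangentSpace (𝓡 n) q)
    (a : Fin (Module.finrank ℝ (GroupLieAlgebra (𝓡 n) G))) (q : G) : ℝ :=
  (auxBasis n G).repr (leftDiffInv q (Y q)) a

lemma contMDiff_coeff {Y : ∀ q : G, TangentSpace (𝓡 n) q} (hY : SmoothField Y)
    (a : Fin (Module.finrank ℝ (GroupLieAlgebra (𝓡 n) G))) :
    ContMDiff (𝓡 n) 𝓘(ℝ, ℝ) ∞ (coeff Y a) := by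
  let c : EuclideanSpace ℝ (Fin n) →L[ℝ] ℝ :=
    LinearMap.toContinuousLinearMap ((auxBasis n G).coord a)
  exact c.contMDiff.comp hY.contMDiff_maurerCartan

lemma sum_coeff_smul (Y : ∀ q : G, TangentSpace (𝓡 n) q) :
    ∑ a, coeff Y a • (fun q : G => leftDiff q (auxBasis n G a)) = Y := by
  funext q
  have h := congrArg (leftDiff q) ((auxBasis n G).sum_repr (leftDiffInv q (Y q)))
  rw [leftDiff_leftDiffInv, map_sum] at h
  rw [← h, Finset.sum_apply]
  refine Finset.sum_congr rfl fun a _ => ?_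
  rw [map_smul]
  rfl

/-- Reduces Hamilton's equations for arbitrary smooth fields to those for left-invariant ones. -/
lemma mlieBracket_leftDiff_coeff (v : GroupLieAlgebra (𝓡 n) G)
    {Y : ∀ q : G, TangentSpace (𝓡 n) q} (hY : SmoothField Y) (q : G) :
    mlieBracket (𝓡 n) (fun q => leftDiff q v) Y q =
      ∑ a, (derivAlong (fun q => leftDiff q v) (coeff Y a) q • leftDiff q (auxBasis n G a) +
        coeff Y a q • leftDiff q ⁅v, auxBasis n G a⁆) := by
  conv_lhs => rw [← sum_coeff_smul Y]
  rw [mlieBracket_sum_smul_right _ _ (fun a => smoothField_leftDiff (auxBasis n G a))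
    (fun a => contMDiff_coeff hY a)]
  simp only [mlieBracket_leftDiff]

variable (S : CarnotStructure n G)

/-! ### The divergence -/

/-- `ad X_i` maps each layer into the next, so its diagonal blocks vanish. -/
lemma trace_ad_X (i : Fin S.rank) : LinearMap.trace ℝ (GroupLieAlgebra (𝓡 n) G)
    (LieAlgebra.ad ℝ (GroupLieAlgebra (𝓡 n) G) (S.X i)) = 0 := by
  have : Module.Finite ℝ (GroupLieAlgebra (𝓡 n) G) := finiteDimensionalTangentSpace (1 : G)
  refine LinearMap.trace_eq_zero_of_mapsTo_ne S.isInternal (fun j => j + 1) (by simp) ?_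
  intro j y hy
  rcases Nat.eq_zero_or_pos j with rfl | hj
  · rw [S.layer_eq_bot 0 (Or.inl rfl), SetLike.mem_coe, Submodule.mem_bot] at hy
    rw [hy, map_zero]
    exact Submodule.zero_mem _
  · rw [SetLike.mem_coe, ← S.bracket_layer j hj]
    exact Submodule.subset_span ⟨_, (S.frame i).2, y, hy, rfl⟩

lemma popp_leftDiff (q : G)
    (v : Fin (Module.finrank ℝ (GroupLieAlgebra (𝓡 n) G)) → GroupLieAlgebra (𝓡 n) G) :
    S.popp q (fun a => leftDiff q (v a)) = S.poppAtOne v := by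
  change S.poppAtOne (fun a => leftDiffInv q (leftDiff q (v a))) = _
  simp only [leftDiffInv_leftDiff]

lemma poppAtOne_auxBasis_ne_zero : S.poppAtOne (auxBasis n G) ≠ 0 := by
  have : S.poppAtOne (auxBasis n G) = √(Matrix.of fun a b => S.scalarProduct (auxBasis n G a) (auxBasis n G b)).det * (auxBasis n G).det (auxBasis n G) := rfl
  rw [this, Module.Basis.det_self, mul_one]
  exact (Real.sqrt_pos.2 S.det_scalarProduct_pos).ne'

/-- Every component of `z` other than the `a`-th repeats a basis vector and contributes zero. -/
lemma _root_.AlternatingMap.map_update_basis {ι M : Type*} [Fintype ι] [DecidableEq ι]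
    [AddCommGroup M] [Module ℝ M] (b : Module.Basis ι ℝ M) (w : M [⋀^ι]→ₗ[ℝ] ℝ) (a : ι) (z : M) :
    w (Function.update b a z) = b.repr z a * w b := by
  conv_lhs => rw [← b.sum_repr z]
  rw [AlternatingMap.map_update_sum, Finset.sum_eq_single a]
  · rw [AlternatingMap.map_update_smul, Function.update_eq_self, smul_eq_mul]
  · intro c _ hc
    rw [AlternatingMap.map_update_smul, AlternatingMap.map_update_self _ _ hc.symm, smul_zero]
  · simp

/-- Popp's form is constant on the left-invariant frame, so only the bracket terms of the Lie
derivative survive, and they assemble into a trace. -/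
lemma divergence_popp {X : ∀ q : G, TangentSpace (𝓡 n) q} (q : G)
    (z : Fin (Module.finrank ℝ (GroupLieAlgebra (𝓡 n) G)) → GroupLieAlgebra (𝓡 n) G)
    (hz : ∀ a, mlieBracket (𝓡 n) X (fun p => leftDiff p (auxBasis n G a)) q = leftDiff q (z a)) :
    divergence S.popp X q = -∑ a, (auxBasis n G).repr (z a) a := by
  have h1 : derivAlong X (fun p => S.popp p fun a => leftDiff p (auxBasis n G a)) q = 0 := by
    have hc : (fun p => S.popp p fun a => leftDiff p (auxBasis n G a)) =
        fun _ => S.poppAtOne (auxBasis n G) := funext fun p => S.popp_leftDiff p _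
    rw [hc]
    exact congrArg (fun L : EuclideanSpace ℝ (Fin n) →L[ℝ] ℝ => L (X q)) mfderiv_const
  have h2 : ∀ a, S.popp q (Function.update (fun b => leftDiff q (auxBasis n G b)) a
      (mlieBracket (𝓡 n) X (fun p => leftDiff p (auxBasis n G a)) q)) =
      (auxBasis n G).repr (z a) a * S.poppAtOne (auxBasis n G) := by
    intro a
    rw [hz, ← AlternatingMap.map_update_basis, ← popp_leftDiff S q]
    congr 1
    funext b
    by_cases hb : b = a
    · subst hb; simp
    · simp [hb]
  rw [divergence, lieDerivative, h1]
  simp only [h2]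
  rw [popp_leftDiff, ← Finset.sum_mul, zero_sub, neg_div,
    mul_div_cancel_right₀ _ S.poppAtOne_auxBasis_ne_zero]

lemma derivAlong_leftDiff_sum (v : GroupLieAlgebra (𝓡 n) G) (f : G → ℝ) (q : G) :
    ∑ a, derivAlong (fun p => leftDiff p (auxBasis n G a)) f q * (auxBasis n G).repr v a =
      derivAlong (fun p => leftDiff p v) f q := by
  have h : ∀ w, derivAlong (fun p => leftDiff p w) f q =
      ((mfderiv (𝓡 n) 𝓘(ℝ, ℝ) f q : EuclideanSpace ℝ (Fin n) →L[ℝ] ℝ) ∘L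
        (leftDiff q : EuclideanSpace ℝ (Fin n) →L[ℝ] EuclideanSpace ℝ (Fin n))) w := fun _ => rfl
  simp only [h]
  conv_rhs => rw [← (auxBasis n G).sum_repr v]
  rw [map_sum]
  refine Finset.sum_congr rfl fun a _ => ?_
  rw [map_smul]
  exact mul_comm _ _

lemma smoothField_XField (i : Fin S.rank) : SmoothField (S.XField i) := smoothField_leftDiff _

lemma grad_eq_sum (f : G → ℝ) :
    S.grad f = ∑ i, derivAlong (S.XField i) f • S.XField i := by
  funext q
  rw [Finset.sum_apply]
  rfl

/-- The macroscopic Laplacian is the sum of squares of the frame. -/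
lemma macroLaplacian_popp {f : G → ℝ} (hf : ContMDiff (𝓡 n) 𝓘(ℝ, ℝ) ∞ f) (q : G) :
    S.macroLaplacian S.popp f q =
      ∑ i, derivAlong (S.XField i) (derivAlong (S.XField i) f) q := by
  -- The witness is `[grad f, E_a]` expanded by the Leibniz rule, with `E_a` the left-invariant
  -- frame: `-E_a(X_i f) X_i + (X_i f) [X_i, E_a]`, summed over `i`.
  rw [macroLaplacian, S.divergence_popp q (fun a => ∑ i,
    (-derivAlong (fun p => leftDiff p (auxBasis n G a)) (derivAlong (S.XField i) f) q • S.X i +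
      derivAlong (S.XField i) f q • ⁅S.X i, auxBasis n G a⁆))]
  · simp only [map_sum, map_add, map_smul, Finsupp.coe_finsetSum, Finset.sum_apply,
      Finsupp.add_apply, Finsupp.smul_apply, smul_eq_mul]
    rw [Finset.sum_comm, ← Finset.sum_neg_distrib]
    refine Finset.sum_congr rfl fun i _ => ?_
    rw [Finset.sum_add_distrib, ← Finset.mul_sum]
    -- This is the contribution of the divergence of `X_i`, which is `-tr(ad X_i)`.
    have h1 : ∑ a, (auxBasis n G).repr ⁅S.X i, auxBasis n G a⁆ a = 0 := by
      rw [← S.trace_ad_X i, LinearMap.trace_eq_matrix_trace ℝ (auxBasis n G), Matrix.trace]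
      refine Finset.sum_congr rfl fun a _ => ?_
      rw [Matrix.diag_apply, LinearMap.toMatrix_apply]
      rfl
    rw [h1, mul_zero, add_zero]
    simp only [neg_mul, Finset.sum_neg_distrib, neg_neg]
    exact derivAlong_leftDiff_sum _ _ _
  · intro a
    rw [grad_eq_sum, mlieBracket_sum_smul_left _ _ (fun i => S.smoothField_XField i)
      (fun i => contMDiff_derivAlong (S.smoothField_XField i) hf), map_sum]
    refine Finset.sum_congr rfl fun i _ => ?_
    rw [map_add, map_smul, map_smul, ← mlieBracket_leftDiff]
    rfl

end CarnotStructure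
end CarnotGroup

/-! ### Flows whose time of existence does not depend on the momentum. -/

open ODE ODE.FunSpace in
/-- The local flow of the Picard-Lindelöf theorem stays in the ball in which the vector field is
controlled. -/
theorem IsPicardLindelof.exists_lipschitzOnWith_flow_mem_closedBall {E : Type*}
    [NormedAddCommGroup E] [NormedSpace ℝ E] [CompleteSpace E] {f : ℝ → E → E} {tmin tmax : ℝ}
    {t₀ : Set.Icc tmin tmax} {x₀ : E} {a r L K : NNReal}
    (hf : IsPicardLindelof f t₀ x₀ a r L K) :
    ∃ α : E → ℝ → E, (∀ x ∈ Metric.closedBall x₀ r, α x t₀ = x ∧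
      ∀ t ∈ Set.Icc tmin tmax, HasDerivWithinAt (α x) (f t (α x t)) (Set.Icc tmin tmax) t ∧
        α x t ∈ Metric.closedBall x₀ a) ∧
      ∃ L' : NNReal, ∀ t ∈ Set.Icc tmin tmax,
        LipschitzOnWith L' (α · t) (Metric.closedBall x₀ r) := by
  classical
  have (x) (hx : x ∈ Metric.closedBall x₀ r) := exists_isFixedPt_next hf hx
  choose α hα using this
  -- The value `0` outside the ball of initial points is arbitrary: nothing is claimed there.
  refine ⟨fun x => if hx : x ∈ Metric.closedBall x₀ r then (α x hx).compProj else 0,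
    fun x hx => ⟨?_, fun t ht => ⟨?_, ?_⟩⟩, ?_⟩
  · simp only [dif_pos hx]
    rw [compProj_val, ← hα, next_apply₀]
  · simp only [dif_pos hx]
    rw [compProj_apply]
    apply hasDerivWithinAt_picard_Icc t₀.2 hf.continuousOn_uncurry
      (α x hx |>.continuous_compProj.continuousOn)
      (fun _ ht' ↦ α x hx |>.compProj_mem_closedBall hf.mul_max_le)
      x ht |>.congr_of_mem _ ht
    intro t' ht'
    nth_rw 1 [← hα]
    rw [compProj_of_mem ht', next_apply]
  · simp only [dif_pos hx]
    exact (α x hx).compProj_mem_closedBall hf.mul_max_le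
  · obtain ⟨L', h⟩ := exists_forall_closedBall_funSpace_dist_le_mul hf
    refine ⟨L', fun t ht ↦ LipschitzOnWith.of_dist_le_mul fun x hx y hy ↦ ?_⟩
    simp only [dif_pos hx, dif_pos hy]
    rw [compProj_apply, compProj_apply,
      ← toContinuousMap_apply_eq_apply, ← toContinuousMap_apply_eq_apply]
    have : Nonempty (Set.Icc tmin tmax) := ⟨t₀⟩
    apply ContinuousMap.dist_le_iff_of_nonempty.mp
    exact h x y hx hy (α x hx) (α y hy) (hα x hx) (hα y hy)

section UniformFlow

variable {W E F : Type*} [NormedAddCommGroup W] [NormedSpace ℝ W] [FiniteDimensional ℝ W]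
  [NormedAddCommGroup E] [NormedSpace ℝ E] [FiniteDimensional ℝ E]
  [NormedAddCommGroup F] [InnerProductSpace ℝ F] [FiniteDimensional ℝ F]

/-- The vector field on the product of a space of momenta and of a space of positions, in which
the momentum evolves quadratically and the velocity depends linearly on the momentum. -/
def momentumField (π : W →L[ℝ] F) (B : F →L[ℝ] W →L[ℝ] W) (A : E → F →L[ℝ] E) (p : W × E) : W × E :=
  (B (π p.1) p.1, A p.2 (π p.1))

/-- The bound on `χ` controls the field in the Picard theorem. Radiality keeps the truncated
quadratic part tangent to the spheres, so that the truncation is inactive on solutions of unit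
momentum. -/
lemma exists_radial_cutoff : ∃ χ : F → F, ContDiff ℝ 1 χ ∧ (∀ a, ‖χ a‖ ≤ 2) ∧
    (∀ a, ‖a‖ ≤ 1 → χ a = a) ∧ ∀ a, ∃ c : ℝ, χ a = c • a := by
  let b : ContDiffBump (0 : F) := ⟨1, 2, one_pos, one_lt_two⟩
  refine ⟨fun a => b a • a, b.contDiff.smul contDiff_id, fun a => ?_, fun a ha => ?_,
    fun a => ⟨b a, rfl⟩⟩
  · rw [norm_smul, Real.norm_eq_abs, abs_of_nonneg b.nonneg]
    rcases lt_or_ge ‖a‖ 2 with h | h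
    · exact (mul_le_of_le_one_left (norm_nonneg _) b.le_one).trans h.le
    · rw [b.zero_of_le_dist (by simpa using h), zero_mul]; norm_num
  · change b a • a = a
    rw [b.one_of_mem_closedBall (by simpa using ha), one_smul]

/-- If the quadratic part of the field is tangent to the spheres `‖π ξ‖ = c`, then the flow starting
from the cylinder `‖π ξ‖ = 1` is defined up to a time which does not depend on the momentum. -/
theorem exists_uniform_momentum_flow (π : W →L[ℝ] F) (B : F →L[ℝ] W →L[ℝ] W)
    (hB : ∀ ξ, inner ℝ (π ξ) (π (B (π ξ) ξ)) = 0) {A : E → F →L[ℝ] E} {U : Set E} (hU : IsOpen U)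
    {x₀ : E} (hx₀ : x₀ ∈ U) (hA : ContDiffOn ℝ 1 A U) :
    ∃ T > 0, ∃ ρ > 0, Metric.closedBall x₀ ρ ⊆ U ∧ ∀ ξ₀ : W, ∃ r > 0, ∃ α : W → ℝ → W × E,
      (∀ ξ ∈ Metric.closedBall ξ₀ r, ‖π ξ‖ = 1 → α ξ 0 = (ξ, x₀) ∧ ∀ t ∈ Set.Ioo (-T) T,
        HasDerivAt (α ξ) (momentumField π B A (α ξ t)) t ∧ ‖π (α ξ t).1‖ = 1 ∧
        (α ξ t).2 ∈ Metric.closedBall x₀ ρ ∧ ‖(α ξ t).1‖ ≤ 2 * (‖ξ₀‖ + 1)) ∧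
      ∀ t ∈ Set.Ioo (-T) T, ContinuousOn (α · t) (Metric.closedBall ξ₀ r) := by
  obtain ⟨χ, hχ, hχ2, hχ1, hχr⟩ := exists_radial_cutoff (F := F)
  obtain ⟨ρ', hρ', hρU'⟩ := Metric.nhds_basis_closedBall.mem_iff.1 (hU.mem_nhds hx₀)
  -- The bound `ρ ≤ 1` will give `‖η‖ ≤ 2` on the ball around the rescaled momentum `η₀`, which has
  -- norm at most `1`.
  set ρ := min ρ' 1 with hρdef
  have hρ : 0 < ρ := lt_min hρ' one_pos
  have hρ1 : ρ ≤ 1 := min_le_right _ _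
  have hρU : Metric.closedBall x₀ ρ ⊆ U :=
    (Metric.closedBall_subset_closedBall (min_le_left _ _)).trans hρU'
  obtain ⟨M, hM⟩ := (isCompact_closedBall x₀ ρ).exists_bound_of_continuousOn
    (hA.continuousOn.mono hρU)
  have hM0 : 0 ≤ M := (norm_nonneg _).trans (hM x₀ (Metric.mem_closedBall_self hρ.le))
  -- Bounds for the two components of the truncated field: the cutoff and the rescaled momentum are
  -- both at most `2`. Neither `L` nor `T` involves `ξ₀`; this is the uniformity.
  set L := max (‖B‖ * 2 * 2) (M * 2) with hL
  have hL0 : 0 ≤ L := (by positivity : 0 ≤ M * 2).trans (le_max_right _ _)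
  set T := ρ / (2 * (L + 1)) with hT
  have hT0 : 0 < T := by positivity
  refine ⟨T, hT0, ρ, hρ, hρU, fun ξ₀ => ?_⟩
  -- In terms of `η = ξ / N` the equation remains linear in the full momentum, and the large factor
  -- `N` occurs only inside the cutoff.
  set N := ‖ξ₀‖ + 1 with hN
  have hN0 : 0 < N := by positivity
  set η₀ := N⁻¹ • ξ₀ with hη₀
  have hη₀1 : ‖η₀‖ ≤ 1 := by
    rw [hη₀, norm_smul, norm_inv, Real.norm_of_nonneg hN0.le, inv_mul_le_iff₀ hN0]
    linarith
  set V : W × E → W × E := fun p => (B (χ (N • π p.1)) p.1, A p.2 (χ (N • π p.1))) with hV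
  have hball : ∀ p ∈ Metric.closedBall (η₀, x₀) ρ, ‖p.1‖ ≤ 2 ∧ p.2 ∈ Metric.closedBall x₀ ρ := by
    rintro ⟨η, x⟩ hp
    rw [← closedBall_prod_same] at hp
    refine ⟨?_, hp.2⟩
    have h1 : ‖η - η₀‖ ≤ ρ := by simpa [dist_eq_norm] using hp.1
    have h2 : ‖η‖ ≤ ‖η - η₀‖ + ‖η₀‖ := by simpa using norm_add_le (η - η₀) η₀
    change ‖η‖ ≤ 2
    linarith
  have hVsmooth : ContDiffOn ℝ 1 V (Metric.closedBall (η₀, x₀) ρ) := by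
    have h1 : ContDiff ℝ 1 fun p : W × E => χ (N • π p.1) :=
      hχ.comp (contDiff_const.smul (π.contDiff.comp contDiff_fst))
    have h2 : ContDiffOn ℝ 1 (fun p : W × E => A p.2) (Metric.closedBall (η₀, x₀) ρ) :=
      hA.comp contDiff_snd.contDiffOn fun p hp => hρU (hball p hp).2
    exact (((B.contDiff.comp h1).clm_apply contDiff_fst).contDiffOn).prodMk
      (h2.clm_apply h1.contDiffOn)
  obtain ⟨K, hK⟩ := hVsmooth.exists_lipschitzOnWith one_ne_zero (convex_closedBall _ _)
    (isCompact_closedBall _ _)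
  have hVL : ∀ p ∈ Metric.closedBall (η₀, x₀) ρ, ‖V p‖ ≤ L := by
    intro p hp
    obtain ⟨h1, h2⟩ := hball p hp
    refine max_le_max ?_ ?_
    · refine (ContinuousLinearMap.le_opNorm _ _).trans ?_
      gcongr
      exact (B.le_opNorm _).trans (by gcongr; exact hχ2 _)
    · refine (ContinuousLinearMap.le_opNorm _ _).trans ?_
      gcongr
      · exact hM _ h2
      · exact hχ2 _
  have hPL : IsPicardLindelof (fun _ => V) (tmin := -T) (tmax := T) ⟨0, by simp [hT0.le]⟩ (η₀, x₀)
      ⟨ρ, hρ.le⟩ ⟨ρ / 2, by positivity⟩ ⟨L, hL0⟩ K := by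
    refine ⟨fun _ _ => hK, fun _ _ => continuousOn_const, fun _ _ => hVL, ?_⟩
    simp only [sub_zero, zero_sub, neg_neg, max_self]
    have : (L + 1) * T = ρ / 2 := by rw [hT]; field_simp
    change L * T ≤ ρ - ρ / 2
    linarith
  obtain ⟨β, hβ, L', hL'⟩ := hPL.exists_lipschitzOnWith_flow_mem_closedBall
  change ∀ x ∈ Metric.closedBall (η₀, x₀) (ρ / 2), β x 0 = x ∧ ∀ t ∈ Set.Icc (-T) T,
    HasDerivWithinAt (β x) (V (β x t)) (Set.Icc (-T) T) t ∧
      β x t ∈ Metric.closedBall (η₀, x₀) ρ at hβ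
  set e : W → W × E := fun ξ => (N⁻¹ • ξ, x₀) with he
  have hemaps : Set.MapsTo e (Metric.closedBall ξ₀ (N * (ρ / 2)))
      (Metric.closedBall (η₀, x₀) (ρ / 2)) := by
    intro ξ hξ
    rw [← closedBall_prod_same]
    refine ⟨?_, Metric.mem_closedBall_self (by positivity)⟩
    rw [Metric.mem_closedBall, dist_eq_norm] at hξ ⊢
    rw [he, hη₀, ← smul_sub, norm_smul, norm_inv, Real.norm_of_nonneg hN0.le,
      inv_mul_le_iff₀ hN0]
    exact hξ
  refine ⟨N * (ρ / 2), by positivity, fun ξ t => (N • (β (e ξ) t).1, (β (e ξ) t).2), ?_, ?_⟩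
  · intro ξ hξ hπ
    obtain ⟨h0, h1⟩ := hβ (e ξ) (hemaps hξ)
    refine ⟨?_, ?_⟩
    · change (N • (β (e ξ) 0).1, (β (e ξ) 0).2) = _
      rw [h0]
      simp [he, hN0.ne']
    have hmem : (0 : ℝ) ∈ Set.Icc (-T) T := ⟨by linarith, hT0.le⟩
    have hder : ∀ t ∈ Set.Icc (-T) T, HasDerivWithinAt (fun t => N • (β (e ξ) t).1)
        (N • (V (β (e ξ) t)).1) (Set.Icc (-T) T) t := fun t ht =>
      ((ContinuousLinearMap.fst ℝ W E).hasFDerivAt.comp_hasDerivWithinAt t (h1 t ht).1).const_smul N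
    -- The derivative of the squared norm is a multiple of the pairing in `hB`, the cutoff being
    -- radial; hence it vanishes.
    have hnorm : ∀ t ∈ Set.Icc (-T) T, ‖π (N • (β (e ξ) t).1)‖ ^ 2 = 1 := by
      have hd : ∀ t ∈ Set.Icc (-T) T, HasDerivWithinAt (fun t => ‖π (N • (β (e ξ) t).1)‖ ^ 2) 0
          (Set.Icc (-T) T) t := by
        intro t ht
        have := (π.hasFDerivAt.comp_hasDerivWithinAt t (hder t ht)).norm_sq
        refine this.congr_deriv ?_
        obtain ⟨c, hc⟩ := hχr (N • π (β (e ξ) t).1)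
        have h2 := hB (N • (β (e ξ) t).1)
        simp only [hV, hc, map_smul, smul_apply, Function.comp_apply,
          inner_smul_left, inner_smul_right, RCLike.conj_to_real] at h2 ⊢
        linear_combination 2 * c * h2
      intro t ht
      have := (convex_Icc (-T) T).norm_image_sub_le_of_norm_hasDerivWithin_le (C := 0) hd
        (by simp) hmem ht
      simp only [zero_mul, norm_le_zero_iff, sub_eq_zero] at this
      rw [this, h0]
      simp [he, hN0.ne', hπ]
    have hnorm1 : ∀ t ∈ Set.Icc (-T) T, ‖π (N • (β (e ξ) t).1)‖ = 1 := fun t ht =>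
      (pow_eq_one_iff_of_nonneg (norm_nonneg _) two_ne_zero).1 (hnorm t ht)
    intro t ht
    have ht' := Set.Ioo_subset_Icc_self ht
    obtain ⟨hb1, hb2⟩ := hball _ (h1 t ht').2
    refine ⟨?_, hnorm1 t ht', hb2, ?_⟩
    -- On momenta of norm `1` the cutoff is the identity, so the rescaled curve solves the original
    -- system.
    · have hχt : χ (N • π (β (e ξ) t).1) = π (N • (β (e ξ) t).1) := by
        rw [map_smul]
        refine hχ1 _ ?_
        rw [← map_smul, hnorm1 t ht']
      have hn := Icc_mem_nhds ht.1 ht.2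
      have hd1 := (hder t ht').hasDerivAt hn
      have hd2 := ((ContinuousLinearMap.snd ℝ W E).hasFDerivAt.comp_hasDerivWithinAt t
        (h1 t ht').1).hasDerivAt hn
      refine (hd1.prodMk hd2).congr_deriv ?_
      simp only [momentumField, hV, hχt, map_smul, ContinuousLinearMap.coe_snd']
    · change ‖N • (β (e ξ) t).1‖ ≤ _
      rw [norm_smul, Real.norm_of_nonneg hN0.le, mul_comm]
      gcongr
  · intro t ht
    have he' : Continuous e := by fun_prop
    have h3 := (hL' t (Set.Ioo_subset_Icc_self ht)).continuousOn.comp he'.continuousOn hemaps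
    exact (continuousOn_const.smul (continuous_fst.comp_continuousOn h3)).prodMk
      (continuous_snd.comp_continuousOn h3)

end UniformFlow

namespace CarnotGroup

variable {n : ℕ} {G : Type*} [TopologicalSpace G] [ChartedSpace (EuclideanSpace ℝ (Fin n)) G]
  [Group G] [LieGroup (𝓡 n) ∞ G]

/-! ### Curves in charts -/

/-- A vector field read in the chart at `p`. -/
def fieldInChart (p : G) (Y : ∀ q : G, TangentSpace (𝓡 n) q) (x : EuclideanSpace ℝ (Fin n)) :
    EuclideanSpace ℝ (Fin n) :=
  mfderiv (𝓡 n) 𝓘(ℝ, EuclideanSpace ℝ (Fin n)) (extChartAt (𝓡 n) p) ((extChartAt (𝓡 n) p).symm x)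
    (Y ((extChartAt (𝓡 n) p).symm x))

/-- The differential of the chart is the trivialization of the tangent bundle over its domain, and
smooth sections have smooth coordinates there. -/
lemma contDiffOn_fieldInChart (p : G) {Y : ∀ q : G, TangentSpace (𝓡 n) q} (hY : SmoothField Y) :
    ContDiffOn ℝ ∞ (fieldInChart p Y) (extChartAt (𝓡 n) p).target := by
  set e := trivializationAt (EuclideanSpace ℝ (Fin n)) (TangentSpace (𝓡 n)) p with he
  have h1 : ContMDiffOn (𝓡 n) 𝓘(ℝ, EuclideanSpace ℝ (Fin n)) ∞
      (fun q => (e ⟨q, Y q⟩).2) e.baseSet :=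
    e.contMDiffOn_section_baseSet_iff.1 (ContMDiff.contMDiffOn hY)
  have hb : e.baseSet = (chartAt (EuclideanSpace ℝ (Fin n)) p).source :=
    TangentBundle.trivializationAt_baseSet p
  have h2 := h1.comp (contMDiffOn_extChartAt_symm (I := 𝓡 n) (n := ∞) p) (by
    intro x hx
    rw [Set.mem_preimage, hb, ← extChartAt_source (𝓡 n)]
    exact (extChartAt (𝓡 n) p).map_target hx)
  refine h2.contDiffOn.congr fun x hx => ?_
  have hs : (extChartAt (𝓡 n) p).symm x ∈ (chartAt (EuclideanSpace ℝ (Fin n)) p).source := by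
    rw [← extChartAt_source (𝓡 n)]
    exact (extChartAt (𝓡 n) p).map_target hx
  have h3 := TangentBundle.continuousLinearMapAt_trivializationAt (I := 𝓡 n) hs
  have h4 := congrArg (fun L : EuclideanSpace ℝ (Fin n) →L[ℝ] EuclideanSpace ℝ (Fin n) =>
    L (Y ((extChartAt (𝓡 n) p).symm x))) h3
  refine h4.symm.trans ?_
  rw [Function.comp_apply]
  exact Bundle.Trivialization.continuousLinearMapAt_apply_of_mem _ _ (hb ▸ hs) _

/-- The tangent vector of a curve, as a continuous linear map. -/
abbrev velocity (q : G) (w : TangentSpace (𝓡 n) q) : ℝ →L[ℝ] TangentSpace (𝓡 n) q :=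
  (1 : ℝ →L[ℝ] ℝ).smulRight w

lemma hasDerivAt_extChartAt_comp (p : G) {γ : ℝ → G} {t : ℝ} {w : TangentSpace (𝓡 n) (γ t)}
    (hγ : HasMFDerivAt 𝓘(ℝ, ℝ) (𝓡 n) γ t (velocity (γ t) w))
    (hs : γ t ∈ (extChartAt (𝓡 n) p).source) :
    HasDerivAt (fun s => extChartAt (𝓡 n) p (γ s))
      (mfderiv (𝓡 n) 𝓘(ℝ, EuclideanSpace ℝ (Fin n)) (extChartAt (𝓡 n) p) (γ t) w :
        EuclideanSpace ℝ (Fin n)) t := by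
  have h1 := (mdifferentiableAt_extChartAt (I := 𝓡 n) (x := p)
    (by rwa [← extChartAt_source (𝓡 n)])).hasMFDerivAt
  let D : EuclideanSpace ℝ (Fin n) →L[ℝ] EuclideanSpace ℝ (Fin n) :=
    mfderiv (𝓡 n) 𝓘(ℝ, EuclideanSpace ℝ (Fin n)) (extChartAt (𝓡 n) p) (γ t)
  let v : EuclideanSpace ℝ (Fin n) := w
  have h2 : HasFDerivAt (fun s => extChartAt (𝓡 n) p (γ s))
    (D.comp ((1 : ℝ →L[ℝ] ℝ).smulRight v)) t := (HasMFDerivAt.comp t h1 hγ).hasFDerivAt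
  refine h2.hasDerivAt.congr_deriv ?_
  change D ((1 : ℝ) • v) = D v
  rw [one_smul]

lemma hasMFDerivAt_extChartAt_symm_comp (p : G) {x : ℝ → EuclideanSpace ℝ (Fin n)} {t : ℝ}
    (hs : x t ∈ (extChartAt (𝓡 n) p).target)
    {w : TangentSpace (𝓡 n) ((extChartAt (𝓡 n) p).symm (x t))}
    (hx : HasDerivAt x (mfderiv (𝓡 n) 𝓘(ℝ, EuclideanSpace ℝ (Fin n)) (extChartAt (𝓡 n) p)
      ((extChartAt (𝓡 n) p).symm (x t)) w : EuclideanSpace ℝ (Fin n)) t) :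
    HasMFDerivAt 𝓘(ℝ, ℝ) (𝓡 n) (fun s => (extChartAt (𝓡 n) p).symm (x s)) t
      (velocity ((extChartAt (𝓡 n) p).symm (x t)) w) := by
  have h0 := (mdifferentiableWithinAt_extChartAt_symm (I := 𝓡 n) hs).hasMFDerivWithinAt
  rw [(𝓡 n).range_eq_univ, hasMFDerivWithinAt_univ] at h0
  have h1 := HasMFDerivAt.comp t h0 hx.hasFDerivAt.hasMFDerivAt
  have h2 := mfderivWithin_extChartAt_symm_comp_mfderiv_extChartAt (I := 𝓡 n) hs
  rw [(𝓡 n).range_eq_univ] at h2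
  refine h1.congr_mfderiv ?_
  have h3 := congrArg (fun L : EuclideanSpace ℝ (Fin n) →L[ℝ] EuclideanSpace ℝ (Fin n) => L w) h2
  refine ContinuousLinearMap.ext fun (c : ℝ) => ?_
  refine (ContinuousLinearMap.map_smul
    (mfderivWithin 𝓘(ℝ, EuclideanSpace ℝ (Fin n)) (𝓡 n) (extChartAt (𝓡 n) p).symm Set.univ (x t) :
      EuclideanSpace ℝ (Fin n) →L[ℝ] EuclideanSpace ℝ (Fin n)) c
    (mfderiv (𝓡 n) 𝓘(ℝ, EuclideanSpace ℝ (Fin n)) (extChartAt (𝓡 n) p)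
      ((extChartAt (𝓡 n) p).symm (x t)) w)).trans ?_
  exact congrArg (fun v : EuclideanSpace ℝ (Fin n) => c • v) h3

lemma hasDerivAt_comp_of_contMDiff {f : G → ℝ} (hf : ContMDiff (𝓡 n) 𝓘(ℝ, ℝ) ∞ f) {γ : ℝ → G}
    {t : ℝ} {Y : ∀ q : G, TangentSpace (𝓡 n) q}
    (hγ : HasMFDerivAt 𝓘(ℝ, ℝ) (𝓡 n) γ t (velocity (γ t) (Y (γ t)))) :
    HasDerivAt (fun s => f (γ s)) (CarnotStructure.derivAlong Y f (γ t)) t := by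
  let D : EuclideanSpace ℝ (Fin n) →L[ℝ] ℝ := mfderiv (𝓡 n) 𝓘(ℝ, ℝ) f (γ t)
  let v : EuclideanSpace ℝ (Fin n) := Y (γ t)
  have h2 : HasFDerivAt (fun s => f (γ s)) (D.comp ((1 : ℝ →L[ℝ] ℝ).smulRight v)) t :=
    (HasMFDerivAt.comp t (hf.mdifferentiable (by simp) (γ t)).hasMFDerivAt hγ).hasFDerivAt
  refine h2.hasDerivAt.congr_deriv ?_
  change D ((1 : ℝ) • v) = D v
  rw [one_smul]

end CarnotGroup

namespace CarnotGroup

variable {n : ℕ} {G : Type*} [TopologicalSpace G] [ChartedSpace (EuclideanSpace ℝ (Fin n)) G]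
  [Group G] [LieGroup (𝓡 n) ∞ G]

namespace CarnotStructure

variable (S : CarnotStructure n G)

/-! ### The left-trivialized Hamiltonian system -/

/-- The values of a covector at the identity on the frame. -/
def momentum : Covector n →L[ℝ] EuclideanSpace ℝ (Fin S.rank) :=
  LinearMap.toContinuousLinearMap
    { toFun := fun ξ => WithLp.toLp 2 fun i => ξ (S.X i)
      map_add' := fun _ _ => rfl
      map_smul' := fun _ _ => rfl }

lemma momentum_apply (ξ : Covector n) (i : Fin S.rank) : S.momentum ξ i = ξ (S.X i) := rfl

/-- The horizontal vector with given coordinates in the frame. -/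
def horizontalVector : EuclideanSpace ℝ (Fin S.rank) →ₗ[ℝ] GroupLieAlgebra (𝓡 n) G where
  toFun a := ∑ i, a i • S.X i
  map_add' a b := by simp [add_smul, Finset.sum_add_distrib]
  map_smul' c a := by simp [mul_smul, Finset.smul_sum]

lemma horizontalVector_apply (a : EuclideanSpace ℝ (Fin S.rank)) :
    S.horizontalVector a = ∑ i, a i • S.X i := rfl

/-- The adjoint action of a horizontal vector, on the Euclidean space which is the Lie algebra. -/
def adHorizontal (a : EuclideanSpace ℝ (Fin S.rank)) :
    EuclideanSpace ℝ (Fin n) →L[ℝ] EuclideanSpace ℝ (Fin n) :=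
  LinearMap.toContinuousLinearMap (E := EuclideanSpace ℝ (Fin n)) (F' := EuclideanSpace ℝ (Fin n))
    (LieAlgebra.ad ℝ (GroupLieAlgebra (𝓡 n) G) (S.horizontalVector a))

lemma adHorizontal_apply (a : EuclideanSpace ℝ (Fin S.rank)) (v : GroupLieAlgebra (𝓡 n) G) :
    S.adHorizontal a v = ⁅S.horizontalVector a, v⁆ := rfl

/-- The infinitesimal coadjoint action of the horizontal vectors. -/
def coadjoint : EuclideanSpace ℝ (Fin S.rank) →L[ℝ] Covector n →L[ℝ] Covector n :=
  LinearMap.toContinuousLinearMap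
    { toFun := fun a => (ContinuousLinearMap.compL ℝ (EuclideanSpace ℝ (Fin n))
        (EuclideanSpace ℝ (Fin n)) ℝ).flip (S.adHorizontal a)
      map_add' := fun a b => by
        rw [← map_add]
        congr 1
        ext1 v
        refine (S.adHorizontal_apply (a + b) v).trans ?_
        rw [map_add]
        let w : GroupLieAlgebra (𝓡 n) G := v
        exact add_lie (S.horizontalVector a) (S.horizontalVector b) w
      map_smul' := fun c a => by
        rw [RingHom.id_apply, ← map_smul]
        congr 1
        ext1 v
        refine (S.adHorizontal_apply (c • a) v).trans ?_
        rw [map_smul]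
        let w : GroupLieAlgebra (𝓡 n) G := v
        exact smul_lie c (S.horizontalVector a) w }

lemma coadjoint_apply (a : EuclideanSpace ℝ (Fin S.rank)) (ξ : Covector n)
    (v : GroupLieAlgebra (𝓡 n) G) : S.coadjoint a ξ v = ξ
      (⁅S.horizontalVector a, v⁆ : GroupLieAlgebra (𝓡 n) G) := rfl

lemma _root_.CarnotGroup.Covector.map_sum_smul {ι : Type*} (s : Finset ι) (ξ : Covector n) (c : ι → ℝ)
    (v : ι → GroupLieAlgebra (𝓡 n) G) :
    ξ (∑ i ∈ s, c i • v i : GroupLieAlgebra (𝓡 n) G) = ∑ i ∈ s, c i * ξ (v i) := by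
  have h := map_sum (ξ : EuclideanSpace ℝ (Fin n) →L[ℝ] ℝ)
    (fun i => c i • (v i : EuclideanSpace ℝ (Fin n))) s
  refine h.trans (Finset.sum_congr rfl fun i _ => ?_)
  exact ContinuousLinearMap.map_smul ξ (c i) (v i : EuclideanSpace ℝ (Fin n))

lemma coadjoint_apply_eq_sum (a : EuclideanSpace ℝ (Fin S.rank)) (ξ : Covector n)
    (v : GroupLieAlgebra (𝓡 n) G) :
    S.coadjoint a ξ v = ∑ i, a i * ξ (⁅S.X i, v⁆ : GroupLieAlgebra (𝓡 n) G) := by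
  rw [coadjoint_apply, horizontalVector_apply, sum_lie]
  simp only [smul_lie]
  exact Covector.map_sum_smul _ _ _ _

/-- Conservation of the Hamiltonian: with `u` the horizontal vector of the momentum, the pairing is
`ξ([u, u])`. -/
lemma inner_momentum_coadjoint (ξ : Covector n) :
    inner ℝ (S.momentum ξ) (S.momentum (S.coadjoint (S.momentum ξ) ξ)) = 0 := by
  have h : S.coadjoint (S.momentum ξ) ξ (S.horizontalVector (S.momentum ξ)) = 0 := by
    rw [coadjoint_apply, lie_self]
    exact map_zero ξ
  rw [horizontalVector_apply] at h
  have h2 := (Covector.map_sum_smul Finset.univ (S.coadjoint (S.momentum ξ) ξ)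
    (fun i => S.momentum ξ i) S.X).symm.trans h
  rw [PiLp.inner_apply, ← h2]
  refine Finset.sum_congr rfl fun i _ => ?_
  rw [momentum_apply _ (S.coadjoint _ _)]
  simp [mul_comm]

/-- The left-trivialized form of the system of the normal extremals. -/
def IsReducedExtremalOn (γ : ℝ → G) (ξ : ℝ → Covector n) (J : Set ℝ) : Prop :=
  ∀ t ∈ J, HasMFDerivAt 𝓘(ℝ, ℝ) (𝓡 n) γ t
      (velocity (γ t) (leftDiff (γ t) (S.horizontalVector (S.momentum (ξ t))))) ∧
    HasDerivAt ξ (S.coadjoint (S.momentum (ξ t)) (ξ t)) t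

/-- The left trivialization of a covector at `q`. -/
def trivializeCovector (q : G) (l : Covector n) : Covector n :=
  l.comp (leftDiff q : EuclideanSpace ℝ (Fin n) →L[ℝ] EuclideanSpace ℝ (Fin n))

/-- The covector at `q` with a given left trivialization. -/
def untrivializeCovector (q : G) (ξ : Covector n) : Covector n :=
  ξ.comp (leftDiffInv q : EuclideanSpace ℝ (Fin n) →L[ℝ] EuclideanSpace ℝ (Fin n))

lemma untrivialize_trivializeCovector (q : G) (l : Covector n) :
    untrivializeCovector q (trivializeCovector q l) = l := by
  ext1 v
  exact congrArg l (leftDiff_leftDiffInv q v)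

lemma sum_smul_XField (q : G) (a : EuclideanSpace ℝ (Fin S.rank)) :
    ∑ i, a i • S.XField i q = leftDiff q (S.horizontalVector a) := by
  rw [horizontalVector_apply, map_sum]
  refine Finset.sum_congr rfl fun i _ => ?_
  rw [map_smul]
  rfl

lemma hasDerivAt_covector {ξ : ℝ → Covector n} {ξ' : Covector n} {t : ℝ}
    (h : ∀ v : EuclideanSpace ℝ (Fin n), HasDerivAt (fun s => ξ s v) (ξ' v) t) :
    HasDerivAt ξ ξ' t := by
  let b := (EuclideanSpace.basisFun (Fin n) ℝ).toBasis
  have key : ∀ η : Covector n, η = ∑ a, η (b a) • LinearMap.toContinuousLinearMap (b.coord a) := by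
    intro η
    ext1 v
    conv_lhs => rw [← b.sum_repr v]
    rw [map_sum, _root_.sum_apply]
    refine Finset.sum_congr rfl fun a _ => ?_
    rw [map_smul]
    exact mul_comm _ _
  have h2 : HasDerivAt (fun s => ∑ a, ξ s (b a) • LinearMap.toContinuousLinearMap (b.coord a))
      (∑ a, ξ' (b a) • LinearMap.toContinuousLinearMap (b.coord a)) t :=
    HasDerivAt.fun_sum fun a _ => HasDerivAt.smul_const (F := Covector n) (h (b a)) _
  rw [← key ξ'] at h2
  exact h2.congr_of_eventuallyEq (Filter.Eventually.of_forall fun s => key (ξ s))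

variable {S}

/-- Testing Hamilton's equations on left-invariant fields alone already gives the coadjoint
equation. -/
lemma IsNormalExtremalOn.isReducedExtremalOn {γ : ℝ → G} {Λ : ℝ → Covector n} {J : Set ℝ}
    (h : S.IsNormalExtremalOn γ Λ J) :
    S.IsReducedExtremalOn γ (fun t => trivializeCovector (γ t) (Λ t)) J := by
  intro t ht
  obtain ⟨h1, h2⟩ := h t ht
  refine ⟨?_, hasDerivAt_covector fun v => ?_⟩
  · rw [← sum_smul_XField]
    exact h1
  · refine (h2 _ (smoothField_leftDiff v)).congr_deriv ?_
    refine Eq.trans ?_ (S.coadjoint_apply_eq_sum _ _ _).symm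
    refine Finset.sum_congr rfl fun i _ => ?_
    exact congrArg (fun w : EuclideanSpace ℝ (Fin n) => Λ t (S.XField i (γ t)) * Λ t w)
      (mlieBracket_leftDiff (S.X i) v (γ t))

lemma IsReducedExtremalOn.hasDerivAt_comp {γ : ℝ → G} {ξ : ℝ → Covector n} {J : Set ℝ}
    (h : S.IsReducedExtremalOn γ ξ J) {f : G → ℝ} (hf : ContMDiff (𝓡 n) 𝓘(ℝ, ℝ) ∞ f)
    {t : ℝ} (ht : t ∈ J) : HasDerivAt (fun s => f (γ s))
      (∑ i, S.momentum (ξ t) i * derivAlong (S.XField i) f (γ t)) t := by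
  refine (hasDerivAt_comp_of_contMDiff hf (Y := fun q => leftDiff q
    (S.horizontalVector (S.momentum (ξ t)))) (h t ht).1).congr_deriv ?_
  have e := S.sum_smul_XField (γ t) (S.momentum (ξ t))
  refine (congrArg (mfderiv (𝓡 n) 𝓘(ℝ, ℝ) f (γ t)) e.symm).trans ?_
  exact Covector.map_sum_smul (G := G) Finset.univ (mfderiv (𝓡 n) 𝓘(ℝ, ℝ) f (γ t))
    (fun i => S.momentum (ξ t) i) (fun i => S.XField i (γ t))

/-- A smooth field is a combination of left-invariant ones with smooth coefficients; the product
rule along the curve matches the Leibniz rule for the bracket term by term. -/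
lemma IsReducedExtremalOn.isNormalExtremalOn {γ : ℝ → G} {ξ : ℝ → Covector n} {J : Set ℝ}
    (h : S.IsReducedExtremalOn γ ξ J) :
    S.IsNormalExtremalOn γ (fun t => untrivializeCovector (γ t) (ξ t)) J := by
  have hX : ∀ t i, untrivializeCovector (γ t) (ξ t) (S.XField i (γ t)) = S.momentum (ξ t) i :=
    fun t i => congrArg (ξ t) (leftDiffInv_leftDiff (γ t) (S.X i))
  have hL : ∀ t (v : GroupLieAlgebra (𝓡 n) G),
      untrivializeCovector (γ t) (ξ t) (leftDiff (γ t) v) = ξ t v :=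
    fun t v => congrArg (ξ t) (leftDiffInv_leftDiff (γ t) v)
  intro t ht
  obtain ⟨h1, h2⟩ := h t ht
  refine ⟨?_, fun Y hY => ?_⟩
  · simp only [hX]
    rw [sum_smul_XField]
    exact h1
  · have e : ∀ s, untrivializeCovector (γ s) (ξ s) (Y (γ s)) =
        ∑ a, coeff Y a (γ s) * ξ s (auxBasis n G a) := by
      intro s
      have h3 := (auxBasis n G).sum_repr (leftDiffInv (γ s) (Y (γ s)))
      exact (congrArg (ξ s) h3.symm).trans (Covector.map_sum_smul _ _ _ _)
    have h4 : ∀ v : EuclideanSpace ℝ (Fin n), HasDerivAt (fun s => ξ s v)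
        (S.coadjoint (S.momentum (ξ t)) (ξ t) v) t := fun v =>
      (ContinuousLinearMap.apply ℝ ℝ v).hasFDerivAt.comp_hasDerivAt t h2
    have h5 := HasDerivAt.fun_sum (u := Finset.univ) fun a _ =>
      (h.hasDerivAt_comp (contMDiff_coeff hY a) ht).mul (h4 (auxBasis n G a))
    refine (h5.congr_of_eventuallyEq (Filter.Eventually.of_forall e)).congr_deriv ?_
    have h6 : ∀ i, untrivializeCovector (γ t) (ξ t) (mlieBracket (𝓡 n) (S.XField i) Y (γ t)) =
        ∑ a, (derivAlong (S.XField i) (coeff Y a) (γ t) * ξ t (auxBasis n G a) +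
          coeff Y a (γ t) * ξ t (⁅S.X i, auxBasis n G a⁆ : GroupLieAlgebra (𝓡 n) G)) := by
      intro i
      have h7 := mlieBracket_leftDiff_coeff (S.X i) hY (γ t)
      rw [Finset.sum_add_distrib] at h7
      refine (congrArg (untrivializeCovector (γ t) (ξ t)) h7).trans ?_
      refine (map_add (untrivializeCovector (γ t) (ξ t)) (_ : EuclideanSpace ℝ (Fin n)) _).trans ?_
      rw [Finset.sum_add_distrib]
      refine congrArg₂ (· + ·) ((Covector.map_sum_smul (G := G) _ _ _ _).trans ?_)
        ((Covector.map_sum_smul (G := G) _ _ _ _).trans ?_)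
      · exact Finset.sum_congr rfl fun a _ => congrArg _ (hL t _)
      · exact Finset.sum_congr rfl fun a _ => congrArg _ (hL t _)
    simp only [hX, h6, coadjoint_apply_eq_sum]
    simp only [Finset.mul_sum, Finset.sum_mul, Finset.sum_add_distrib, mul_add]
    rw [Finset.sum_comm (f := fun i a => S.momentum (ξ t) i *
      (derivAlong (S.XField i) (coeff Y a) (γ t) * ξ t (auxBasis n G a))),
      Finset.sum_comm (f := fun i a => S.momentum (ξ t) i *
      (coeff Y a (γ t) * ξ t (⁅S.X i, auxBasis n G a⁆ : GroupLieAlgebra (𝓡 n) G)))]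
    refine congrArg₂ (· + ·) ?_ ?_
    · exact Finset.sum_congr rfl fun a _ => Finset.sum_congr rfl fun i _ => mul_assoc _ _ _
    · exact Finset.sum_congr rfl fun a _ => Finset.sum_congr rfl fun i _ => mul_left_comm _ _ _

end CarnotStructure
end CarnotGroup

namespace CarnotGroup

variable {n : ℕ} {G : Type*} [TopologicalSpace G] [ChartedSpace (EuclideanSpace ℝ (Fin n)) G]
  [Group G] [LieGroup (𝓡 n) ∞ G]

namespace CarnotStructure

variable (S : CarnotStructure n G)

/-! ### The Hamiltonian system in charts -/

/-- The frame, read in the chart at `p`. -/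
def frameInChart (p : G) (x : EuclideanSpace ℝ (Fin n)) :
    EuclideanSpace ℝ (Fin S.rank) →L[ℝ] EuclideanSpace ℝ (Fin n) :=
  ∑ i, (EuclideanSpace.proj i : EuclideanSpace ℝ (Fin S.rank) →L[ℝ] ℝ).smulRight
    (fieldInChart p (S.XField i) x)

lemma contDiffOn_frameInChart (p : G) :
    ContDiffOn ℝ 1 (S.frameInChart p) (extChartAt (𝓡 n) p).target := by
  refine ContDiffOn.sum fun i _ => ?_
  exact ((ContinuousLinearMap.smulRightL ℝ (EuclideanSpace ℝ (Fin S.rank))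
    (EuclideanSpace ℝ (Fin n)) (EuclideanSpace.proj i)).contDiff.comp_contDiffOn
    ((contDiffOn_fieldInChart p (S.smoothField_XField i)).of_le (by simp)))

lemma frameInChart_apply (p : G) (x : EuclideanSpace ℝ (Fin n))
    (a : EuclideanSpace ℝ (Fin S.rank)) :
    S.frameInChart p x a = mfderiv (𝓡 n) 𝓘(ℝ, EuclideanSpace ℝ (Fin n)) (extChartAt (𝓡 n) p)
      ((extChartAt (𝓡 n) p).symm x)
      (leftDiff ((extChartAt (𝓡 n) p).symm x) (S.horizontalVector a)) := by
  let D : EuclideanSpace ℝ (Fin n) →L[ℝ] EuclideanSpace ℝ (Fin n) :=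
    mfderiv (𝓡 n) 𝓘(ℝ, EuclideanSpace ℝ (Fin n)) (extChartAt (𝓡 n) p)
      ((extChartAt (𝓡 n) p).symm x)
  have h1 := S.sum_smul_XField ((extChartAt (𝓡 n) p).symm x) a
  let Y : Fin S.rank → EuclideanSpace ℝ (Fin n) :=
    fun i => S.XField i ((extChartAt (𝓡 n) p).symm x)
  have h2 : D (∑ i, a i • Y i) = ∑ i, a i • D (Y i) := by
    rw [map_sum]
    exact Finset.sum_congr rfl fun i _ => map_smul D _ _
  refine Eq.trans ?_ (congrArg D h1)
  refine Eq.trans ?_ h2.symm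
  rw [frameInChart, _root_.sum_apply]
  rfl

/-- The Hamiltonian vector field in the chart at `p`. -/
abbrev chartField (p : G) : Covector n × EuclideanSpace ℝ (Fin n) →
    Covector n × EuclideanSpace ℝ (Fin n) :=
  momentumField S.momentum S.coadjoint (S.frameInChart p)

lemma contDiffAt_chartField (p : G) {z : Covector n × EuclideanSpace ℝ (Fin n)}
    (hz : z.2 ∈ (extChartAt (𝓡 n) p).target) : ContDiffAt ℝ 1 (S.chartField p) z := by
  have h1 : ContDiffAt ℝ 1 (fun z : Covector n × EuclideanSpace ℝ (Fin n) =>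
      S.frameInChart p z.2) z :=
    ContDiffAt.comp (g := S.frameInChart p) (f := Prod.snd) z ((S.contDiffOn_frameInChart p).contDiffAt
      ((isOpen_extChartAt_target p).mem_nhds hz)) contDiffAt_snd
  have h2 : ContDiff ℝ 1 fun z : Covector n × EuclideanSpace ℝ (Fin n) => S.momentum z.1 :=
    S.momentum.contDiff.comp contDiff_fst
  exact ((S.coadjoint.contDiff.comp h2).clm_apply contDiff_fst).contDiffAt.prodMk
    (h1.clm_apply h2.contDiffAt)

variable {S}

lemma IsReducedExtremalOn.hasDerivAt_chart {γ : ℝ → G} {ξ : ℝ → Covector n} {J : Set ℝ}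
    (h : S.IsReducedExtremalOn γ ξ J) {t : ℝ} (ht : t ∈ J) (p : G)
    (hs : γ t ∈ (extChartAt (𝓡 n) p).source) :
    HasDerivAt (fun s => (ξ s, extChartAt (𝓡 n) p (γ s)))
      (S.chartField p (ξ t, extChartAt (𝓡 n) p (γ t))) t := by
  refine (h t ht).2.prodMk ((hasDerivAt_extChartAt_comp p (h t ht).1 hs).congr_deriv ?_)
  rw [frameInChart_apply, (extChartAt (𝓡 n) p).left_inv hs]

lemma isReducedExtremalOn_of_hasDerivAt_chart (p : G)
    {z : ℝ → Covector n × EuclideanSpace ℝ (Fin n)} {J : Set ℝ}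
    (hz : ∀ t ∈ J, HasDerivAt z (S.chartField p (z t)) t)
    (hs : ∀ t ∈ J, (z t).2 ∈ (extChartAt (𝓡 n) p).target) :
    S.IsReducedExtremalOn (fun t => (extChartAt (𝓡 n) p).symm (z t).2) (fun t => (z t).1) J := by
  intro t ht
  refine ⟨hasMFDerivAt_extChartAt_symm_comp p (hs t ht) ?_, ?_⟩
  · have h1 := (ContinuousLinearMap.snd ℝ (Covector n)
      (EuclideanSpace ℝ (Fin n))).hasFDerivAt.comp_hasDerivAt t (hz t ht)
    refine h1.congr_deriv ?_
    exact S.frameInChart_apply p (z t).2 (S.momentum (z t).1)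
  · exact (ContinuousLinearMap.fst ℝ (Covector n)
      (EuclideanSpace ℝ (Fin n))).hasFDerivAt.comp_hasDerivAt t (hz t ht)

/-! ### Uniqueness -/

lemma IsReducedExtremalOn.continuousAt {γ : ℝ → G} {ξ : ℝ → Covector n} {J : Set ℝ}
    (h : S.IsReducedExtremalOn γ ξ J) {t : ℝ} (ht : t ∈ J) : ContinuousAt γ t :=
  (h t ht).1.continuousAt

/-- In the chart at the common point both curves solve the same ordinary differential equation with
a locally Lipschitz field. -/
lemma IsReducedExtremalOn.eventuallyEq {γ₁ γ₂ : ℝ → G} {ξ₁ ξ₂ : ℝ → Covector n} {J : Set ℝ}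
    (h₁ : S.IsReducedExtremalOn γ₁ ξ₁ J) (h₂ : S.IsReducedExtremalOn γ₂ ξ₂ J) {t : ℝ}
    (hJ : J ∈ 𝓝 t) (hγ : γ₁ t = γ₂ t) (hξ : ξ₁ t = ξ₂ t) :
    ∀ᶠ s in 𝓝 t, γ₁ s = γ₂ s ∧ ξ₁ s = ξ₂ s := by
  have ht := mem_of_mem_nhds hJ
  set p := γ₁ t with hp
  have hsource := extChartAt_source_mem_nhds (I := 𝓡 n) p
  obtain ⟨K, U, hU, hK⟩ := (S.contDiffAt_chartField p (z := (ξ₁ t, extChartAt (𝓡 n) p p))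
    (mem_extChartAt_target p)).exists_lipschitzOnWith
  have key : ∀ {γ : ℝ → G} {ξ : ℝ → Covector n}, S.IsReducedExtremalOn γ ξ J → γ t = p →
      ξ t = ξ₁ t → ∀ᶠ s in 𝓝 t, (HasDerivAt (fun s => (ξ s, extChartAt (𝓡 n) p (γ s)))
        (S.chartField p (ξ s, extChartAt (𝓡 n) p (γ s))) s ∧
          (ξ s, extChartAt (𝓡 n) p (γ s)) ∈ U) ∧ γ s ∈ (extChartAt (𝓡 n) p).source := by
    intro γ ξ h hγ hξ
    have hs : ∀ᶠ s in 𝓝 t, γ s ∈ (extChartAt (𝓡 n) p).source :=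
      (h.continuousAt ht).eventually_mem (hγ ▸ hsource)
    have hd := h.hasDerivAt_chart ht p (by rw [hγ]; exact mem_extChartAt_source p)
    have hUs := hd.continuousAt.eventually_mem (show U ∈ 𝓝 (ξ t, extChartAt (𝓡 n) p (γ t)) by
      rw [hγ, hξ]; exact hU)
    filter_upwards [hs, hUs, hJ] with s h3 h4 h5
    exact ⟨⟨h.hasDerivAt_chart h5 p h3, h4⟩, h3⟩
  have k1 := key h₁ rfl rfl
  have k2 := key h₂ hγ.symm hξ.symm
  have heq := ODE_solution_unique_of_eventually (v := fun _ => S.chartField p) (s := fun _ => U)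
    (Filter.Eventually.of_forall fun _ => hK) (k1.mono fun _ h => h.1) (k2.mono fun _ h => h.1)
    (by rw [← hγ, hξ])
  filter_upwards [heq, k1, k2] with s h3 h4 h5
  obtain ⟨h6, h7⟩ := Prod.mk.injEq .. ▸ h3
  exact ⟨(extChartAt (𝓡 n) p).injOn h4.2 h5.2 h7, h6⟩

/-- The set of coincidence is open by local uniqueness, relatively closed since `G` is Hausdorff,
and the interval is connected. -/
lemma IsReducedExtremalOn.eqOn [T2Space G] {γ₁ γ₂ : ℝ → G} {ξ₁ ξ₂ : ℝ → Covector n} {a b : ℝ}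
    (h₁ : S.IsReducedExtremalOn γ₁ ξ₁ (Set.Ioo a b))
    (h₂ : S.IsReducedExtremalOn γ₂ ξ₂ (Set.Ioo a b)) {t₀ : ℝ} (ht₀ : t₀ ∈ Set.Ioo a b)
    (hγ : γ₁ t₀ = γ₂ t₀) (hξ : ξ₁ t₀ = ξ₂ t₀) : Set.EqOn γ₁ γ₂ (Set.Ioo a b) := by
  set s : Set ℝ := {t | t ∈ Set.Ioo a b ∧ γ₁ t = γ₂ t ∧ ξ₁ t = ξ₂ t} with hs
  suffices hsub : Set.Ioo a b ⊆ s from fun t ht => (hsub ht).2.1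
  refine isPreconnected_Ioo.subset_of_closure_inter_subset ?_ ⟨t₀, ht₀, ht₀, hγ, hξ⟩ ?_
  · rw [isOpen_iff_mem_nhds]
    rintro t ⟨ht, h3, h4⟩
    have hJ := Ioo_mem_nhds ht.1 ht.2
    filter_upwards [h₁.eventuallyEq h₂ hJ h3 h4, hJ] with u hu hu'
    exact ⟨hu', hu⟩
  · rintro t ⟨htc, ht⟩
    rw [mem_closure_iff_frequently] at htc
    refine ⟨ht, ?_, ?_⟩
    · by_contra hne
      have h5 := ((h₁.continuousAt ht).prodMk (h₂.continuousAt ht)).eventually_mem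
        (isClosed_diagonal.isOpen_compl.mem_nhds (show (γ₁ t, γ₂ t) ∈ (Set.diagonal G)ᶜ from hne))
      exact htc (h5.mono fun u hu hu' => hu hu'.2.1)
    · by_contra hne
      have h5 := ((h₁ t ht).2.continuousAt.prodMk (h₂ t ht).2.continuousAt).eventually_mem
        (isClosed_diagonal.isOpen_compl.mem_nhds
          (show (ξ₁ t, ξ₂ t) ∈ (Set.diagonal (Covector n))ᶜ from hne))
      exact htc (h5.mono fun u hu hu' => hu hu'.2.2)

lemma IsReducedExtremalOn.mono {γ : ℝ → G} {ξ : ℝ → Covector n} {J J' : Set ℝ}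
    (h : S.IsReducedExtremalOn γ ξ J) (hJ : J' ⊆ J) : S.IsReducedExtremalOn γ ξ J' :=
  fun t ht => h t (hJ ht)

/-- `normalExp` chooses some end point; uniqueness on the intersection of the two time intervals
shows that every choice agrees with `γ`. -/
lemma normalExp_eq [T2Space G] {q : G} {l : Covector n} {γ : ℝ → G} {ξ : ℝ → Covector n} {T : ℝ}
    (h : S.IsReducedExtremalOn γ ξ (Set.Ioo (-T) T)) (hγ : γ 0 = q)
    (hξ : ξ 0 = trivializeCovector q l) {t : ℝ} (ht : t ∈ Set.Ico 0 T) :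
    S.normalExp q t l = γ t := by
  have hex : ∃ p, S.ReachedByNormalGeodesic q l t p := by
    refine ⟨γ t, γ, fun s => untrivializeCovector (γ s) (ξ s), T - t, sub_pos.2 ht.2, ?_, hγ, ?_,
      rfl⟩
    · refine (h.mono ?_).isNormalExtremalOn
      intro s hs
      exact ⟨by linarith [hs.1, ht.1], by linarith [hs.2]⟩
    · simp only [hξ, hγ, untrivialize_trivializeCovector]
  rw [normalExp, dif_pos hex]
  obtain ⟨γ', Λ, δ, hδ, hext, h0, hΛ, hp⟩ := hex.choose_spec
  rw [← hp]
  have h2 := hext.isReducedExtremalOn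
  have hT : t < min T (t + δ) := lt_min ht.2 (by linarith)
  have hδT : max (-δ) (-T) < 0 := max_lt (by linarith) (by linarith [ht.1, ht.2])
  have h3 : S.IsReducedExtremalOn γ' (fun t => trivializeCovector (γ' t) (Λ t))
      (Set.Ioo (max (-δ) (-T)) (min T (t + δ))) := h2.mono
    (Set.Ioo_subset_Ioo (le_max_left _ _) (min_le_right _ _))
  have h4 : S.IsReducedExtremalOn γ ξ (Set.Ioo (max (-δ) (-T)) (min T (t + δ))) := h.mono
    (Set.Ioo_subset_Ioo (le_max_right _ _) (min_le_left _ _))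
  exact h3.eqOn h4 ⟨hδT, ht.1.trans_lt hT⟩ (h0.trans hγ.symm) (by simp only [h0, hΛ, hξ])
    ⟨hδT.trans_le ht.1, hT⟩

/-! ### The exponential map for small times -/

variable (S) in
/-- The unit covectors at `q`. -/
def unitCovectors (q : G) : Set (Covector n) := {l | ‖S.momentum (trivializeCovector q l)‖ = 1}

lemma continuous_trivializeCovector (q : G) :
    Continuous (trivializeCovector q : Covector n → Covector n) :=
  ((ContinuousLinearMap.compL ℝ (EuclideanSpace ℝ (Fin n)) (EuclideanSpace ℝ (Fin n)) ℝ).flip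
    (leftDiff q : EuclideanSpace ℝ (Fin n) →L[ℝ] EuclideanSpace ℝ (Fin n))).continuous

variable (S) in
/-- The normal geodesics issued from `q` with unit speed exist up to a common time, in a common
compact set, and depend continuously on the initial covector. -/
theorem exists_normalExp [T2Space G] (q : G) : ∃ T > 0, ∃ K : Set G, IsCompact K ∧
    (∀ l ∈ S.unitCovectors q, ∃ (γ : ℝ → G) (ξ : ℝ → Covector n),
      S.IsReducedExtremalOn γ ξ (Set.Ioo (-T) T) ∧ γ 0 = q ∧ ξ 0 = trivializeCovector q l ∧
      ∀ t ∈ Set.Ico 0 T, S.normalExp q t l = γ t ∧ γ t ∈ K ∧ ‖S.momentum (ξ t)‖ = 1 ∧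
        ‖ξ t‖ ≤ 2 * (‖trivializeCovector q l‖ + 1)) ∧
    ∀ t ∈ Set.Ico 0 T, ContinuousOn (S.normalExp q t) (S.unitCovectors q) := by
  obtain ⟨T, hT, ρ, hρ, hρU, hflow⟩ := exists_uniform_momentum_flow S.momentum S.coadjoint
    S.inner_momentum_coadjoint (isOpen_extChartAt_target (I := 𝓡 n) q) (mem_extChartAt_target q)
    (S.contDiffOn_frameInChart q)
  have hsymm := (continuousOn_extChartAt_symm (I := 𝓡 n) q).mono hρU
  have hcurve : ∀ l₀ : Covector n, ∃ r > 0, ∃ α : Covector n → ℝ → Covector n × EuclideanSpace ℝ (Fin n),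
      (∀ l ∈ S.unitCovectors q, trivializeCovector q l ∈
        Metric.closedBall (trivializeCovector q l₀) r →
        (S.IsReducedExtremalOn (fun t => (extChartAt (𝓡 n) q).symm (α (trivializeCovector q l) t).2)
          (fun t => (α (trivializeCovector q l) t).1) (Set.Ioo (-T) T)) ∧
        (extChartAt (𝓡 n) q).symm (α (trivializeCovector q l) 0).2 = q ∧
        (α (trivializeCovector q l) 0).1 = trivializeCovector q l ∧
        ∀ t ∈ Set.Ioo (-T) T, ‖S.momentum (α (trivializeCovector q l) t).1‖ = 1 ∧
          (α (trivializeCovector q l) t).2 ∈ Metric.closedBall (extChartAt (𝓡 n) q q) ρ ∧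
          ‖(α (trivializeCovector q l) t).1‖ ≤ 2 * (‖trivializeCovector q l₀‖ + 1)) ∧
      ∀ t ∈ Set.Ioo (-T) T, ContinuousOn (α · t)
        (Metric.closedBall (trivializeCovector q l₀) r) := by
    intro l₀
    obtain ⟨r, hr, α, h1, h2⟩ := hflow (trivializeCovector q l₀)
    refine ⟨r, hr, α, fun l hl hlr => ?_, h2⟩
    obtain ⟨h3, h4⟩ := h1 _ hlr hl
    refine ⟨isReducedExtremalOn_of_hasDerivAt_chart q (fun t ht => (h4 t ht).1)
      (fun t ht => hρU (h4 t ht).2.2.1), ?_, ?_, fun t ht => (h4 t ht).2⟩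
    · rw [h3]; exact extChartAt_to_inv q
    · rw [h3]
  refine ⟨T, hT, (extChartAt (𝓡 n) q).symm '' Metric.closedBall (extChartAt (𝓡 n) q q) ρ,
    (isCompact_closedBall _ _).image_of_continuousOn hsymm, fun l hl => ?_, fun t ht => ?_⟩
  · obtain ⟨r, hr, α, h1, -⟩ := hcurve l
    obtain ⟨h2, h3, h4, h5⟩ := h1 l hl (Metric.mem_closedBall_self hr.le)
    refine ⟨_, _, h2, h3, h4, fun t ht => ?_⟩
    obtain ⟨h6, h7, h8⟩ := h5 t ⟨by linarith [ht.1], ht.2⟩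
    exact ⟨normalExp_eq h2 h3 h4 ht, ⟨_, h7, rfl⟩, h6, h8⟩
  · intro l₀ hl₀
    obtain ⟨r, hr, α, h1, h2⟩ := hcurve l₀
    have ht' : t ∈ Set.Ioo (-T) T := ⟨by linarith [ht.1], ht.2⟩
    -- Near `l₀` one local flow `α` computes `normalExp`, so its continuity carries over.
    have hev : ∀ᶠ l in 𝓝 l₀, trivializeCovector q l ∈
        Metric.closedBall (trivializeCovector q l₀) r :=
      (continuous_trivializeCovector q).continuousAt.eventually_mem (Metric.closedBall_mem_nhds _ hr)
    have hα : ContinuousAt (fun l => (α (trivializeCovector q l) t).2) l₀ :=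
      continuous_snd.continuousAt.comp (((h2 t ht').continuousAt
        (Metric.closedBall_mem_nhds _ hr)).comp (continuous_trivializeCovector q).continuousAt)
    have hmem := (h1 l₀ hl₀ (Metric.mem_closedBall_self hr.le)).2.2.2 t ht'
    have hc : ContinuousAt (fun l => (extChartAt (𝓡 n) q).symm (α (trivializeCovector q l) t).2) l₀ :=
      ContinuousAt.comp (f := fun l => (α (trivializeCovector q l) t).2)
        (continuousAt_extChartAt_symm'' (hρU hmem.2.1)) hα
    refine hc.continuousWithinAt.congr_of_eventuallyEq ?_ ?_
    · filter_upwards [self_mem_nhdsWithin, mem_nhdsWithin_of_mem_nhds hev] with l hl hlr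
      obtain ⟨h3, h4, h5, -⟩ := h1 l hl hlr
      exact normalExp_eq h3 h4 h5 ht
    · obtain ⟨h3, h4, h5, -⟩ := h1 l₀ hl₀ (Metric.mem_closedBall_self hr.le)
      exact normalExp_eq h3 h4 h5 ht

end CarnotStructure
end CarnotGroup

namespace CarnotGroup

variable {n : ℕ} {G : Type*} [TopologicalSpace G] [ChartedSpace (EuclideanSpace ℝ (Fin n)) G]
  [Group G] [LieGroup (𝓡 n) ∞ G]

namespace CarnotStructure

variable {S : CarnotStructure n G}

/-! ### Covectors of the cylinder -/

lemma rank_pos : 0 < S.rank := by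
  obtain ⟨x, hx, hx0⟩ := Submodule.exists_mem_ne_zero_of_ne_bot
    (S.layer_ne_bot 1 le_rfl S.one_le_step)
  refine Nat.pos_of_ne_zero fun h => hx0 ?_
  have : IsEmpty (Fin S.rank) := by rw [h]; infer_instance
  have h2 : (⟨x, hx⟩ : S.layer 1) = 0 := by
    rw [← S.frame.sum_repr ⟨x, hx⟩, Finset.univ_eq_empty, Finset.sum_empty]
  exact congrArg Subtype.val h2

namespace LeftInvariantComplement

variable (V : S.LeftInvariantComplement)

lemma horizontalCovector_of_mem_fiber (q : G) (s : EuclideanSpace ℝ (Fin S.rank))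
    {v : TangentSpace (𝓡 n) q} (hv : v ∈ V.fiber q) : V.horizontalCovector q s v = 0 := by
  have h : (S.horizontal q).projectionOnto (V.fiber q) (V.isCompl q) v = 0 :=
    (Submodule.projectionOnto_apply_eq_zero_iff (V.isCompl q)).2 hv
  refine (congrArg ((S.frameAt q).constr ℝ (fun i => s i)) h).trans (map_zero _)

lemma horizontalCovector_XField (q : G) (s : EuclideanSpace ℝ (Fin S.rank)) (i : Fin S.rank) :
    V.horizontalCovector q s (S.XField i q) = s i := by
  have h : (S.horizontal q).projectionOnto (V.fiber q) (V.isCompl q) (S.XField i q) =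
      S.frameAt q i :=
    Submodule.projectionOnto_apply_left (V.isCompl q) (S.frameAt q i)
  refine (congrArg ((S.frameAt q).constr ℝ (fun i => s i)) h).trans ?_
  exact (S.frameAt q).constr_basis ℝ _ i

/-- The horizontal covector is linear in its coordinates. -/
def horizontalCovectorL (q : G) : EuclideanSpace ℝ (Fin S.rank) →ₗ[ℝ] Covector n where
  toFun := V.horizontalCovector q
  map_add' a b := by
    have h : (S.frameAt q).constr ℝ (fun i => (a + b) i) =
        (S.frameAt q).constr ℝ (fun i => a i) + (S.frameAt q).constr ℝ (fun i => b i) :=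
      map_add ((S.frameAt q).constr ℝ) (fun i => a i) (fun i => b i)
    ext1 v
    exact congrArg (fun c : S.horizontal q →ₗ[ℝ] ℝ =>
      c ((S.horizontal q).projectionOnto (V.fiber q) (V.isCompl q) v)) h
  map_smul' c a := by
    have h : (S.frameAt q).constr ℝ (fun i => (c • a) i) =
        c • (S.frameAt q).constr ℝ (fun i => a i) :=
      map_smul ((S.frameAt q).constr ℝ) c (fun i => a i)
    ext1 v
    exact congrArg (fun c : S.horizontal q →ₗ[ℝ] ℝ =>
      c ((S.horizontal q).projectionOnto (V.fiber q) (V.isCompl q) v)) h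

lemma continuous_horizontalCovector (q : G) : Continuous (V.horizontalCovector q) :=
  (V.horizontalCovectorL q).continuous_of_finiteDimensional

lemma continuous_covector (q : G) : Continuous (V.covector q) :=
  ((V.continuous_horizontalCovector q).comp (continuous_subtype_val.comp continuous_fst)).add
    (continuous_subtype_val.comp continuous_snd)

lemma covector_XField (q : G) (x : S.Cylinder q) (i : Fin S.rank) :
    V.covector q x (S.XField i q) = (x.1 : EuclideanSpace ℝ (Fin S.rank)) i := by
  have h : (x.2 : Covector n) (S.XField i q) = 0 := x.2.2 _ ⟨_, (S.frame i).2, rfl⟩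
  exact (congrArg₂ (· + ·) (V.horizontalCovector_XField q x.1 i) h).trans (add_zero _)

lemma momentum_covector (q : G) (x : S.Cylinder q) :
    S.momentum (trivializeCovector q (V.covector q x)) = x.1 := by
  ext i
  exact V.covector_XField q x i

lemma covector_mem_unitCovectors (q : G) (x : S.Cylinder q) :
    V.covector q x ∈ S.unitCovectors q := by
  change ‖S.momentum _‖ = 1
  rw [momentum_covector]
  exact norm_eq_of_mem_sphere x.1

end LeftInvariantComplement

lemma _root_.CarnotGroup.Covector.map_add (ξ : Covector n) (v w : GroupLieAlgebra (𝓡 n) G) :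
    ξ (v + w : GroupLieAlgebra (𝓡 n) G) = ξ v + ξ w :=
  ContinuousLinearMap.map_add ξ (v : EuclideanSpace ℝ (Fin n)) w

/-- The covector kills `v + ℓ v`, so its value at `v` is minus its value at the horizontal vector `ℓ
v`. This is how `ℓ` enters the microscopic Laplacian. -/
lemma horizontalCovector_graphComplement (l : S.V₀ →ₗ[ℝ] S.layer 1) (q : G)
    (s : EuclideanSpace ℝ (Fin S.rank)) (v : S.V₀) :
    (S.graphComplement l).horizontalCovector q s (leftDiff q (v : GroupLieAlgebra (𝓡 n) G)) =
      -∑ i, s i * S.frame.repr (l v) i := by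
  let H : Covector n := trivializeCovector q ((S.graphComplement l).horizontalCovector q s)
  have h1 : H ((v : GroupLieAlgebra (𝓡 n) G) + (l v : GroupLieAlgebra (𝓡 n) G)) = 0 :=
    (S.graphComplement l).horizontalCovector_of_mem_fiber q s
      ⟨_, (S.add_mem_graph_iff l (l v).2 v).2 rfl, rfl⟩
  have h2 : H (l v : GroupLieAlgebra (𝓡 n) G) = ∑ i, s i * S.frame.repr (l v) i := by
    have h3 : (l v : GroupLieAlgebra (𝓡 n) G) = ∑ i, S.frame.repr (l v) i • S.X i := by
      conv_lhs => rw [← S.frame.sum_repr (l v)]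
      rw [AddSubmonoidClass.coe_finsetSum]
      rfl
    refine (congrArg H h3).trans ((Covector.map_sum_smul _ _ _ _).trans ?_)
    refine Finset.sum_congr rfl fun i _ => ?_
    rw [mul_comm]
    exact congrArg (· * _) ((S.graphComplement l).horizontalCovector_XField q s i)
  have h4 : H ((v : GroupLieAlgebra (𝓡 n) G) + (l v : GroupLieAlgebra (𝓡 n) G)) =
      H (v : GroupLieAlgebra (𝓡 n) G) + H (l v : GroupLieAlgebra (𝓡 n) G) :=
    Covector.map_add H _ _
  change H (v : GroupLieAlgebra (𝓡 n) G) = _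
  rw [← h2]
  linarith

end CarnotStructure

/-! ### Taylor expansion of order two -/

/-- Two applications of the mean value inequality; the constant `M` in place of `M / 2` is enough
for domination. -/
lemma abs_sub_sub_le_of_second_derivative_le {F F' F'' : ℝ → ℝ} {T M : ℝ}
    (h1 : ∀ t ∈ Set.Ioo (-T) T, HasDerivAt F (F' t) t)
    (h2 : ∀ t ∈ Set.Ioo (-T) T, HasDerivAt F' (F'' t) t)
    (hM : ∀ t ∈ Set.Ico 0 T, |F'' t| ≤ M) {t : ℝ} (ht : t ∈ Set.Ico 0 T) :
    |F t - F 0 - t * F' 0| ≤ M * t ^ 2 := by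
  have hsub : ∀ s ∈ Set.Icc 0 t, s ∈ Set.Ioo (-T) T ∧ s ∈ Set.Ico 0 T := fun s hs =>
    ⟨⟨by linarith [hs.1, hs.2, ht.2], hs.2.trans_lt ht.2⟩, hs.1, hs.2.trans_lt ht.2⟩
  have hM0 : 0 ≤ M := (abs_nonneg _).trans (hM t ht)
  have h3 : ∀ s ∈ Set.Icc 0 t, ‖F' s - F' 0‖ ≤ M * t := by
    intro s hs
    have := Convex.norm_image_sub_le_of_norm_hasDerivWithin_le (f := F') (f' := F'')
      (fun r hr => (h2 r (hsub r hr).1).hasDerivWithinAt) (fun r hr => hM r (hsub r hr).2)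
      (convex_Icc 0 t) (Set.left_mem_Icc.2 ht.1) hs
    refine this.trans ?_
    rw [Real.norm_eq_abs, sub_zero, abs_of_nonneg hs.1]
    exact mul_le_mul_of_nonneg_left hs.2 hM0
  have h4 := Convex.norm_image_sub_le_of_norm_hasDerivWithin_le (f := fun s => F s - s * F' 0)
    (f' := fun s => F' s - 1 * F' 0) (C := M * t)
    (fun r hr => (((h1 r (hsub r hr).1).sub ((hasDerivAt_id r).mul_const (F' 0)))).hasDerivWithinAt)
    (fun r hr => by simpa only [one_mul] using h3 r hr)
    (convex_Icc 0 t) (Set.left_mem_Icc.2 ht.1) (Set.right_mem_Icc.2 ht.1)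
  rw [Real.norm_eq_abs, Real.norm_eq_abs, sub_zero, abs_of_nonneg ht.1] at h4
  calc |F t - F 0 - t * F' 0| = |F t - t * F' 0 - (F 0 - 0 * F' 0)| := by congr 1; ring
    _ ≤ M * t * t := h4
    _ = M * t ^ 2 := by ring

/-- One application of l'Hôpital's rule leaves the difference quotient of `F'` at `0`, so continuity
of the second derivative is not needed. -/
lemma tendsto_second_difference_quotient {F F' : ℝ → ℝ} {T a : ℝ} (hT : 0 < T)
    (h1 : ∀ t ∈ Set.Ioo (-T) T, HasDerivAt F (F' t) t) (h2 : HasDerivAt F' a 0) :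
    Filter.Tendsto (fun t => (F t - F 0 - t * F' 0) / t ^ 2) (𝓝[>] 0) (𝓝 (a / 2)) := by
  have hI : ∀ᶠ t : ℝ in 𝓝[>] 0, t ∈ Set.Ioo 0 T := Ioo_mem_nhdsGT hT
  have h0 : (0 : ℝ) ∈ Set.Ioo (-T) T := ⟨by linarith, hT⟩
  have hc : ContinuousAt (fun t => F t - F 0 - t * F' 0) 0 :=
    ((h1 0 h0).continuousAt.sub continuousAt_const).sub (continuousAt_id.mul continuousAt_const)
  have hc2 : ContinuousAt (fun t : ℝ => t ^ 2) 0 := by fun_prop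
  refine HasDerivAt.lhopital_zero_nhdsGT (f' := fun t => F' t - F' 0) (g' := fun t => 2 * t)
    ?_ ?_ ?_ ?_ ?_ ?_
  · filter_upwards [hI] with t ht
    have := ((h1 t ⟨by linarith [ht.1], ht.2⟩).sub_const (F 0)).sub
      ((hasDerivAt_id t).mul_const (F' 0))
    rw [one_mul] at this
    exact this
  · filter_upwards with t
    simpa using hasDerivAt_pow 2 t
  · filter_upwards [hI] with t ht
    exact (mul_pos two_pos ht.1).ne'
  · simpa using hc.tendsto.mono_left nhdsWithin_le_nhds
  · simpa using hc2.tendsto.mono_left nhdsWithin_le_nhds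
  · have h3 := (hasDerivAt_iff_tendsto_slope.1 h2).mono_left
      (nhdsWithin_mono 0 (fun t (ht : 0 < t) => ht.ne' : Set.Ioi (0 : ℝ) ⊆ {0}ᶜ))
    refine (h3.div_const 2).congr fun t => ?_
    rw [slope_def_field, sub_zero, div_div, mul_comm t]

namespace CarnotStructure

variable (S : CarnotStructure n G)

/-! ### Expansion along normal geodesics -/

/-- The second derivative of `f` along a normal extremal, as a function of the point and of the
left-trivialized covector. -/
def secondVariation (f : G → ℝ) (p : G) (ξ : Covector n) : ℝ :=
  ∑ i, S.coadjoint (S.momentum ξ) ξ (S.X i) * derivAlong (S.XField i) f p +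
    ∑ i, S.momentum ξ i *
      ∑ j, S.momentum ξ j * derivAlong (S.XField j) (derivAlong (S.XField i) f) p

variable {S}

lemma IsReducedExtremalOn.hasDerivAt_deriv {γ : ℝ → G} {ξ : ℝ → Covector n} {J : Set ℝ}
    (h : S.IsReducedExtremalOn γ ξ J) {f : G → ℝ} (hf : ContMDiff (𝓡 n) 𝓘(ℝ, ℝ) ∞ f)
    {t : ℝ} (ht : t ∈ J) :
    HasDerivAt (fun s => ∑ i, S.momentum (ξ s) i * derivAlong (S.XField i) f (γ s))
      (S.secondVariation f (γ t) (ξ t)) t := by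
  have h4 : ∀ v : EuclideanSpace ℝ (Fin n), HasDerivAt (fun s => ξ s v)
      (S.coadjoint (S.momentum (ξ t)) (ξ t) v) t := fun v =>
    (ContinuousLinearMap.apply ℝ ℝ v).hasFDerivAt.comp_hasDerivAt t (h t ht).2
  have h5 := HasDerivAt.fun_sum (u := Finset.univ) fun i _ => (h4 (S.X i)).mul
    (h.hasDerivAt_comp (contMDiff_derivAlong (S.smoothField_XField i) hf) ht)
  refine h5.congr_deriv ?_
  rw [Finset.sum_add_distrib]
  rfl

lemma _root_.ContinuousLinearMap.exists_bound_apply_apply {E F F' : Type*} [NormedAddCommGroup E]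
    [NormedSpace ℝ E] [NormedAddCommGroup F] [NormedSpace ℝ F] [NormedAddCommGroup F']
    [NormedSpace ℝ F'] (A : E →L[ℝ] F →L[ℝ] F') :
    ∃ B, 0 ≤ B ∧ ∀ a ξ, ‖A a ξ‖ ≤ B * ‖a‖ * ‖ξ‖ :=
  ⟨‖A‖, A.opNorm_nonneg, A.le_opNorm₂⟩

variable (S) in
lemma exists_coadjoint_bound : ∃ B, 0 ≤ B ∧
    ∀ a ξ i, |S.coadjoint a ξ (S.X i)| ≤ B * (‖a‖ * ‖ξ‖) := by
  let x : Fin S.rank → EuclideanSpace ℝ (Fin n) := S.X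
  obtain ⟨B, hB0, hB⟩ := S.coadjoint.exists_bound_apply_apply
  refine ⟨B * ∑ i, ‖x i‖, by positivity, fun a ξ i => ?_⟩
  have h1 : |S.coadjoint a ξ (x i)| ≤ ‖S.coadjoint a ξ‖ * ‖x i‖ :=
    (S.coadjoint a ξ).le_opNorm (x i)
  have h2 := hB a ξ
  have h3 : ‖x i‖ ≤ ∑ i, ‖x i‖ :=
    Finset.single_le_sum (f := fun i => ‖x i‖) (fun j _ => norm_nonneg _) (Finset.mem_univ i)
  refine h1.trans ((mul_le_mul h2 h3 (norm_nonneg _) (by positivity)).trans (le_of_eq ?_))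
  ring

/-- At unit momentum the coadjoint term is linear in `ξ` and the other term is bounded. Growth of
order one in `‖ξ‖` is integrable against adapted measures. -/
lemma abs_secondVariation_le {B : ℝ} (hB0 : 0 ≤ B)
    (hB : ∀ a ξ i, |S.coadjoint a ξ (S.X i)| ≤ B * (‖a‖ * ‖ξ‖)) (f : G → ℝ) (p : G)
    {ξ : Covector n} (hξ : ‖S.momentum ξ‖ = 1) :
    |S.secondVariation f p ξ| ≤
      (∑ i, B * |derivAlong (S.XField i) f p| +
        ∑ i, ∑ j, |derivAlong (S.XField j) (derivAlong (S.XField i) f) p|) * (1 + ‖ξ‖) := by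
  have hu : ∀ i, |S.momentum ξ i| ≤ 1 := fun i => by
    rw [← hξ]; exact PiLp.norm_apply_le (S.momentum ξ) i
  have h1 := fun i => hB (S.momentum ξ) ξ i
  simp only [hξ, one_mul] at h1
  have h6 : |∑ i, S.coadjoint (S.momentum ξ) ξ (S.X i) * derivAlong (S.XField i) f p| ≤
      (∑ i, B *
        |derivAlong (S.XField i) f p|) * ‖ξ‖ := by
    rw [Finset.sum_mul]
    refine (Finset.abs_sum_le_sum_abs _ _).trans (Finset.sum_le_sum fun i _ => ?_)
    rw [abs_mul]
    refine (mul_le_mul_of_nonneg_right (h1 i) (abs_nonneg _)).trans (le_of_eq ?_)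
    ring
  have h7 : |∑ i, S.momentum ξ i * ∑ j, S.momentum ξ j *
      derivAlong (S.XField j) (derivAlong (S.XField i) f) p| ≤
      ∑ i, ∑ j, |derivAlong (S.XField j) (derivAlong (S.XField i) f) p| := by
    refine (Finset.abs_sum_le_sum_abs _ _).trans (Finset.sum_le_sum fun i _ => ?_)
    rw [abs_mul]
    refine (mul_le_of_le_one_left (abs_nonneg _) (hu i)).trans ?_
    refine (Finset.abs_sum_le_sum_abs _ _).trans (Finset.sum_le_sum fun j _ => ?_)
    rw [abs_mul]
    exact mul_le_of_le_one_left (abs_nonneg _) (hu j)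
  refine (abs_add_le _ _).trans ((add_le_add h6 h7).trans ?_)
  have h8 : 0 ≤ ∑ i, B *
      |derivAlong (S.XField i) f p| := Finset.sum_nonneg fun i _ => by positivity
  have h9 : 0 ≤ ∑ i, ∑ j, |derivAlong (S.XField j) (derivAlong (S.XField i) f) p| :=
    Finset.sum_nonneg fun i _ => Finset.sum_nonneg fun j _ => abs_nonneg _
  nlinarith [mul_nonneg h9 (norm_nonneg ξ)]

variable (S) in
/-- Near `q` and for all unit covectors, the remainder of the expansion of order one of `f` along
normal geodesics is quadratic in time, with an explicit limit. -/
theorem exists_normalExp_expansion [T2Space G] {f : G → ℝ} (hf : ContMDiff (𝓡 n) 𝓘(ℝ, ℝ) ∞ f)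
    (q : G) : ∃ T > 0, ∃ C : ℝ,
    (∀ t ∈ Set.Ico 0 T, ContinuousOn (fun l => f (S.normalExp q t l)) (S.unitCovectors q)) ∧
    ∀ l ∈ S.unitCovectors q,
      (∀ t ∈ Set.Ico 0 T, |f (S.normalExp q t l) - f q - t * ∑ i,
        S.momentum (trivializeCovector q l) i * derivAlong (S.XField i) f q| ≤
          C * (3 + 2 * ‖trivializeCovector q l‖) * t ^ 2) ∧
      Filter.Tendsto (fun t => (f (S.normalExp q t l) - f q - t * ∑ i,
        S.momentum (trivializeCovector q l) i * derivAlong (S.XField i) f q) / t ^ 2) (𝓝[>] 0)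
        (𝓝 (S.secondVariation f q (trivializeCovector q l) / 2)) := by
  obtain ⟨T, hT, K, hK, hex, hcont⟩ := S.exists_normalExp q
  have hd1 : ∀ i, Continuous (derivAlong (S.XField i) f) := fun i =>
    (contMDiff_derivAlong (S.smoothField_XField i) hf).continuous
  have hd2 : ∀ i j, Continuous (derivAlong (S.XField j) (derivAlong (S.XField i) f)) := fun i j =>
    (contMDiff_derivAlong (S.smoothField_XField j)
      (contMDiff_derivAlong (S.smoothField_XField i) hf)).continuous
  obtain ⟨B, hB0, hB⟩ := S.exists_coadjoint_bound
  set b : G → ℝ := fun p =>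
    ∑ i, B * |derivAlong (S.XField i) f p| +
        ∑ i, ∑ j, |derivAlong (S.XField j) (derivAlong (S.XField i) f) p| with hb
  have hbc : Continuous b :=
    (continuous_finsetSum _ fun i _ => (hd1 i).abs.const_mul _).add
      (continuous_finsetSum _ fun i _ => continuous_finsetSum _ fun j _ => (hd2 i j).abs)
  obtain ⟨C, hC⟩ := hK.exists_bound_of_continuousOn hbc.continuousOn
  refine ⟨T, hT, C, fun t ht => hf.continuous.comp_continuousOn (hcont t ht), fun l hl => ?_⟩
  obtain ⟨γ, ξ, hred, h0, hξ0, hex⟩ := hex l hl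
  have h1 : ∀ t ∈ Set.Ioo (-T) T, _ := fun t ht => hred.hasDerivAt_comp hf ht
  have h2 : ∀ t ∈ Set.Ioo (-T) T, _ := fun t ht => hred.hasDerivAt_deriv hf ht
  -- The flow satisfies `‖ξ t‖ ≤ 2 * (‖ξ 0‖ + 1)`, hence `1 + ‖ξ t‖ ≤ 3 + 2 * ‖ξ 0‖`.
  have hM : ∀ t ∈ Set.Ico 0 T, |S.secondVariation f (γ t) (ξ t)| ≤
      C * (3 + 2 * ‖trivializeCovector q l‖) := by
    intro t ht
    obtain ⟨-, h3, h4, h5⟩ := hex t ht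
    refine (abs_secondVariation_le hB0 hB f (γ t) h4).trans ?_
    have h6 : b (γ t) ≤ C := (le_abs_self _).trans (hC _ h3)
    have hC0 : 0 ≤ C := (abs_nonneg _).trans (hC _ h3)
    exact (mul_le_mul_of_nonneg_right h6 (by positivity)).trans
      (mul_le_mul_of_nonneg_left (by linarith) hC0)
  have he : ∀ t ∈ Set.Ico 0 T, f (S.normalExp q t l) = f (γ t) := fun t ht => by rw [(hex t ht).1]
  constructor
  · intro t ht
    have := abs_sub_sub_le_of_second_derivative_le h1 h2 hM ht
    rw [he t ht]
    simpa only [h0, hξ0] using this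
  · have := tendsto_second_difference_quotient hT h1 (h2 0 ⟨by linarith, hT⟩)
    simp only [h0, hξ0] at this
    refine this.congr' ?_
    filter_upwards [Ioo_mem_nhdsGT hT] with t ht
    rw [he t ⟨ht.1.le, ht.2⟩]

end CarnotStructure
end CarnotGroup

namespace CarnotGroup

variable {n : ℕ} {G : Type*} [TopologicalSpace G] [ChartedSpace (EuclideanSpace ℝ (Fin n)) G]
  [Group G] [LieGroup (𝓡 n) ∞ G]

lemma Covector.norm_le_sum (η : Covector n) :
    ‖η‖ ≤ ∑ a, |η (EuclideanSpace.basisFun (Fin n) ℝ a)| := by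
  refine η.opNorm_le_bound (Finset.sum_nonneg fun a _ => abs_nonneg _) fun v => ?_
  conv_lhs => rw [← (EuclideanSpace.basisFun (Fin n) ℝ).sum_repr v]
  rw [map_sum, Finset.sum_mul]
  refine (norm_sum_le _ _).trans (Finset.sum_le_sum fun a _ => ?_)
  rw [map_smul, norm_smul, mul_comm]
  exact mul_le_mul_of_nonneg_left (PiLp.norm_apply_le v a) (norm_nonneg _)

namespace CarnotStructure

variable {S : CarnotStructure n G}

/-! ### Moments of the cylinder measure -/

section moments

variable {q : G} {μ : Measure (S.vertical q)} [IsProbabilityMeasure μ]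

instance : IsProbabilityMeasure (sphereMeasure S.rank) :=
  isProbabilityMeasure_sphereMeasure rank_pos

instance : IsProbabilityMeasure (cylinderMeasure q μ) := by
  rw [cylinderMeasure]; infer_instance

lemma integrable_cylinder_of_sphere {g : Metric.sphere (0 : EuclideanSpace ℝ (Fin S.rank)) 1 → ℝ}
    (hg : Continuous g) : Integrable (fun x : S.Cylinder q => g x.1) (cylinderMeasure q μ) :=
  (integrable_sphereMeasure g hg rank_pos).comp_fst μ

lemma integral_cylinder_of_sphere (g : Metric.sphere (0 : EuclideanSpace ℝ (Fin S.rank)) 1 → ℝ) :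
    ∫ x : S.Cylinder q, g x.1 ∂(cylinderMeasure q μ) = ∫ s, g s ∂(sphereMeasure S.rank) := by
  rw [cylinderMeasure, integral_fun_fst]
  simp

lemma integrable_vertical_apply (hμ : ∀ f : S.vertical q →ₗ[ℝ] ℝ, MemLp f 2 μ)
    (v : EuclideanSpace ℝ (Fin n)) :
    Integrable (fun x : S.vertical q => (x : Covector n) v) μ :=
  (hμ { toFun := fun x => (x : Covector n) v
        map_add' := fun _ _ => rfl
        map_smul' := fun _ _ => rfl }).integrable one_le_two

/-- The norm is at most a finite sum of absolute values on basis vectors: the horizontal parts are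
continuous on a compact sphere, the vertical ones square integrable. This provides the dominating
function. -/
lemma integrable_norm_covector (hμ : ∀ f : S.vertical q →ₗ[ℝ] ℝ, MemLp f 2 μ)
    (V : S.LeftInvariantComplement) :
    Integrable (fun x => ‖trivializeCovector q (V.covector q x)‖) (cylinderMeasure q μ) := by
  let w : Fin n → EuclideanSpace ℝ (Fin n) :=
    fun a => leftDiff (G := G) q (EuclideanSpace.basisFun (Fin n) ℝ a)
  have h1 : ∀ a, Integrable (fun x : S.Cylinder q =>
      |V.horizontalCovector q (x.1 : EuclideanSpace ℝ (Fin S.rank)) (w a)|)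
      (cylinderMeasure q μ) := fun a =>
    integrable_cylinder_of_sphere (S := S) (q := q) (μ := μ)
      (g := fun s => |V.horizontalCovector q (s : EuclideanSpace ℝ (Fin S.rank)) (w a)|)
      (((V.continuous_horizontalCovector q).comp continuous_subtype_val).clm_apply
        continuous_const).abs
  have h2 : ∀ a, Integrable (fun x : S.Cylinder q => |(x.2 : Covector n) (w a)|)
      (cylinderMeasure q μ) := fun a =>
    (integrable_vertical_apply hμ (w a)).abs.comp_snd (sphereMeasure S.rank)
  refine (integrable_finsetSum Finset.univ fun a _ => (h1 a).add (h2 a)).mono' ?_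
    (Filter.Eventually.of_forall fun x => ?_)
  · exact ((continuous_trivializeCovector q).comp
      (V.continuous_covector q)).norm.aestronglyMeasurable
  · rw [norm_norm]
    refine (Covector.norm_le_sum _).trans (Finset.sum_le_sum fun a _ => ?_)
    exact abs_add_le (V.horizontalCovector q (x.1 : EuclideanSpace ℝ (Fin S.rank)) (w a)) _

/-- The vertical part is independent of the coordinate, which has mean zero, so only the horizontal
part `-⟨s, ℓ v⟩` correlates with `s_j`. -/
lemma integrable_coord_mul_covector (hμ : ∀ f : S.vertical q →ₗ[ℝ] ℝ, MemLp f 2 μ)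
    (l : S.V₀ →ₗ[ℝ] S.layer 1) (j : Fin S.rank) (v : S.V₀) :
    Integrable (fun x : S.Cylinder q => (x.1 : EuclideanSpace ℝ (Fin S.rank)) j *
      (S.graphComplement l).covector q x (leftDiff q (v : GroupLieAlgebra (𝓡 n) G)))
      (cylinderMeasure q μ) ∧
    ∫ x : S.Cylinder q, (x.1 : EuclideanSpace ℝ (Fin S.rank)) j *
      (S.graphComplement l).covector q x (leftDiff q (v : GroupLieAlgebra (𝓡 n) G))
      ∂(cylinderMeasure q μ) = -(1 / (S.rank : ℝ) * S.frame.repr (l v) j) := by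
  let w : EuclideanSpace ℝ (Fin n) := leftDiff q (v : GroupLieAlgebra (𝓡 n) G)
  have hsum : ∀ x : S.Cylinder q, (x.1 : EuclideanSpace ℝ (Fin S.rank)) j *
      (S.graphComplement l).covector q x (leftDiff q (v : GroupLieAlgebra (𝓡 n) G)) =
      (∑ i, -S.frame.repr (l v) i * ((x.1 : EuclideanSpace ℝ (Fin S.rank)) j *
        (x.1 : EuclideanSpace ℝ (Fin S.rank)) i)) +
      (x.1 : EuclideanSpace ℝ (Fin S.rank)) j * (x.2 : Covector n) w := by
    intro x
    have h := horizontalCovector_graphComplement l q (x.1 : EuclideanSpace ℝ (Fin S.rank)) v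
    have h2 : (S.graphComplement l).covector q x (leftDiff q (v : GroupLieAlgebra (𝓡 n) G)) =
      (-∑ i, (x.1 : EuclideanSpace ℝ (Fin S.rank)) i * S.frame.repr (l v) i) +
        (x.2 : Covector n) w := congrArg (· + (x.2 : Covector n) w) h
    rw [h2, mul_add, ← Finset.sum_neg_distrib, Finset.mul_sum]
    congr 1
    exact Finset.sum_congr rfl fun i _ => by ring
  have hi1 : ∀ i, Integrable (fun x : S.Cylinder q => (x.1 : EuclideanSpace ℝ (Fin S.rank)) j *
        (x.1 : EuclideanSpace ℝ (Fin S.rank)) i) (cylinderMeasure q μ) := fun i =>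
    integrable_cylinder_of_sphere (S := S) (q := q) (μ := μ)
      (g := fun s => (s : EuclideanSpace ℝ (Fin S.rank)) j *
      (s : EuclideanSpace ℝ (Fin S.rank)) i)
      ((continuous_sphere_coord j).mul (continuous_sphere_coord i))
  have hi2 : Integrable (fun x : S.Cylinder q => ∑ i, -S.frame.repr (l v) i *
      ((x.1 : EuclideanSpace ℝ (Fin S.rank)) j *
        (x.1 : EuclideanSpace ℝ (Fin S.rank)) i)) (cylinderMeasure q μ) :=
    integrable_finsetSum _ fun i _ => (hi1 i).const_mul _
  have hi3 : Integrable (fun x : S.Cylinder q => (x.1 : EuclideanSpace ℝ (Fin S.rank)) j *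
      (x.2 : Covector n) w) (cylinderMeasure q μ) :=
    (integrable_sphereMeasure _ (continuous_sphere_coord j) rank_pos).mul_prod
      (integrable_vertical_apply hμ w)
  have he : ∫ x : S.Cylinder q, (x.1 : EuclideanSpace ℝ (Fin S.rank)) j *
      (x.2 : Covector n) w ∂(cylinderMeasure q μ) = 0 := by
    rw [cylinderMeasure, integral_prod_mul
      (fun s : Metric.sphere (0 : EuclideanSpace ℝ (Fin S.rank)) 1 =>
        (s : EuclideanSpace ℝ (Fin S.rank)) j) (fun y : S.vertical q => (y : Covector n) w),
      integral_sphere_coord, zero_mul]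
  refine ⟨(hi2.add hi3).congr (Filter.Eventually.of_forall fun x => (hsum x).symm), ?_⟩
  rw [integral_congr_ae (Filter.Eventually.of_forall hsum), integral_add hi2 hi3, he, add_zero,
    integral_finsetSum _ fun i _ => (hi1 i).const_mul _]
  have hc : ∀ i, ∫ x : S.Cylinder q, (x.1 : EuclideanSpace ℝ (Fin S.rank)) j *
        (x.1 : EuclideanSpace ℝ (Fin S.rank)) i ∂(cylinderMeasure q μ) =
      if j = i then 1 / (S.rank : ℝ) else 0 := fun i =>
    (integral_cylinder_of_sphere (S := S) (q := q) (μ := μ) (fun s => (s : EuclideanSpace ℝ (Fin S.rank)) j *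
      (s : EuclideanSpace ℝ (Fin S.rank)) i)).trans (integral_sphere_coord_mul j i)
  simp only [integral_const_mul, hc]
  simp [mul_comm]

/-- The second moments `δ_ij / k` turn the quadratic term into the sum of squares, and the
correlations of the coordinates with `ξ([X_j, X_i])` add up to the traces. -/
lemma integral_secondVariation (hμ : ∀ f : S.vertical q →ₗ[ℝ] ℝ, MemLp f 2 μ)
    (l : S.V₀ →ₗ[ℝ] S.layer 1) (f : G → ℝ) :
    S.rank * ∫ x : S.Cylinder q, S.secondVariation f q
      (trivializeCovector q ((S.graphComplement l).covector q x)) ∂(cylinderMeasure q μ) =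
    ∑ i, derivAlong (S.XField i) (derivAlong (S.XField i) f) q +
      ∑ i, LinearMap.trace ℝ (GroupLieAlgebra (𝓡 n) G) (S.compAd l i) *
        derivAlong (S.XField i) f q := by
  have hk : (S.rank : ℝ) ≠ 0 := Nat.cast_ne_zero.2 (rank_pos (S := S)).ne'
  have hsum : ∀ x : S.Cylinder q, S.secondVariation f q
      (trivializeCovector q ((S.graphComplement l).covector q x)) =
      (∑ i, ∑ j, derivAlong (S.XField i) f q * ((x.1 : EuclideanSpace ℝ (Fin S.rank)) j *
        (S.graphComplement l).covector q x
          (leftDiff q (S.adX j (S.X i) : GroupLieAlgebra (𝓡 n) G)))) +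
      ∑ i, ∑ j, derivAlong (S.XField j) (derivAlong (S.XField i) f) q *
        ((x.1 : EuclideanSpace ℝ (Fin S.rank)) i * (x.1 : EuclideanSpace ℝ (Fin S.rank)) j) := by
    intro x
    rw [secondVariation, LeftInvariantComplement.momentum_covector]
    refine congrArg₂ (· + ·) (Finset.sum_congr rfl fun i _ => ?_)
      (Finset.sum_congr rfl fun i _ => ?_)
    · rw [coadjoint_apply_eq_sum, Finset.sum_mul]
      refine Finset.sum_congr rfl fun j _ => ?_
      exact mul_comm _ _
    · rw [Finset.mul_sum]
      exact Finset.sum_congr rfl fun j _ => by ring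
  have hi1 : ∀ i j, Integrable (fun x : S.Cylinder q => derivAlong (S.XField i) f q *
      ((x.1 : EuclideanSpace ℝ (Fin S.rank)) j * (S.graphComplement l).covector q x
          (leftDiff q (S.adX j (S.X i) : GroupLieAlgebra (𝓡 n) G)))) (cylinderMeasure q μ) :=
    fun i j => (integrable_coord_mul_covector hμ l j (S.adX j (S.X i))).1.const_mul _
  have hi2 : ∀ i j, Integrable (fun x : S.Cylinder q =>
      derivAlong (S.XField j) (derivAlong (S.XField i) f) q *
        ((x.1 : EuclideanSpace ℝ (Fin S.rank)) i * (x.1 : EuclideanSpace ℝ (Fin S.rank)) j))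
      (cylinderMeasure q μ) := fun i j =>
    (integrable_cylinder_of_sphere (S := S) (q := q) (μ := μ)
      (g := fun s => (s : EuclideanSpace ℝ (Fin S.rank)) i *
      (s : EuclideanSpace ℝ (Fin S.rank)) j)
      ((continuous_sphere_coord i).mul (continuous_sphere_coord j))).const_mul _
  have hc : ∀ i j, ∫ x : S.Cylinder q, (x.1 : EuclideanSpace ℝ (Fin S.rank)) i *
        (x.1 : EuclideanSpace ℝ (Fin S.rank)) j ∂(cylinderMeasure q μ) =
      if i = j then 1 / (S.rank : ℝ) else 0 := fun i j =>
    (integral_cylinder_of_sphere (S := S) (q := q) (μ := μ) (fun s => (s : EuclideanSpace ℝ (Fin S.rank)) i *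
      (s : EuclideanSpace ℝ (Fin S.rank)) j)).trans (integral_sphere_coord_mul i j)
  -- This sign cancels the one in the horizontal covector, so the traces appear with a plus.
  have hskew : ∀ i j, S.adX j (S.X i) = -S.adX i (S.X j) := fun i j =>
    Subtype.ext (lie_skew (S.X j) (S.X i)).symm
  rw [integral_congr_ae (Filter.Eventually.of_forall hsum),
    integral_add (integrable_finsetSum _ fun i _ => integrable_finsetSum _ fun j _ => hi1 i j)
      (integrable_finsetSum _ fun i _ => integrable_finsetSum _ fun j _ => hi2 i j),
    integral_finsetSum _ fun i _ => integrable_finsetSum _ fun j _ => hi1 i j,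
    integral_finsetSum _ fun i _ => integrable_finsetSum _ fun j _ => hi2 i j, mul_add, add_comm,
    Finset.mul_sum, Finset.mul_sum]
  refine congrArg₂ (· + ·) (Finset.sum_congr rfl fun i _ => ?_)
      (Finset.sum_congr rfl fun i _ => ?_)
  · rw [integral_finsetSum _ fun j _ => hi2 i j]
    simp only [integral_const_mul, hc]
    simp
    field_simp
  · rw [integral_finsetSum _ fun j _ => hi1 i j, trace_compAd, Finset.mul_sum, Finset.sum_mul]
    refine Finset.sum_congr rfl fun j _ => ?_
    rw [integral_const_mul, (integrable_coord_mul_covector hμ l j (S.adX j (S.X i))).2, hskew,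
      map_neg, map_neg, Finsupp.neg_apply]
    field_simp

/-- The limit which defines the microscopic Laplacian, for a probability measure on the vertical
covectors with finite second moments. -/
theorem tendsto_microLaplacian [T2Space G]
    (hμ : ∀ f : S.vertical q →ₗ[ℝ] ℝ, MemLp f 2 μ) (l : S.V₀ →ₗ[ℝ] S.layer 1) {f : G → ℝ}
    (hf : ContMDiff (𝓡 n) 𝓘(ℝ, ℝ) ∞ f) :
    Filter.Tendsto (fun t : ℝ => 2 * (S.rank : ℝ) / t ^ 2 *
        ∫ x, (f (S.normalExp q t ((S.graphComplement l).covector q x)) - f q)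
          ∂(cylinderMeasure q μ)) (𝓝[>] 0)
      (𝓝 (∑ i, derivAlong (S.XField i) (derivAlong (S.XField i) f) q +
        ∑ i, LinearMap.trace ℝ (GroupLieAlgebra (𝓡 n) G) (S.compAd l i) *
          derivAlong (S.XField i) f q)) := by
  obtain ⟨T, hT, C, hcont, hex⟩ := S.exists_normalExp_expansion hf q
  set V := S.graphComplement l with hV
  set d : S.Cylinder q → ℝ := fun x =>
    ∑ i, (x.1 : EuclideanSpace ℝ (Fin S.rank)) i * derivAlong (S.XField i) f q with hd
  -- The first-order term has mean zero but is not pointwise of order `t ^ 2`; it is removed before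
  -- the limit is taken under the integral.
  set r : ℝ → S.Cylinder q → ℝ := fun t x =>
    f (S.normalExp q t (V.covector q x)) - f q - t * d x with hr
  set N : S.Cylinder q → ℝ := fun x => ‖trivializeCovector q (V.covector q x)‖ with hN
  have hex' : ∀ x : S.Cylinder q, (∀ t ∈ Set.Ico 0 T, |r t x| ≤ C * (3 + 2 * N x) * t ^ 2) ∧
      Filter.Tendsto (fun t => r t x / t ^ 2) (𝓝[>] 0)
        (𝓝 (S.secondVariation f q (trivializeCovector q (V.covector q x)) / 2)) := by
    intro x
    have := hex _ (V.covector_mem_unitCovectors q x)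
    simpa only [LeftInvariantComplement.momentum_covector] using this
  have hdi : Integrable d (cylinderMeasure q μ) :=
    integrable_cylinder_of_sphere (S := S) (q := q) (μ := μ)
      (g := fun s => ∑ i, (s : EuclideanSpace ℝ (Fin S.rank)) i *
      derivAlong (S.XField i) f q)
      (continuous_finsetSum _ fun i _ => (continuous_sphere_coord i).mul_const _)
  have hd0 : ∫ x, d x ∂(cylinderMeasure q μ) = 0 := by
    refine (integral_cylinder_of_sphere (S := S) (q := q) (μ := μ) (fun s => ∑ i, (s : EuclideanSpace ℝ (Fin S.rank)) i *
      derivAlong (S.XField i) f q)).trans ?_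
    rw [integral_finsetSum _ fun i _ => (integrable_sphereMeasure _
      (continuous_sphere_coord i) rank_pos).mul_const _]
    simp [integral_mul_const, integral_sphere_coord]
  have hNi : Integrable N (cylinderMeasure q μ) := integrable_norm_covector hμ V
  have hrm : ∀ t ∈ Set.Ioo 0 T, AEStronglyMeasurable (r t) (cylinderMeasure q μ) := by
    intro t ht
    have h1 : Continuous fun x : S.Cylinder q => f (S.normalExp q t (V.covector q x)) :=
      (hcont t ⟨ht.1.le, ht.2⟩).comp_continuous (V.continuous_covector q)
        (V.covector_mem_unitCovectors q)
    have h2 : Continuous d := continuous_finsetSum _ fun i _ =>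
      ((continuous_sphere_coord i).comp continuous_fst).mul_const _
    exact ((h1.sub continuous_const).sub (h2.const_mul t)).aestronglyMeasurable
  have hri : ∀ t ∈ Set.Ioo 0 T, Integrable (r t) (cylinderMeasure q μ) := fun t ht =>
    ((((integrable_const 3).add (hNi.const_mul 2)).const_mul C).mul_const (t ^ 2)).mono' (hrm t ht)
      (Filter.Eventually.of_forall fun x => (hex' x).1 t ⟨ht.1.le, ht.2⟩)
  have hlim : Filter.Tendsto (fun t : ℝ => ∫ x, r t x / t ^ 2 ∂(cylinderMeasure q μ)) (𝓝[>] 0)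
      (𝓝 (∫ x, S.secondVariation f q (trivializeCovector q (V.covector q x)) / 2
        ∂(cylinderMeasure q μ))) := by
    refine tendsto_integral_filter_of_dominated_convergence (fun x => C * (3 + 2 * N x)) ?_ ?_
      (((integrable_const 3).add (hNi.const_mul 2)).const_mul C)
      (Filter.Eventually.of_forall fun x => (hex' x).2)
    · filter_upwards [Ioo_mem_nhdsGT hT] with t ht
      exact ((hri t ht).div_const _).aestronglyMeasurable
    · filter_upwards [Ioo_mem_nhdsGT hT] with t ht
      refine Filter.Eventually.of_forall fun x => ?_
      rw [Real.norm_eq_abs, abs_div, abs_of_nonneg (sq_nonneg t), div_le_iff₀ (pow_pos ht.1 2)]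
      exact (hex' x).1 t ⟨ht.1.le, ht.2⟩
  rw [integral_div] at hlim
  rw [← integral_secondVariation hμ l f]
  have hlim2 := hlim.const_mul (2 * (S.rank : ℝ))
  refine (hlim2.congr' ?_).trans_eq ?_
  · filter_upwards [Ioo_mem_nhdsGT hT] with t ht
    rw [integral_div]
    have h1 : ∫ x, (f (S.normalExp q t (V.covector q x)) - f q) ∂(cylinderMeasure q μ) =
        ∫ x, r t x ∂(cylinderMeasure q μ) := by
      have h2 : ∀ x, f (S.normalExp q t (V.covector q x)) - f q = r t x + t * d x := fun x => by
        rw [hr]; ring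
      rw [integral_congr_ae (Filter.Eventually.of_forall h2),
        integral_add (hri t ht) (hdi.const_mul t), integral_const_mul, hd0, mul_zero, add_zero]
    rw [h1]
    ring
  · congr 1
    ring

end moments

end CarnotStructure
end CarnotGroup

/-! ### Test functions, an adapted family, and the comparison of the two Laplacians. -/

namespace CarnotGroup

variable {n : ℕ} {G : Type*} [TopologicalSpace G] [ChartedSpace (EuclideanSpace ℝ (Fin n)) G]
  [Group G] [LieGroup (𝓡 n) ∞ G]

/-- On a smooth manifold there are smooth functions with nonzero derivative along a given
nonzero tangent vector. -/
lemma exists_contMDiff_mfderiv_ne_zero [T2Space G] (q : G) {v : EuclideanSpace ℝ (Fin n)}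
    (hv : v ≠ 0) : ∃ f : G → ℝ, ContMDiff (𝓡 n) 𝓘(ℝ, ℝ) ∞ f ∧
      (mfderiv (𝓡 n) 𝓘(ℝ, ℝ) f q : EuclideanSpace ℝ (Fin n) →L[ℝ] ℝ) v ≠ 0 := by
  let D : EuclideanSpace ℝ (Fin n) →L[ℝ] EuclideanSpace ℝ (Fin n) :=
    mfderiv (𝓡 n) 𝓘(ℝ, EuclideanSpace ℝ (Fin n)) (extChartAt (𝓡 n) q) q
  have hD : D v ≠ 0 := by
    obtain ⟨e, he⟩ := isInvertible_mfderiv_extChartAt (I := 𝓡 n) (mem_extChartAt_source (I := 𝓡 n) q)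
    let e' : EuclideanSpace ℝ (Fin n) ≃L[ℝ] EuclideanSpace ℝ (Fin n) := e
    have h1 : D v = e' v :=
      congrArg (fun A : EuclideanSpace ℝ (Fin n) →L[ℝ] EuclideanSpace ℝ (Fin n) => A v) he.symm
    rw [h1]
    exact fun h => hv (e'.injective (h.trans (map_zero e').symm))
  -- With this functional of the chart the derivative along `v` is `‖D v‖ ^ 2`; the bump function
  -- extends it to all of `G`.
  let c : EuclideanSpace ℝ (Fin n) →L[ℝ] ℝ := innerSL ℝ (D v)
  let b : SmoothBumpFunction (𝓡 n) q := Classical.arbitrary _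
  have hc : ContMDiffOn (𝓡 n) 𝓘(ℝ, ℝ) ∞ (fun x => c (extChartAt (𝓡 n) q x))
      (chartAt (EuclideanSpace ℝ (Fin n)) q).source :=
    c.contMDiff.comp_contMDiffOn contMDiffOn_extChartAt
  refine ⟨fun x => b x • c (extChartAt (𝓡 n) q x), b.contMDiff_smul hc, ?_⟩
  have h2 : (fun x => b x • c (extChartAt (𝓡 n) q x)) =ᶠ[𝓝 q]
      fun x => c (extChartAt (𝓡 n) q x) := by
    filter_upwards [b.eventuallyEq_one] with x hx
    simp [hx]
  have h3 : HasMFDerivAt (𝓡 n) 𝓘(ℝ, ℝ) (fun x => c (extChartAt (𝓡 n) q x)) q (c.comp D) :=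
    HasMFDerivAt.comp (g := c) (f := extChartAt (𝓡 n) q) q c.hasMFDerivAt
      (mdifferentiableAt_extChartAt (mem_chart_source _ q)).hasMFDerivAt
  have h4 := (h3.congr_of_eventuallyEq h2).mfderiv
  let B : EuclideanSpace ℝ (Fin n) →L[ℝ] ℝ :=
    mfderiv (𝓡 n) 𝓘(ℝ, ℝ) (fun x => b x • c (extChartAt (𝓡 n) q x)) q
  have h5 : B v = inner ℝ (D v) (D v) :=
    congrArg (fun A : EuclideanSpace ℝ (Fin n) →L[ℝ] ℝ => A v) h4
  change B v ≠ 0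
  rw [h5]
  exact inner_self_ne_zero.2 hD

namespace CarnotStructure

variable {S : CarnotStructure n G}

lemma sum_mul_derivAlong_XField (c : Fin S.rank → ℝ) (f : G → ℝ) (q : G) :
    ∑ i, c i * derivAlong (S.XField i) f q =
      mfderiv (𝓡 n) 𝓘(ℝ, ℝ) f q (leftDiff q (∑ i, c i • S.X i)) := by
  have e := S.sum_smul_XField q (WithLp.toLp 2 c)
  refine Eq.symm ((congrArg (mfderiv (𝓡 n) 𝓘(ℝ, ℝ) f q) e.symm).trans ?_)
  exact Covector.map_sum_smul (G := G) Finset.univ (mfderiv (𝓡 n) 𝓘(ℝ, ℝ) f q)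
    c (fun i => S.XField i q)

lemma eq_zero_of_sum_mul_derivAlong_eq_zero [T2Space G] {c : Fin S.rank → ℝ} (q : G)
    (h : ∀ f : G → ℝ, ContMDiff (𝓡 n) 𝓘(ℝ, ℝ) ∞ f → ∑ i, c i * derivAlong (S.XField i) f q = 0) :
    c = 0 := by
  have h1 : ∑ i, c i • S.X i = 0 := by
    by_contra hne
    have h2 : leftDiff q (∑ i, c i • S.X i) ≠ 0 := fun h0 => hne <|
      (leftDiffInv_leftDiff q _).symm.trans ((congrArg (leftDiffInv q) h0).trans (map_zero _))
    obtain ⟨f, hf, hne⟩ := exists_contMDiff_mfderiv_ne_zero q h2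
    exact hne ((sum_mul_derivAlong_XField c f q).symm.trans (h f hf))
  have h2 : ∑ i, c i • S.frame i = 0 := by
    apply Subtype.ext
    rw [AddSubmonoidClass.coe_finsetSum]
    exact h1
  funext i
  exact Fintype.linearIndependent_iff.1 S.frame.linearIndependent c h2 i

/-! ### The family of Dirac measures is adapted -/

lemma covector_ext {ξ η : Covector n} (h1 : ∀ i, ξ (S.X i) = η (S.X i))
    (h2 : ∀ v ∈ S.V₀, ξ v = η v) : ξ = η := by
  ext1 w
  let w' : GroupLieAlgebra (𝓡 n) G := w
  have hw : w' ∈ S.layer 1 ⊔ S.V₀ := by rw [S.isCompl_V₀.sup_eq_top]; exact Submodule.mem_top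
  obtain ⟨a, ha, b, hb, hab⟩ := Submodule.mem_sup.1 hw
  have h3 : a = ∑ i, S.frame.repr ⟨a, ha⟩ i • S.X i := by
    have := congrArg Subtype.val (S.frame.sum_repr ⟨a, ha⟩)
    rw [AddSubmonoidClass.coe_finsetSum] at this
    exact this.symm
  have h4 : ∀ ζ : Covector n, ζ w = ∑ i, S.frame.repr ⟨a, ha⟩ i * ζ (S.X i) + ζ b := fun ζ =>
    (congrArg ζ hab.symm).trans ((Covector.map_add ζ a b).trans
      (congrArg (· + ζ b) ((congrArg ζ h3).trans (Covector.map_sum_smul _ _ _ _))))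
  rw [h4 ξ, h4 η, h2 b hb]
  simp only [h1]

/-- Left invariance: both sides take the value `s i` on `X_i`, and on `V₀` a value that depends only
on `ℓ` and `s`. -/
lemma trivializeCovector_horizontalCovector (l : S.V₀ →ₗ[ℝ] S.layer 1) (q : G)
    (s : EuclideanSpace ℝ (Fin S.rank)) :
    trivializeCovector q ((S.graphComplement l).horizontalCovector q s) =
      trivializeCovector (1 : G) ((S.graphComplement l).horizontalCovector 1 s) := by
  refine covector_ext (S := S) (fun i => ?_) fun v hv => ?_
  · exact ((S.graphComplement l).horizontalCovector_XField q s i).trans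
      ((S.graphComplement l).horizontalCovector_XField 1 s i).symm
  · exact (horizontalCovector_graphComplement l q s ⟨v, hv⟩).trans
      (horizontalCovector_graphComplement l 1 s ⟨v, hv⟩).symm

/-- Without some adapted family compatibility would hold vacuously and force no condition on `ℓ`.
For these measures the integral depends on `q` only through the left trivialization of `Y q`, which
is continuous. -/
lemma isAdapted_dirac (l : S.V₀ →ₗ[ℝ] S.layer 1) :
    (S.graphComplement l).IsAdapted fun q => Measure.dirac (0 : S.vertical q) where
  isProbabilityMeasure _ := inferInstance
  twoDecreasing q f := (memLp_const (f 0)).ae_eq (ae_eq_dirac f).symm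
  continuous Y hY := by
    let h : EuclideanSpace ℝ (Fin n) → Metric.sphere (0 : EuclideanSpace ℝ (Fin S.rank)) 1 → ℝ :=
      fun m s => (trivializeCovector (1 : G) ((S.graphComplement l).horizontalCovector 1
        (s : EuclideanSpace ℝ (Fin S.rank))) m) ^ 2
    have hh : Continuous h.uncurry :=
      ((((continuous_trivializeCovector (n := n) (1 : G)).comp
        (((S.graphComplement l).continuous_horizontalCovector 1).comp
          continuous_subtype_val)).comp continuous_snd).clm_apply continuous_fst).pow 2
    have hc : Continuous fun m => ∫ s, h m s ∂(sphereMeasure S.rank) := by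
      have := continuous_parametric_integral_of_continuous (μ := sphereMeasure S.rank) hh
        isCompact_univ
      simpa only [Measure.restrict_univ] using this
    refine (hc.comp hY.continuous_maurerCartan).congr fun q => ?_
    have hm : Measurable fun s : Metric.sphere (0 : EuclideanSpace ℝ (Fin S.rank)) 1 =>
      (s, (0 : S.vertical q)) := by fun_prop
    have hcov : Continuous fun x : S.Cylinder q =>
        ((S.graphComplement l).covector q x (Y q : EuclideanSpace ℝ (Fin n))) ^ 2 :=
      (((S.graphComplement l).continuous_covector q).clm_apply continuous_const).pow 2
    refine Eq.symm ?_
    rw [cylinderMeasure, Measure.prod_dirac]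
    refine (integral_map hm.aemeasurable hcov.aestronglyMeasurable).trans ?_
    refine integral_congr_ae (Filter.Eventually.of_forall fun s => ?_)
    refine congrArg (· ^ 2) ?_
    have h1 := congrArg (fun A : Covector n => A (maurerCartan ⟨q, Y q⟩))
      (trivializeCovector_horizontalCovector l q (s : EuclideanSpace ℝ (Fin S.rank)))
    refine Eq.trans ?_ h1
    refine (add_zero ((S.graphComplement l).horizontalCovector q
      (s : EuclideanSpace ℝ (Fin S.rank)) (Y q))).trans ?_
    exact congrArg ((S.graphComplement l).horizontalCovector q
      (s : EuclideanSpace ℝ (Fin S.rank))) (leftDiff_leftDiffInv q (Y q)).symm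

/-- The characterization of the compatible left-invariant complements. -/
theorem compatibleWithPopp_iff [T2Space G] (l : S.V₀ →ₗ[ℝ] S.layer 1) :
    (S.graphComplement l).CompatibleWithPopp ↔
      ∀ i, LinearMap.trace ℝ (GroupLieAlgebra (𝓡 n) G) (S.compAd l i) = 0 := by
  constructor
  · intro h
    refine fun i => congrFun (eq_zero_of_sum_mul_derivAlong_eq_zero (S := S) (1 : G)
      (c := fun i => LinearMap.trace ℝ (GroupLieAlgebra (𝓡 n) G) (S.compAd l i)) ?_) i
    intro f hf
    have hμ := isAdapted_dirac l
    have h1 := h _ hμ f hf 1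
    have h2 := tendsto_microLaplacian (hμ.twoDecreasing 1) l hf
    -- Both limits concern the same family, so the first-order term with the traces as coefficients
    -- vanishes on every `f`.
    have h3 := tendsto_nhds_unique h1 h2
    rw [S.macroLaplacian_popp hf] at h3
    linarith
  · intro h μ hμ f hf q
    have := hμ.isProbabilityMeasure q
    have h2 := tendsto_microLaplacian (hμ.twoDecreasing q) l hf
    simp only [h, zero_mul, Finset.sum_const_zero, add_zero] at h2
    rwa [← S.macroLaplacian_popp hf] at h2

/-- In corank one, the compatible complements correspond to the kernel of the matrix of the
brackets. -/
lemma compatibleWithPopp_iff_mulVec [T2Space G] {Z : GroupLieAlgebra (𝓡 n) G}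
    {A : Matrix (Fin S.rank) (Fin S.rank) ℝ} (h2 : S.step = 2)
    (hZ : S.layer 2 = Submodule.span ℝ {Z}) (hA : ∀ i j, ⁅S.X i, S.X j⁆ = A i j • Z)
    (c : Fin S.rank → ℝ) (V : S.LeftInvariantComplement)
    (hV : V.fiber = leftTranslates (Submodule.span ℝ {Z + ∑ j, c j • S.X j})) :
    V.CompatibleWithPopp ↔ A.mulVec c = 0 := by
  obtain ⟨l, rfl, -⟩ := S.existsUnique_graphComplement V
  have hZ' := generator_mem_V₀ h2 hZ
  have hl := (graph_eq_span_iff h2 hZ hZ' l c).1 ((fiber_graphComplement_eq_iff l _).1 hV)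
  rw [compatibleWithPopp_iff, funext_iff]
  simp only [trace_compAd_eq_mulVec A hA hZ' l c hl, Pi.zero_apply]

/-- The complement with `c = 0` is always compatible, so uniqueness means that no other vector lies
in the kernel. -/
lemma existsUnique_compatible_iff [T2Space G] {Z : GroupLieAlgebra (𝓡 n) G}
    {A : Matrix (Fin S.rank) (Fin S.rank) ℝ} (h2 : S.step = 2)
    (hZ : S.layer 2 = Submodule.span ℝ {Z}) (hA : ∀ i j, ⁅S.X i, S.X j⁆ = A i j • Z) :
    (∃! V : S.LeftInvariantComplement, V.CompatibleWithPopp) ↔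
      ∀ c : Fin S.rank → ℝ, A.mulVec c = 0 → c = 0 := by
  obtain ⟨V₁, hV₁, -⟩ := existsUnique_complement_of_vector h2 hZ 0
  have hc₁ := (compatibleWithPopp_iff_mulVec h2 hZ hA 0 V₁ hV₁).2 (Matrix.mulVec_zero A)
  constructor
  · intro hu c hc
    obtain ⟨V, hV, -⟩ := existsUnique_complement_of_vector h2 hZ c
    have h3 := hu.unique ((compatibleWithPopp_iff_mulVec h2 hZ hA c V hV).2 hc) hc₁
    subst h3
    exact (existsUnique_vector_of_complement h2 hZ V).unique hV hV₁
  · refine fun hker => ⟨V₁, hc₁, fun V hV => ?_⟩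
    obtain ⟨c, hc, -⟩ := existsUnique_vector_of_complement h2 hZ V
    have h3 := hker c ((compatibleWithPopp_iff_mulVec h2 hZ hA c V hc).1 hV)
    subst h3
    exact (existsUnique_complement_of_vector h2 hZ 0).unique hc hV₁

end CarnotStructure
end CarnotGroup

end

theorem propositionp {n : ℕ} {G : Type*} [TopologicalSpace G] [T2Space G]
    [ChartedSpace (EuclideanSpace ℝ (Fin n)) G] [Group G] [LieGroup (𝓡 n) ∞ G]
    [SimplyConnectedSpace G] (S : CarnotGroup.CarnotStructure n G) :
    -- every left-invariant complement is the graph of a unique linear map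
    (∀ V : S.LeftInvariantComplement, ∃! l : S.V₀ →ₗ[ℝ] S.layer 1, V = S.graphComplement l) ∧
    -- the characterization of the compatible ones
    (∀ l : S.V₀ →ₗ[ℝ] S.layer 1, (S.graphComplement l).CompatibleWithPopp ↔
      ∀ i, LinearMap.trace ℝ (GroupLieAlgebra (𝓡 n) G) (S.compAd l i) = 0) ∧
    -- the maps that vanish on the second layer
    (∀ l : S.V₀ →ₗ[ℝ] S.layer 1, (∀ v : S.V₀, (v : GroupLieAlgebra (𝓡 n) G) ∈ S.layer 2 → l v = 0) →
      (S.graphComplement l).CompatibleWithPopp) ∧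
    (3 ≤ S.step →
      (∃ l : S.V₀ →ₗ[ℝ] S.layer 1, l ≠ 0 ∧
        ∀ v : S.V₀, (v : GroupLieAlgebra (𝓡 n) G) ∈ S.layer 2 → l v = 0) ∧
      ∃ V W : S.LeftInvariantComplement,
        V ≠ W ∧ V.CompatibleWithPopp ∧ W.CompatibleWithPopp) ∧
    -- the case of corank one
    (∀ (Z : GroupLieAlgebra (𝓡 n) G) (A : Matrix (Fin S.rank) (Fin S.rank) ℝ),
      S.step = 2 → S.layer 2 = Submodule.span ℝ {Z} → (∀ i j, ⁅S.X i, S.X j⁆ = A i j • Z) →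
      (∀ c : Fin S.rank → ℝ, ∃! V : S.LeftInvariantComplement,
        V.fiber = CarnotGroup.leftTranslates (Submodule.span ℝ {Z + ∑ j, c j • S.X j})) ∧
      (∀ V : S.LeftInvariantComplement, ∃! c : Fin S.rank → ℝ,
        V.fiber = CarnotGroup.leftTranslates (Submodule.span ℝ {Z + ∑ j, c j • S.X j})) ∧
      (∀ (c : Fin S.rank → ℝ) (V : S.LeftInvariantComplement),
        V.fiber = CarnotGroup.leftTranslates (Submodule.span ℝ {Z + ∑ j, c j • S.X j}) →
        (V.CompatibleWithPopp ↔ A.mulVec c = 0)) ∧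
      ((∃! V : S.LeftInvariantComplement, V.CompatibleWithPopp) ↔
        ∀ c : Fin S.rank → ℝ, A.mulVec c = 0 → c = 0)) := by
  refine ⟨S.existsUnique_graphComplement, CarnotGroup.CarnotStructure.compatibleWithPopp_iff,
    fun l hl => CarnotGroup.CarnotStructure.compatibleWithPopp_iff l |>.2
      (S.trace_compAd_eq_zero hl), fun h3 => ?_, fun Z A h2 hZ hA => ?_⟩
  · obtain ⟨l, hl, hl2⟩ := S.exists_ne_zero_vanishing_on_layer_two h3
    -- Both `l` and `0` vanish on the second layer, and distinct maps have distinct graphs.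
    refine ⟨⟨l, hl, hl2⟩, S.graphComplement l, S.graphComplement 0,
      fun h => hl (S.graphComplement_injective h), ?_, ?_⟩
    · exact (CarnotGroup.CarnotStructure.compatibleWithPopp_iff l).2 (S.trace_compAd_eq_zero hl2)
    · exact (CarnotGroup.CarnotStructure.compatibleWithPopp_iff 0).2
        (S.trace_compAd_eq_zero fun _ _ => rfl)
  · exact ⟨CarnotGroup.CarnotStructure.existsUnique_complement_of_vector h2 hZ,
      CarnotGroup.CarnotStructure.existsUnique_vector_of_complement h2 hZ,
      CarnotGroup.CarnotStructure.compatibleWithPopp_iff_mulVec h2 hZ hA,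
      CarnotGroup.CarnotStructure.existsUnique_compatible_iff h2 hZ hA⟩
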